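/- **Conventions.** All algebras are unital, over $\mathbb{C}$. Let $(A,\Delta,\epsilon,S,*)$ be a Hopf $*$-algebra (so $\Delta$ is a $*$-homomorphism; $S$ is then bijective with $S^{-1}=*\circ S\circ *$), and let $B$ be a left $A$-comodule $*$-algebra, i.e. a $*$-algebra with a coaction $\delta:B\to A\otimes B$, $\delta(b)=b_{(-1)}\otimes b_{(0)}$, that is a $*$-homomorphism. Let ${}^{A}_{B}\mathcal M_{B}$ be the category of relative Hopf modules: $B$-bimodules $M$ with a left $A$-coaction such that $\delta(bm)=\delta(b)\delta(m)$ and $\delta(mb)=\delta(m)\delta(b)$, with $B$-bilinear $A$-colinear maps as morphisms; it is monoidal under $\otimes_B$ with the diagonal coaction and with unit $B$. It is a bar category: $\overline M$ is the conjugate vector space with $b\,\overline m=\overline{mb^*}$, $\overline m\,b=\overline{b^*m}$, $\delta(\overline m)=m_{(-1)}^*\otimes\overline{m_{(0)}}$, and $\overline f(\overline m)=\overline{f(m)}$, $\mathrm{bb}_M(m)=\overline{\overline m}$, $\star(b)=\overline{b^*}$, $\Upsilon_{M,N}(\overline{m\otimes n})=\overline n\otimes\overline m$. Let $\gamma:A\otimes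 A\to\mathbb C$ be a unital $2$-cocycle with convolution inverse $\overline\gamma$, that is, $\gamma(g_{(1)}\otimes h_{(1)})\gamma(g_{(2)}h_{(2)}\otimes k)=\gamma(h_{(1)}\otimes k_{(1)})\gamma(g\otimes h_{(2)}k_{(2)})$ and $\gamma(h\otimes 1)=\epsilon(h)=\gamma(1\otimes h)$. Assume that $\gamma$ is unitary: $\overline{\gamma(a\otimes b)}=\overline\gamma(S(a)^*\otimes S(b)^*)$ for all $a,b\in A$. Put $$U(k)=\gamma(k_{(1)}\otimes S(k_{(2)})),\quad \overline U(k)=\overline\gamma(S(k_{(1)})\otimes k_{(2)}),\quad V=U\circ S^{-1},\quad \overline V=\overline U\circ S^{-1}.$$ Let $A_\gamma$ be the coalgebra $A$ with the product $h\cdot_\gamma k=\gamma(h_{(1)}\otimes k_{(1)})h_{(2)}k_{(2)}\overline\gamma(h_{(3)}\otimes k_{(3)})$, and let $B_\gamma$ be the comodule $B$ with the product $a\cdot_\gamma b=\gamma(a_{(-1)}\otimes b_{(-1)})a_{(0)}b_{(0)}$. Let $\Gamma:{}^{A}_{B}\mathcal M_{B}\to{}^{A_\gamma}_{B_\gamma}\mathcal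 M_{B_\gamma}$ be the functor that sends $M$ to the comodule $M$ with the actions $b\cdot_\gamma m=\gamma(b_{(-1)}\otimes m_{(-1)})b_{(0)}m_{(0)}$ and $m\cdot_\gamma b=\gamma(m_{(-1)}\otimes b_{(-1)})m_{(0)}b_{(0)}$, and that is the identity on the linear maps underlying morphisms. **Theorem.** $A_\gamma$ is a Hopf $*$-algebra with antipode $S_\gamma(h)=U(h_{(1)})S(h_{(2)})\overline U(h_{(3)})$ and involution $h^{*_\gamma}=\overline V(h_{(1)}^*)\,h_{(2)}^*\,V(h_{(3)}^*)$, and $B_\gamma$ is a left $A_\gamma$-comodule $*$-algebra with involution $b^{*_\gamma}=\overline V(b_{(-1)}^*)\,b_{(0)}^*$, so that ${}^{A_\gamma}_{B_\gamma}\mathcal M_{B_\gamma}$ is a bar category. The functor $\Gamma$ is a monoidal equivalence with structure maps $f^1=\mathrm{id}:B_\gamma\to\Gamma(B)$ and $$\varphi_{M,N}:\Gamma(M)\otimes_{B_\gamma}\Gamma(N)\to\Gamma(M\otimes_BN),\qquad m\otimes n\mapsto\gamma(m_{(-1)}\otimes n_{(-1)})\,m_{(0)}\otimes n_{(0)},$$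 and the maps $$\mathfrak N_M:\overline{\Gamma(M)}\to\Gamma(\overline M),\qquad \mathfrak N_M(\overline e)=\overline V(e_{(-1)}^*)\,\overline{e_{(0)}},$$ form a natural isomorphism $\mathrm{bar}\circ\Gamma\cong\Gamma\circ\mathrm{bar}$ such that, with $\mathrm{fb}=\mathfrak N$, the functor $\Gamma$ is a bar functor; that is, for all objects $M,N$, 1. $\mathrm{fb}_{B}\circ\overline{f^1}\circ\star_{B_\gamma}=\Gamma(\star_B)\circ f^1$; 2. $\Gamma(\mathrm{bb}_M)=\mathrm{fb}_{\overline M}\circ\overline{\mathrm{fb}_M}\circ\mathrm{bb}_{\Gamma(M)}$; 3. $(\mathrm{fb}_N\otimes\mathrm{fb}_M)\circ\Upsilon_{\Gamma(M),\Gamma(N)}\circ\overline{\varphi_{M,N}^{-1}}=\varphi^{-1}_{\overline N,\overline M}\circ\Gamma(\Upsilon_{M,N})\circ\mathrm{fb}_{M\otimes N}$. -/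

import Mathlib

open scoped TensorProduct
open TensorProduct CategoryTheory MonoidalCategory

universe u v

set_option linter.unusedSectionVars false
set_option linter.unusedSimpArgs false


namespace RelativeHopf

section Contraction

variable {M N M' N' P : Type*}
  [AddCommGroup M] [Module ℂ M] [AddCommGroup N] [Module ℂ N]
  [AddCommGroup M'] [Module ℂ M'] [AddCommGroup N'] [Module ℂ N']
  [AddCommGroup P] [Module ℂ P]

/-- `contractL F G (x₁ ⊗ x₂) (y₁ ⊗ y₂) = F x₁ y₁ • G x₂ y₂`. -/
noncomputable def contractL (F : M →ₗ[ℂ] N →ₗ[ℂ] ℂ) (G : M' →ₗ[ℂ] N' →ₗ[ℂ] P) :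
    M ⊗[ℂ] M' →ₗ[ℂ] N ⊗[ℂ] N' →ₗ[ℂ] P :=
  (map₂ F G).compr₂ (TensorProduct.lid ℂ P).toLinearMap

/-- `contractR G F (x₁ ⊗ x₂) (y₁ ⊗ y₂) = F x₂ y₂ • G x₁ y₁`. -/
noncomputable def contractR (G : M →ₗ[ℂ] N →ₗ[ℂ] P) (F : M' →ₗ[ℂ] N' →ₗ[ℂ] ℂ) :
    M ⊗[ℂ] M' →ₗ[ℂ] N ⊗[ℂ] N' →ₗ[ℂ] P :=
  (map₂ G F).compr₂ (TensorProduct.rid ℂ P).toLinearMap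

@[simp] theorem contractL_tmul (F : M →ₗ[ℂ] N →ₗ[ℂ] ℂ) (G : M' →ₗ[ℂ] N' →ₗ[ℂ] P)
    (a : M) (m : M') (b : N) (n : N') :
    contractL F G (a ⊗ₜ m) (b ⊗ₜ n) = F a b • G m n := by
  simp [contractL]

@[simp] theorem contractR_tmul (G : M →ₗ[ℂ] N →ₗ[ℂ] P) (F : M' →ₗ[ℂ] N' →ₗ[ℂ] ℂ)
    (a : M) (m : M') (b : N) (n : N') :
    contractR G F (a ⊗ₜ m) (b ⊗ₜ n) = F m n • G a b := by
  simp [contractR]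

end Contraction

/-- A left coaction of a coalgebra: a coassociative and counital linear map `M → A ⊗ M`. -/
structure IsCoaction {A M : Type*} [AddCommGroup A] [Module ℂ A] [Coalgebra ℂ A]
    [AddCommGroup M] [Module ℂ M] (δ : M →ₗ[ℂ] A ⊗[ℂ] M) : Prop where
  counit : ∀ m, TensorProduct.lid ℂ M ((Coalgebra.counit (R := ℂ) (A := A)).rTensor M (δ m)) = m
  coassoc : ∀ m, TensorProduct.assoc ℂ A A M ((Coalgebra.comul (R := ℂ) (A := A)).rTensor M (δ m))
    = δ.lTensor A (δ m)

section twist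
variable {A M N P Q R S T : Type*} [AddCommGroup A] [Module ℂ A]
  [AddCommGroup M] [Module ℂ M] [AddCommGroup N] [Module ℂ N]
  [AddCommGroup P] [Module ℂ P] [AddCommGroup Q] [Module ℂ Q]
  [AddCommGroup R] [Module ℂ R] [AddCommGroup S] [Module ℂ S] [AddCommGroup T] [Module ℂ T]

/-- Associativity of two bilinear pairings is preserved by twisting with a functional `f`
satisfying the cocycle identity. -/
theorem twist_assoc (Δ : A →ₗ[ℂ] A ⊗[ℂ] A) (mul : A →ₗ[ℂ] A →ₗ[ℂ] A) (f : A →ₗ[ℂ] A →ₗ[ℂ] ℂ)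
    (hf : ∀ g h k, contractL f (mul.compr₂ (f.flip k)) (Δ g) (Δ h)
      = contractL f (mul.compr₂ (f g)) (Δ h) (Δ k))
    (δM : M →ₗ[ℂ] A ⊗[ℂ] M) (δN : N →ₗ[ℂ] A ⊗[ℂ] N) (δP : P →ₗ[ℂ] A ⊗[ℂ] P)
    (δQ : Q →ₗ[ℂ] A ⊗[ℂ] Q) (δS : S →ₗ[ℂ] A ⊗[ℂ] S)
    (hM : ∀ m, TensorProduct.assoc ℂ A A M (Δ.rTensor M (δM m)) = δM.lTensor A (δM m))
    (hN : ∀ m, TensorProduct.assoc ℂ A A N (Δ.rTensor N (δN m)) = δN.lTensor A (δN m))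
    (hQ : ∀ m, TensorProduct.assoc ℂ A A Q (Δ.rTensor Q (δQ m)) = δQ.lTensor A (δQ m))
    (p : M →ₗ[ℂ] N →ₗ[ℂ] P) (hp : ∀ m n, δP (p m n) = map₂ mul p (δM m) (δN n))
    (s : N →ₗ[ℂ] Q →ₗ[ℂ] S) (hs : ∀ n q, δS (s n q) = map₂ mul s (δN n) (δQ q))
    (r : P →ₗ[ℂ] Q →ₗ[ℂ] R) (t : M →ₗ[ℂ] S →ₗ[ℂ] R)
    (h : ∀ m n q, r (p m n) q = t m (s n q)) (m : M) (n : N) (q : Q) :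
    contractL f r (δP (contractL f p (δM m) (δN n))) (δQ q)
      = contractL f t (δM m) (δS (contractL f s (δN n) (δQ q))) := by
  have h1 : ∀ x y, δP (contractL f p x y)
      = contractL f (map₂ mul p) (δM.lTensor A x) (δN.lTensor A y) := by
    intro x y
    induction x with
    | zero => simp only [LinearMap.map_zero, LinearMap.zero_apply]
    | add x x' hx hx' => simp only [LinearMap.map_add, LinearMap.add_apply, hx, hx']
    | tmul a m =>
      induction y with
      | zero => simp only [LinearMap.map_zero]
      | add x x' hx hx' => simp only [LinearMap.map_add, hx, hx']
      | tmul b n => simp [hp]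
  have h2 : ∀ x y, δS (contractL f s x y)
      = contractL f (map₂ mul s) (δN.lTensor A x) (δQ.lTensor A y) := by
    intro x y
    induction x with
    | zero => simp only [LinearMap.map_zero, LinearMap.zero_apply]
    | add x x' hx hx' => simp only [LinearMap.map_add, LinearMap.add_apply, hx, hx']
    | tmul a m =>
      induction y with
      | zero => simp only [LinearMap.map_zero]
      | add x x' hx hx' => simp only [LinearMap.map_add, hx, hx']
      | tmul b n => simp [hs]
  rw [h1, h2, ← hM, ← hN, ← hQ]
  generalize δM m = x
  generalize δN n = y
  generalize δQ q = z
  induction x with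
  | zero => simp only [LinearMap.map_zero, LinearEquiv.map_zero, LinearMap.zero_apply]
  | add x x' hx hx' => simp only [LinearMap.map_add, LinearEquiv.map_add,
         LinearMap.add_apply, hx, hx']
  | tmul a m =>
  induction y with
  | zero => simp only [LinearMap.map_zero, LinearEquiv.map_zero, LinearMap.zero_apply]
  | add x x' hx hx' => simp only [LinearMap.map_add, LinearEquiv.map_add,
         LinearMap.add_apply, hx, hx']
  | tmul b n =>
  induction z with
  | zero => simp only [LinearMap.map_zero, LinearEquiv.map_zero]
  | add x x' hx hx' => simp only [LinearMap.map_add, LinearEquiv.map_add,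
         hx, hx']
  | tmul c q =>
  have e1 : ∀ x y, contractL f r (contractL f (map₂ mul p) (TensorProduct.assoc ℂ A A M (x ⊗ₜ m))
      (TensorProduct.assoc ℂ A A N (y ⊗ₜ n))) (c ⊗ₜ q)
      = contractL f (mul.compr₂ (f.flip c)) x y • r (p m n) q := by
    intro x y
    induction x with
    | zero =>
      simp only [LinearMap.map_zero, LinearEquiv.map_zero, LinearMap.zero_apply, zero_tmul,
        zero_smul]
    | add x x' hx hx' => simp only [LinearMap.map_add, LinearEquiv.map_add,
           add_tmul, add_smul, LinearMap.add_apply, hx, hx']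
    | tmul a a' =>
      induction y with
      | zero =>
        simp only [LinearMap.map_zero, LinearEquiv.map_zero, LinearMap.zero_apply, zero_tmul,
          zero_smul]
      | add x x' hx hx' => simp only [LinearMap.map_add, LinearEquiv.map_add,
             add_tmul, add_smul, LinearMap.add_apply, hx, hx']
      | tmul b b' => simp [smul_smul]
  have e2 : ∀ x y, contractL f t (a ⊗ₜ m) (contractL f (map₂ mul s)
      (TensorProduct.assoc ℂ A A N (x ⊗ₜ n)) (TensorProduct.assoc ℂ A A Q (y ⊗ₜ q)))
      = contractL f (mul.compr₂ (f a)) x y • t m (s n q) := by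
    intro x y
    induction x with
    | zero =>
      simp only [LinearMap.map_zero, LinearEquiv.map_zero, LinearMap.zero_apply, zero_tmul,
        zero_smul]
    | add x x' hx hx' => simp only [LinearMap.map_add, LinearEquiv.map_add,
           add_tmul, add_smul, LinearMap.add_apply, hx, hx']
    | tmul a a' =>
      induction y with
      | zero => simp only [LinearMap.map_zero, LinearEquiv.map_zero, zero_tmul, zero_smul]
      | add x x' hx hx' => simp only [LinearMap.map_add, LinearEquiv.map_add,
             add_tmul, add_smul, hx, hx']
      | tmul b b' => simp [smul_smul]
  simp only [LinearMap.rTensor_tmul]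
  rw [e1, e2, hf, h]

end twist

section cocycle
open Coalgebra

/-- A unital `2`-cocycle `γ : A ⊗ A → ℂ` (written as a bilinear map `toFun`) on a bialgebra,
together with its convolution inverse `inv`. -/
structure TwoCocycle (A : Type*) [Ring A] [Bialgebra ℂ A] where
  toFun : A →ₗ[ℂ] A →ₗ[ℂ] ℂ
  inv : A →ₗ[ℂ] A →ₗ[ℂ] ℂ
  mul_inv : ∀ a b, contractL toFun inv (comul a) (comul b) = counit (R := ℂ) a * counit (R := ℂ) b
  inv_mul : ∀ a b, contractL inv toFun (comul a) (comul b) = counit (R := ℂ) a * counit (R := ℂ) b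
  /-- `γ(g₁ ⊗ h₁) γ(g₂h₂ ⊗ k) = γ(h₁ ⊗ k₁) γ(g ⊗ h₂k₂)` -/
  cocycle : ∀ g h k,
    contractL toFun ((LinearMap.mul ℂ A).compr₂ (toFun.flip k)) (comul g) (comul h)
      = contractL toFun ((LinearMap.mul ℂ A).compr₂ (toFun g)) (comul h) (comul k)
  map_one_right : ∀ h, toFun h 1 = counit (R := ℂ) h
  map_one_left : ∀ h, toFun 1 h = counit (R := ℂ) h

variable {A : Type*} [Ring A] [Bialgebra ℂ A]

/-- `a ⊗ b ⊗ c ↦ ε(c) a ⊗ b` -/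
noncomputable def projL (A : Type*) [Ring A] [Bialgebra ℂ A] :
    (A ⊗[ℂ] A) ⊗[ℂ] A →ₗc[ℂ] A ⊗[ℂ] A :=
  (Coalgebra.TensorProduct.rid ℂ ℂ (A ⊗[ℂ] A)).toCoalgHom.comp
    (Coalgebra.TensorProduct.map (CoalgHom.id ℂ (A ⊗[ℂ] A)) (counitCoalgHom ℂ A))

/-- `a ⊗ b ⊗ c ↦ ab ⊗ c` -/
noncomputable def mulL (A : Type*) [Ring A] [Bialgebra ℂ A] :
    (A ⊗[ℂ] A) ⊗[ℂ] A →ₗc[ℂ] A ⊗[ℂ] A :=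
  Coalgebra.TensorProduct.map (Bialgebra.mulCoalgHom ℂ A) (CoalgHom.id ℂ A)

/-- `a ⊗ b ⊗ c ↦ ε(a) b ⊗ c` -/
noncomputable def projR (A : Type*) [Ring A] [Bialgebra ℂ A] :
    (A ⊗[ℂ] A) ⊗[ℂ] A →ₗc[ℂ] A ⊗[ℂ] A :=
  ((Coalgebra.TensorProduct.lid ℂ (A ⊗[ℂ] A)).toCoalgHom.comp
    (Coalgebra.TensorProduct.map (counitCoalgHom ℂ A) (CoalgHom.id ℂ (A ⊗[ℂ] A)))).comp
    (Coalgebra.TensorProduct.assoc ℂ ℂ A A A).toCoalgHom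

/-- `a ⊗ b ⊗ c ↦ a ⊗ bc` -/
noncomputable def mulR (A : Type*) [Ring A] [Bialgebra ℂ A] :
    (A ⊗[ℂ] A) ⊗[ℂ] A →ₗc[ℂ] A ⊗[ℂ] A :=
  (Coalgebra.TensorProduct.map (CoalgHom.id ℂ A) (Bialgebra.mulCoalgHom ℂ A)).comp
    (Coalgebra.TensorProduct.assoc ℂ ℂ A A A).toCoalgHom

theorem projL_tmul (a b c : A) : projL A ((a ⊗ₜ b) ⊗ₜ c) = counit (R := ℂ) c • (a ⊗ₜ b) := rfl
theorem mulL_tmul (a b c : A) : mulL A ((a ⊗ₜ b) ⊗ₜ c) = (a * b) ⊗ₜ c := rfl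
theorem projR_tmul (a b c : A) : projR A ((a ⊗ₜ b) ⊗ₜ c) = counit (R := ℂ) a • (b ⊗ₜ c) := rfl
theorem mulR_tmul (a b c : A) : mulR A ((a ⊗ₜ b) ⊗ₜ c) = a ⊗ₜ (b * c) := rfl

/-- pull back a bilinear functional along a coalgebra map -/
noncomputable def pull (f : A →ₗ[ℂ] A →ₗ[ℂ] ℂ) (p : (A ⊗[ℂ] A) ⊗[ℂ] A →ₗc[ℂ] A ⊗[ℂ] A) :
    WithConv ((A ⊗[ℂ] A) ⊗[ℂ] A →ₗ[ℂ] ℂ) :=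
  WithConv.toConv ((TensorProduct.lift f).comp p.toLinearMap)

theorem conv_triple (f g : WithConv ((A ⊗[ℂ] A) ⊗[ℂ] A →ₗ[ℂ] ℂ)) (a b c : A) :
    (f * g) ((a ⊗ₜ b) ⊗ₜ c) =
      LinearMap.mul' ℂ ℂ (TensorProduct.map f.ofConv g.ofConv
        (TensorProduct.tensorTensorTensorComm ℂ _ _ _ _
          ((TensorProduct.tensorTensorTensorComm ℂ _ _ _ _ (comul a ⊗ₜ comul b)) ⊗ₜ comul c))) :=
  rfl

theorem lid_counit_comul (a : A) :
    TensorProduct.lid ℂ A ((counit (R := ℂ) (A := A)).rTensor A (comul a)) = a := by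
  rw [Coalgebra.rTensor_counit_comul]; simp

theorem rid_counit_comul (a : A) :
    TensorProduct.rid ℂ A ((counit (R := ℂ) (A := A)).lTensor A (comul a)) = a := by
  rw [Coalgebra.lTensor_counit_comul]; simp

theorem pull_projL_mulL (f g : A →ₗ[ℂ] A →ₗ[ℂ] ℂ) (a b c : A) :
    (pull f (projL A) * pull g (mulL A)) ((a ⊗ₜ b) ⊗ₜ c)
      = contractL f ((LinearMap.mul ℂ A).compr₂ (g.flip c)) (comul a) (comul b) := by
  rw [conv_triple]
  conv_rhs => rw [← lid_counit_comul c]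
  generalize comul (R := ℂ) a = x
  generalize comul (R := ℂ) b = y
  generalize comul (R := ℂ) c = z
  induction x with
  | zero => simp only [LinearMap.map_zero, LinearEquiv.map_zero, LinearMap.zero_apply, zero_tmul]
  | add x x' hx hx' => simp only [LinearMap.map_add, LinearEquiv.map_add,
         add_tmul, LinearMap.add_apply, hx, hx']
  | tmul a a' =>
  induction y with
  | zero => simp only [LinearMap.map_zero, LinearEquiv.map_zero, zero_tmul, tmul_zero]
  | add x x' hx hx' => simp only [LinearMap.map_add, LinearEquiv.map_add,
         tmul_add, add_tmul, hx, hx']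
  | tmul b b' =>
  induction z with
  | zero => simp
  | add x x' hx hx' =>
    simp only [LinearMap.map_add, LinearEquiv.map_add,
           tmul_add, hx, hx', contractL_tmul, LinearMap.compr₂_apply,
      LinearMap.flip_apply, LinearMap.add_apply, smul_add]
  | tmul c c' =>
    simp [pull, projL_tmul, mulL_tmul]; ring

theorem pull_mulL_projL (f g : A →ₗ[ℂ] A →ₗ[ℂ] ℂ) (a b c : A) :
    (pull g (mulL A) * pull f (projL A)) ((a ⊗ₜ b) ⊗ₜ c)
      = contractR ((LinearMap.mul ℂ A).compr₂ (g.flip c)) f (comul a) (comul b) := by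
  rw [conv_triple]
  conv_rhs => rw [← rid_counit_comul c]
  generalize comul (R := ℂ) a = x
  generalize comul (R := ℂ) b = y
  generalize comul (R := ℂ) c = z
  induction x with
  | zero => simp only [LinearMap.map_zero, LinearEquiv.map_zero, LinearMap.zero_apply, zero_tmul]
  | add x x' hx hx' => simp only [LinearMap.map_add, LinearEquiv.map_add,
         add_tmul, LinearMap.add_apply, hx, hx']
  | tmul a a' =>
  induction y with
  | zero => simp only [LinearMap.map_zero, LinearEquiv.map_zero, zero_tmul, tmul_zero]
  | add x x' hx hx' => simp only [LinearMap.map_add, LinearEquiv.map_add,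
         tmul_add, add_tmul, hx, hx']
  | tmul b b' =>
  induction z with
  | zero => simp
  | add x x' hx hx' =>
    simp only [LinearMap.map_add, LinearEquiv.map_add,
           tmul_add, hx, hx', contractR_tmul, LinearMap.compr₂_apply,
      LinearMap.flip_apply, LinearMap.add_apply, smul_add]
  | tmul c c' =>
    simp [pull, projL_tmul, mulL_tmul]; ring

theorem pull_projR_mulR (f g : A →ₗ[ℂ] A →ₗ[ℂ] ℂ) (a b c : A) :
    (pull f (projR A) * pull g (mulR A)) ((a ⊗ₜ b) ⊗ₜ c)
      = contractL f ((LinearMap.mul ℂ A).compr₂ (g a)) (comul b) (comul c) := by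
  rw [conv_triple]
  conv_rhs => rw [← lid_counit_comul a]
  generalize comul (R := ℂ) a = x
  generalize comul (R := ℂ) b = y
  generalize comul (R := ℂ) c = z
  induction y with
  | zero =>
    simp only [LinearMap.map_zero, LinearEquiv.map_zero, LinearMap.zero_apply, zero_tmul, tmul_zero]
  | add x x' hx hx' => simp only [LinearMap.map_add, LinearEquiv.map_add,
         tmul_add, add_tmul, LinearMap.add_apply, hx, hx']
  | tmul b b' =>
  induction z with
  | zero => simp only [LinearMap.map_zero, LinearEquiv.map_zero, tmul_zero]
  | add x x' hx hx' => simp only [LinearMap.map_add, LinearEquiv.map_add, tmul_add, hx, hx']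
  | tmul c c' =>
  induction x with
  | zero => simp
  | add x x' hx hx' =>
    simp only [LinearMap.map_add, LinearEquiv.map_add,
           add_tmul, hx, hx', contractL_tmul, LinearMap.compr₂_apply,
      LinearMap.add_apply, smul_add]
  | tmul a a' =>
    simp [pull, projR_tmul, mulR_tmul]; ring

theorem pull_mulR_projR (f g : A →ₗ[ℂ] A →ₗ[ℂ] ℂ) (a b c : A) :
    (pull g (mulR A) * pull f (projR A)) ((a ⊗ₜ b) ⊗ₜ c)
      = contractR ((LinearMap.mul ℂ A).compr₂ (g a)) f (comul b) (comul c) := by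
  rw [conv_triple]
  conv_rhs => rw [← rid_counit_comul a]
  generalize comul (R := ℂ) a = x
  generalize comul (R := ℂ) b = y
  generalize comul (R := ℂ) c = z
  induction y with
  | zero =>
    simp only [LinearMap.map_zero, LinearEquiv.map_zero, LinearMap.zero_apply, zero_tmul, tmul_zero]
  | add x x' hx hx' => simp only [LinearMap.map_add, LinearEquiv.map_add,
         tmul_add, add_tmul, LinearMap.add_apply, hx, hx']
  | tmul b b' =>
  induction z with
  | zero => simp only [LinearMap.map_zero, LinearEquiv.map_zero, tmul_zero]
  | add x x' hx hx' => simp only [LinearMap.map_add, LinearEquiv.map_add, tmul_add, hx, hx']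
  | tmul c c' =>
  induction x with
  | zero => simp
  | add x x' hx hx' =>
    simp only [LinearMap.map_add, LinearEquiv.map_add,
           add_tmul, hx, hx', contractR_tmul, LinearMap.compr₂_apply,
      LinearMap.add_apply, smul_add]
  | tmul a a' =>
    simp [pull, projR_tmul, mulR_tmul]; ring

theorem pull_mul_eq_one (f g : A →ₗ[ℂ] A →ₗ[ℂ] ℂ)
    (h : ∀ a b, contractL f g (comul a) (comul b) = counit (R := ℂ) a * counit (R := ℂ) b)
    (p : (A ⊗[ℂ] A) ⊗[ℂ] A →ₗc[ℂ] A ⊗[ℂ] A) : pull f p * pull g p = 1 := by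
  have h0 : WithConv.toConv (TensorProduct.lift f) * WithConv.toConv (TensorProduct.lift g)
      = (1 : WithConv (A ⊗[ℂ] A →ₗ[ℂ] ℂ)) := by
    apply WithConv.ofConv_injective
    apply TensorProduct.ext'
    intro a b
    have e : ∀ x y : A ⊗[ℂ] A, LinearMap.mul' ℂ ℂ (TensorProduct.map (TensorProduct.lift f)
        (TensorProduct.lift g) (TensorProduct.tensorTensorTensorComm ℂ _ _ _ _ (x ⊗ₜ y)))
        = contractL f g x y := by
      intro x y
      induction x with
      | zero =>
        simp only [LinearMap.map_zero, LinearEquiv.map_zero, LinearMap.zero_apply, zero_tmul]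
      | add x x' hx hx' => simp only [LinearMap.map_add, LinearEquiv.map_add,
             add_tmul, LinearMap.add_apply, hx, hx']
      | tmul a a' =>
      induction y with
      | zero => simp only [LinearMap.map_zero, LinearEquiv.map_zero, tmul_zero]
      | add x x' hx hx' => simp only [LinearMap.map_add, LinearEquiv.map_add, tmul_add, hx, hx']
      | tmul b b' => simp
    refine (e (comul a) (comul b)).trans ((h a b).trans ?_)
    simp [mul_comm]
  have h1 := LinearMap.convMul_comp_coalgHom_distrib (WithConv.toConv (TensorProduct.lift f))
    (WithConv.toConv (TensorProduct.lift g)) p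
  rw [h0] at h1
  apply WithConv.ofConv_injective
  refine h1.symm.trans ?_
  ext x
  simp

/-- `γ̄(g₁h₁ ⊗ k) γ̄(g₂ ⊗ h₂) = γ̄(g ⊗ h₁k₁) γ̄(h₂ ⊗ k₂)` -/
theorem TwoCocycle.inv_cocycle (γ : TwoCocycle A) (g h k : A) :
    contractR ((LinearMap.mul ℂ A).compr₂ (γ.inv.flip k)) γ.inv (comul g) (comul h)
      = contractR ((LinearMap.mul ℂ A).compr₂ (γ.inv g)) γ.inv (comul h) (comul k) := by
  rw [← pull_mulL_projL, ← pull_mulR_projR]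
  have key : pull γ.inv (mulL A) * pull γ.inv (projL A)
      = pull γ.inv (mulR A) * pull γ.inv (projR A) := by
    refine left_inv_eq_right_inv (a := pull γ.toFun (projL A) * pull γ.toFun (mulL A)) ?_ ?_
    · rw [mul_assoc, ← mul_assoc (pull γ.inv (projL A)), pull_mul_eq_one _ _ γ.inv_mul, one_mul,
        pull_mul_eq_one _ _ γ.inv_mul]
    · have : pull γ.toFun (projL A) * pull γ.toFun (mulL A)
          = pull γ.toFun (projR A) * pull γ.toFun (mulR A) := by
        apply WithConv.ofConv_injective
        apply TensorProduct.ext_threefold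
        intro a b c
        exact (pull_projL_mulL _ _ a b c).trans
          ((γ.cocycle a b c).trans (pull_projR_mulR _ _ a b c).symm)
      rw [this, mul_assoc, ← mul_assoc (pull γ.toFun (mulR A)), pull_mul_eq_one _ _ γ.mul_inv,
        one_mul, pull_mul_eq_one _ _ γ.mul_inv]
  rw [key]

end cocycle

section twist
variable {A M N P Q R S T : Type*} [AddCommGroup A] [Module ℂ A]
  [AddCommGroup M] [Module ℂ M] [AddCommGroup N] [Module ℂ N]
  [AddCommGroup P] [Module ℂ P]

/-- If `p` intertwines the coactions, then its twist intertwines them with respect to `mul'`. -/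
theorem coact_twist (Δ : A →ₗ[ℂ] A ⊗[ℂ] A) (mul mul' : A →ₗ[ℂ] A →ₗ[ℂ] A)
    (f : A →ₗ[ℂ] A →ₗ[ℂ] ℂ)
    (hmul : ∀ a b, contractR mul' f (Δ a) (Δ b) = contractL f mul (Δ a) (Δ b))
    (δM : M →ₗ[ℂ] A ⊗[ℂ] M) (δN : N →ₗ[ℂ] A ⊗[ℂ] N) (δP : P →ₗ[ℂ] A ⊗[ℂ] P)
    (hM : ∀ m, TensorProduct.assoc ℂ A A M (Δ.rTensor M (δM m)) = δM.lTensor A (δM m))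
    (hN : ∀ m, TensorProduct.assoc ℂ A A N (Δ.rTensor N (δN m)) = δN.lTensor A (δN m))
    (p : M →ₗ[ℂ] N →ₗ[ℂ] P) (hp : ∀ m n, δP (p m n) = map₂ mul p (δM m) (δN n))
    (m : M) (n : N) :
    δP (contractL f p (δM m) (δN n))
      = map₂ mul' ((contractL f p).compl₁₂ δM δN) (δM m) (δN n) := by
  have h1 : ∀ x y, δP (contractL f p x y)
      = contractL f (map₂ mul p) (δM.lTensor A x) (δN.lTensor A y) := by
    intro x y
    induction x with
    | zero => simp only [LinearMap.map_zero, LinearMap.zero_apply]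
    | add x x' hx hx' => simp only [LinearMap.map_add, LinearMap.add_apply, hx, hx']
    | tmul a m =>
      induction y with
      | zero => simp only [LinearMap.map_zero]
      | add x x' hx hx' => simp only [LinearMap.map_add, hx, hx']
      | tmul b n => simp [hp]
  have h2 : ∀ x y, map₂ mul' ((contractL f p).compl₁₂ δM δN) x y
      = map₂ mul' (contractL f p) (δM.lTensor A x) (δN.lTensor A y) := by
    intro x y
    induction x with
    | zero => simp only [LinearMap.map_zero, LinearMap.zero_apply]
    | add x x' hx hx' => simp only [LinearMap.map_add, LinearMap.add_apply, hx, hx']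
    | tmul a m =>
      induction y with
      | zero => simp only [LinearMap.map_zero]
      | add x x' hx hx' => simp only [LinearMap.map_add, hx, hx']
      | tmul b n => simp
  rw [h1, h2, ← hM, ← hN]
  generalize δM m = x
  generalize δN n = y
  induction x with
  | zero => simp only [LinearMap.map_zero, LinearEquiv.map_zero, LinearMap.zero_apply]
  | add x x' hx hx' => simp only [LinearMap.map_add, LinearEquiv.map_add,
         LinearMap.add_apply, hx, hx']
  | tmul a m =>
  induction y with
  | zero => simp only [LinearMap.map_zero, LinearEquiv.map_zero]
  | add x x' hx hx' => simp only [LinearMap.map_add, LinearEquiv.map_add, hx, hx']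
  | tmul b n =>
  have e1 : ∀ x y, contractL f (map₂ mul p) (TensorProduct.assoc ℂ A A M (x ⊗ₜ m))
      (TensorProduct.assoc ℂ A A N (y ⊗ₜ n)) = contractL f mul x y ⊗ₜ p m n := by
    intro x y
    induction x with
    | zero => simp only [LinearMap.map_zero, LinearEquiv.map_zero, LinearMap.zero_apply, zero_tmul]
    | add x x' hx hx' => simp only [LinearMap.map_add, LinearEquiv.map_add,
           add_tmul, LinearMap.add_apply, hx, hx']
    | tmul a a' =>
      induction y with
      | zero => simp only [LinearMap.map_zero, LinearEquiv.map_zero, zero_tmul]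
      | add x x' hx hx' => simp only [LinearMap.map_add, LinearEquiv.map_add, add_tmul, hx, hx']
      | tmul b b' => simp [smul_tmul']
  have e2 : ∀ x y, map₂ mul' (contractL f p) (TensorProduct.assoc ℂ A A M (x ⊗ₜ m))
      (TensorProduct.assoc ℂ A A N (y ⊗ₜ n)) = contractR mul' f x y ⊗ₜ p m n := by
    intro x y
    induction x with
    | zero => simp only [LinearMap.map_zero, LinearEquiv.map_zero, LinearMap.zero_apply, zero_tmul]
    | add x x' hx hx' => simp only [LinearMap.map_add, LinearEquiv.map_add,
           add_tmul, LinearMap.add_apply, hx, hx']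
    | tmul a a' =>
      induction y with
      | zero => simp only [LinearMap.map_zero, LinearEquiv.map_zero, zero_tmul]
      | add x x' hx hx' => simp only [LinearMap.map_add, LinearEquiv.map_add, add_tmul, hx, hx']
      | tmul b b' => simp [smul_tmul']
  simp only [LinearMap.rTensor_tmul]
  rw [e1, e2, hmul]

theorem contractR_contractR (Δ : A →ₗ[ℂ] A ⊗[ℂ] A)
    (hΔ : ∀ m, TensorProduct.assoc ℂ A A A (Δ.rTensor A (Δ m)) = Δ.lTensor A (Δ m))
    (p : A →ₗ[ℂ] A →ₗ[ℂ] P) (f g : A →ₗ[ℂ] A →ₗ[ℂ] ℂ) (a b : A) :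
    contractR ((contractR p f).compl₁₂ Δ Δ) g (Δ a) (Δ b)
      = contractR p ((contractL f g).compl₁₂ Δ Δ) (Δ a) (Δ b) := by
  have h1 : ∀ x y, contractR ((contractR p f).compl₁₂ Δ Δ) g x y
      = contractR (contractR p f) g (Δ.rTensor A x) (Δ.rTensor A y) := by
    intro x y
    induction x with
    | zero => simp only [LinearMap.map_zero, LinearMap.zero_apply]
    | add x x' hx hx' => simp only [LinearMap.map_add, LinearMap.add_apply, hx, hx']
    | tmul a m =>
      induction y with
      | zero => simp only [LinearMap.map_zero]
      | add x x' hx hx' => simp only [LinearMap.map_add, hx, hx']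
      | tmul b n => simp
  have h2 : ∀ x y, contractR p ((contractL f g).compl₁₂ Δ Δ) x y
      = contractR p (contractL f g) (Δ.lTensor A x) (Δ.lTensor A y) := by
    intro x y
    induction x with
    | zero => simp only [LinearMap.map_zero, LinearMap.zero_apply]
    | add x x' hx hx' => simp only [LinearMap.map_add, LinearMap.add_apply, hx, hx']
    | tmul a m =>
      induction y with
      | zero => simp only [LinearMap.map_zero]
      | add x x' hx hx' => simp only [LinearMap.map_add, hx, hx']
      | tmul b n => simp
  rw [h1, h2, ← hΔ, ← hΔ]
  generalize Δ.rTensor A (Δ a) = x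
  generalize Δ.rTensor A (Δ b) = y
  induction x with
  | zero => simp only [LinearMap.map_zero, LinearEquiv.map_zero, LinearMap.zero_apply]
  | add x x' hx hx' => simp only [LinearMap.map_add, LinearEquiv.map_add,
         LinearMap.add_apply, hx, hx']
  | tmul a m =>
  induction y with
  | zero => simp only [LinearMap.map_zero, LinearEquiv.map_zero]
  | add x x' hx hx' => simp only [LinearMap.map_add, LinearEquiv.map_add, hx, hx']
  | tmul b n =>
  induction a with
  | zero => simp only [LinearMap.map_zero, LinearEquiv.map_zero, LinearMap.zero_apply, zero_tmul]
  | add x x' hx hx' => simp only [LinearMap.map_add, LinearEquiv.map_add,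
         add_tmul, LinearMap.add_apply, hx, hx']
  | tmul a a' =>
  induction b with
  | zero => simp only [LinearMap.map_zero, LinearEquiv.map_zero, zero_tmul]
  | add x x' hx hx' => simp only [LinearMap.map_add, LinearEquiv.map_add, add_tmul, hx, hx']
  | tmul b b' => simp [smul_smul, mul_comm]

end twist

section cocycle
open Coalgebra
variable {A : Type*} [Ring A] [Bialgebra ℂ A] (γ : TwoCocycle A)

/-- `h, k ↦ γ(h₁ ⊗ k₁) h₂k₂` -/
noncomputable def TwoCocycle.lmul : A →ₗ[ℂ] A →ₗ[ℂ] A :=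
  (contractL γ.toFun (LinearMap.mul ℂ A)).compl₁₂ comul comul

/-- `h ·_γ k = γ(h₁ ⊗ k₁) h₂k₂ γ̄(h₃ ⊗ k₃)` -/
noncomputable def TwoCocycle.mulA : A →ₗ[ℂ] A →ₗ[ℂ] A :=
  (contractR γ.lmul γ.inv).compl₁₂ comul comul

theorem map₂_mul (x y : A ⊗[ℂ] A) :
    map₂ (LinearMap.mul ℂ A) (LinearMap.mul ℂ A) x y = x * y := by
  induction x with
  | zero => simp only [LinearMap.map_zero, LinearMap.zero_apply, zero_mul]
  | add x x' hx hx' => simp only [LinearMap.map_add, LinearMap.add_apply, hx, hx', add_mul]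
  | tmul a a' =>
  induction y with
  | zero => simp only [LinearMap.map_zero, mul_zero]
  | add x x' hx hx' => simp only [LinearMap.map_add, hx, hx', mul_add]
  | tmul b b' => simp

theorem comul_mul' (a b : A) : comul (R := ℂ) (LinearMap.mul ℂ A a b)
    = map₂ (LinearMap.mul ℂ A) (LinearMap.mul ℂ A) (comul a) (comul b) := by
  rw [map₂_mul, LinearMap.mul_apply', Bialgebra.comul_mul]

theorem comul_coassoc (a : A) : TensorProduct.assoc ℂ A A A
    ((comul (R := ℂ)).rTensor A (comul a)) = (comul (R := ℂ)).lTensor A (comul a) :=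
  Coalgebra.coassoc_apply a

theorem TwoCocycle.lmul_assoc (a b c : A) :
    γ.lmul (γ.lmul a b) c = γ.lmul a (γ.lmul b c) :=
  twist_assoc comul (LinearMap.mul ℂ A) γ.toFun γ.cocycle comul comul comul comul comul
    comul_coassoc comul_coassoc comul_coassoc _ comul_mul' _ comul_mul' (LinearMap.mul ℂ A)
    (LinearMap.mul ℂ A) (fun a b c => mul_assoc a b c) a b c

/-- the coopposite comultiplication -/
noncomputable def cop (A : Type*) [Ring A] [Bialgebra ℂ A] : A →ₗ[ℂ] A ⊗[ℂ] A :=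
  (TensorProduct.comm ℂ A A).toLinearMap ∘ₗ comul

theorem cop_coassoc (a : A) : TensorProduct.assoc ℂ A A A ((cop A).rTensor A (cop A a))
    = (cop A).lTensor A (cop A a) := by
  let rev : A ⊗[ℂ] (A ⊗[ℂ] A) →ₗ[ℂ] A ⊗[ℂ] (A ⊗[ℂ] A) :=
    (TensorProduct.assoc ℂ A A A).toLinearMap ∘ₗ
      ((TensorProduct.comm ℂ A A).toLinearMap.rTensor A) ∘ₗ
      (TensorProduct.comm ℂ A (A ⊗[ℂ] A)).toLinearMap
  have h1 : ∀ x : A ⊗[ℂ] A, TensorProduct.assoc ℂ A A A ((cop A).rTensor A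
      (TensorProduct.comm ℂ A A x)) = rev ((comul (R := ℂ)).lTensor A x) := by
    intro x
    induction x with
    | zero => simp only [LinearMap.map_zero, LinearEquiv.map_zero]
    | add x x' hx hx' => simp only [LinearMap.map_add, LinearEquiv.map_add, hx, hx']
    | tmul a b => simp [rev, cop]
  have h2 : ∀ x : A ⊗[ℂ] A, (cop A).lTensor A
      (TensorProduct.comm ℂ A A x) = rev (TensorProduct.assoc ℂ A A A
        ((comul (R := ℂ)).rTensor A x)) := by
    intro x
    induction x with
    | zero => simp only [LinearMap.map_zero, LinearEquiv.map_zero]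
    | add x x' hx hx' => simp only [LinearMap.map_add, LinearEquiv.map_add, hx, hx']
    | tmul a b =>
      simp only [rev, cop, TensorProduct.comm_tmul, LinearMap.lTensor_tmul, LinearMap.rTensor_tmul,
        LinearMap.comp_apply]
      generalize comul (R := ℂ) a = y
      induction y with
      | zero => simp only [LinearMap.map_zero, LinearEquiv.map_zero, zero_tmul, tmul_zero]
      | add x x' hx hx' => simp only [LinearMap.map_add, LinearEquiv.map_add,
             add_tmul, tmul_add, hx, hx']
      | tmul c d => simp
  refine (h1 _).trans ?_
  rw [← comul_coassoc]
  exact (h2 _).symm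

theorem contractL_comm {P : Type*} [AddCommGroup P] [Module ℂ P] (p : A →ₗ[ℂ] A →ₗ[ℂ] P)
    (f : A →ₗ[ℂ] A →ₗ[ℂ] ℂ) (x y : A ⊗[ℂ] A) :
    contractL f p (TensorProduct.comm ℂ A A x) (TensorProduct.comm ℂ A A y)
      = contractR p f x y := by
  induction x with
  | zero => simp only [LinearMap.map_zero, LinearEquiv.map_zero, LinearMap.zero_apply]
  | add x x' hx hx' => simp only [LinearMap.map_add, LinearEquiv.map_add,
         LinearMap.add_apply, hx, hx']
  | tmul a a' =>
  induction y with
  | zero => simp only [LinearMap.map_zero, LinearEquiv.map_zero]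
  | add x x' hx hx' => simp only [LinearMap.map_add, LinearEquiv.map_add, hx, hx']
  | tmul b b' => simp

theorem map₂_comm (p q : A →ₗ[ℂ] A →ₗ[ℂ] A) (x y : A ⊗[ℂ] A) :
    map₂ q p (TensorProduct.comm ℂ A A x) (TensorProduct.comm ℂ A A y)
      = TensorProduct.comm ℂ A A (map₂ p q x y) := by
  induction x with
  | zero => simp only [LinearMap.map_zero, LinearEquiv.map_zero, LinearMap.zero_apply]
  | add x x' hx hx' => simp only [LinearMap.map_add, LinearEquiv.map_add,
         LinearMap.add_apply, hx, hx']
  | tmul a a' =>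
  induction y with
  | zero => simp only [LinearMap.map_zero, LinearEquiv.map_zero]
  | add x x' hx hx' => simp only [LinearMap.map_add, LinearEquiv.map_add, hx, hx']
  | tmul b b' => simp

theorem TwoCocycle.mulA_eq (a b : A) :
    γ.mulA a b = contractL γ.inv γ.lmul (cop A a) (cop A b) :=
  (contractL_comm _ _ _ _).symm

/-- `Δ(γ(a₁ ⊗ b₁)a₂b₂) = γ(a₁ ⊗ b₁)a₂b₂ ⊗ a₃b₃` -/
theorem TwoCocycle.comul_lmul (a b : A) : comul (R := ℂ) (γ.lmul a b)
    = map₂ γ.lmul (LinearMap.mul ℂ A) (comul a) (comul b) := by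
  have h1 : ∀ x y : A ⊗[ℂ] A, comul (R := ℂ) (contractL γ.toFun (LinearMap.mul ℂ A) x y)
      = contractL γ.toFun (map₂ (LinearMap.mul ℂ A) (LinearMap.mul ℂ A))
        ((comul (R := ℂ)).lTensor A x) ((comul (R := ℂ)).lTensor A y) := by
    intro x y
    induction x with
    | zero => simp only [LinearMap.map_zero, LinearMap.zero_apply]
    | add x x' hx hx' => simp only [LinearMap.map_add, LinearMap.add_apply, hx, hx']
    | tmul a m =>
      induction y with
      | zero => simp only [LinearMap.map_zero]
      | add x x' hx hx' => simp only [LinearMap.map_add, hx, hx']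
      | tmul b n => simp [map₂_mul]
  refine (h1 _ _).trans ?_
  rw [← comul_coassoc, ← comul_coassoc]
  generalize comul (R := ℂ) a = x
  generalize comul (R := ℂ) b = y
  induction x with
  | zero => simp only [LinearMap.map_zero, LinearEquiv.map_zero, LinearMap.zero_apply]
  | add x x' hx hx' => simp only [LinearMap.map_add, LinearEquiv.map_add,
         LinearMap.add_apply, hx, hx']
  | tmul a m =>
  induction y with
  | zero => simp only [LinearMap.map_zero, LinearEquiv.map_zero]
  | add x x' hx hx' => simp only [LinearMap.map_add, LinearEquiv.map_add, hx, hx']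
  | tmul b n =>
  simp only [LinearMap.rTensor_tmul, map₂_apply_tmul, TensorProduct.map_tmul, TwoCocycle.lmul,
    LinearMap.compl₁₂_apply]
  generalize comul (R := ℂ) a = x
  generalize comul (R := ℂ) b = y
  induction x with
  | zero => simp only [LinearMap.map_zero, LinearEquiv.map_zero, LinearMap.zero_apply, zero_tmul]
  | add x x' hx hx' => simp only [LinearMap.map_add, LinearEquiv.map_add,
         add_tmul, LinearMap.add_apply, hx, hx']
  | tmul a a' =>
  induction y with
  | zero => simp only [LinearMap.map_zero, LinearEquiv.map_zero, zero_tmul]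
  | add x x' hx hx' => simp only [LinearMap.map_add, LinearEquiv.map_add, add_tmul, hx, hx']
  | tmul b b' => simp [smul_tmul']

theorem TwoCocycle.mulA_assoc (a b c : A) :
    γ.mulA (γ.mulA a b) c = γ.mulA a (γ.mulA b c) := by
  simp only [TwoCocycle.mulA_eq]
  refine twist_assoc (cop A) (LinearMap.mul ℂ A) γ.inv ?_ (cop A) (cop A) (cop A) (cop A) (cop A)
    cop_coassoc cop_coassoc cop_coassoc _ ?_ _ ?_ γ.lmul γ.lmul γ.lmul_assoc a b c
  · intro g h k
    exact (contractL_comm _ _ _ _).trans ((γ.inv_cocycle g h k).trans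
      (contractL_comm _ _ _ _).symm)
  all_goals
    intro m n
    refine Eq.trans ?_ (map₂_comm _ _ _ _).symm
    rw [← TwoCocycle.comul_lmul]
    rfl

theorem TwoCocycle.inv_one_left (b : A) : γ.inv 1 b = counit (R := ℂ) b := by
  have h := γ.mul_inv 1 b
  rw [Bialgebra.comul_one, Algebra.TensorProduct.one_def, Bialgebra.counit_one, one_mul] at h
  rw [← h]
  conv_lhs => rw [← lid_counit_comul b]
  generalize comul (R := ℂ) b = y
  induction y with
  | zero => simp only [LinearMap.map_zero, LinearEquiv.map_zero]
  | add x x' hx hx' => simp only [LinearMap.map_add, LinearEquiv.map_add, hx, hx']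
  | tmul b b' => simp [γ.map_one_left]

theorem TwoCocycle.inv_one_right (b : A) : γ.inv b 1 = counit (R := ℂ) b := by
  have h := γ.mul_inv b 1
  rw [Bialgebra.comul_one, Algebra.TensorProduct.one_def, Bialgebra.counit_one, mul_one] at h
  rw [← h]
  conv_lhs => rw [← lid_counit_comul b]
  generalize comul (R := ℂ) b = y
  induction y with
  | zero => simp only [LinearMap.map_zero, LinearEquiv.map_zero, LinearMap.zero_apply]
  | add x x' hx hx' => simp only [LinearMap.map_add, LinearEquiv.map_add,
         LinearMap.add_apply, hx, hx']
  | tmul b b' => simp [γ.map_one_right]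

theorem TwoCocycle.twist_one_left {M P : Type*} [AddCommGroup M] [Module ℂ M] [AddCommGroup P]
    [Module ℂ P] (p : P →ₗ[ℂ] M →ₗ[ℂ] M) (e : P) (he : ∀ m, p e m = m) (x : A ⊗[ℂ] M) :
    contractL γ.toFun p ((1 : A) ⊗ₜ e) x =
      TensorProduct.lid ℂ M ((counit (R := ℂ) (A := A)).rTensor M x) := by
  induction x with
  | zero => simp only [LinearMap.map_zero, LinearEquiv.map_zero]
  | add x x' hx hx' => simp only [LinearMap.map_add, LinearEquiv.map_add, hx, hx']
  | tmul b b' => simp [γ.map_one_left, he]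

theorem TwoCocycle.twist_one_right {M P : Type*} [AddCommGroup M] [Module ℂ M] [AddCommGroup P]
    [Module ℂ P] (p : M →ₗ[ℂ] P →ₗ[ℂ] M) (e : P) (he : ∀ m, p m e = m) (x : A ⊗[ℂ] M) :
    contractL γ.toFun p x ((1 : A) ⊗ₜ e) =
      TensorProduct.lid ℂ M ((counit (R := ℂ) (A := A)).rTensor M x) := by
  induction x with
  | zero => simp only [LinearMap.map_zero, LinearEquiv.map_zero, LinearMap.zero_apply]
  | add x x' hx hx' => simp only [LinearMap.map_add, LinearEquiv.map_add,
         LinearMap.add_apply, hx, hx']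
  | tmul b b' => simp [γ.map_one_right, he]

theorem TwoCocycle.one_mulA (b : A) : γ.mulA 1 b = b := by
  have h1 : ∀ b, γ.lmul 1 b = b := fun b => by
    rw [TwoCocycle.lmul, LinearMap.compl₁₂_apply, Bialgebra.comul_one,
      Algebra.TensorProduct.one_def, γ.twist_one_left _ _ (fun m => by simp), lid_counit_comul]
  rw [TwoCocycle.mulA, LinearMap.compl₁₂_apply, Bialgebra.comul_one,
    Algebra.TensorProduct.one_def]
  conv_rhs => rw [← rid_counit_comul b]
  generalize comul (R := ℂ) b = y
  induction y with
  | zero => simp only [LinearMap.map_zero, LinearEquiv.map_zero]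
  | add x x' hx hx' => simp only [LinearMap.map_add, LinearEquiv.map_add, hx, hx']
  | tmul b b' => simp [γ.inv_one_left, h1]

theorem TwoCocycle.mulA_one (b : A) : γ.mulA b 1 = b := by
  have h1 : ∀ b, γ.lmul b 1 = b := fun b => by
    rw [TwoCocycle.lmul, LinearMap.compl₁₂_apply, Bialgebra.comul_one,
      Algebra.TensorProduct.one_def, γ.twist_one_right _ _ (fun m => by simp), lid_counit_comul]
  rw [TwoCocycle.mulA, LinearMap.compl₁₂_apply, Bialgebra.comul_one,
    Algebra.TensorProduct.one_def]
  conv_rhs => rw [← rid_counit_comul b]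
  generalize comul (R := ℂ) b = y
  induction y with
  | zero => simp only [LinearMap.map_zero, LinearEquiv.map_zero, LinearMap.zero_apply]
  | add x x' hx hx' => simp only [LinearMap.map_add, LinearEquiv.map_add,
         LinearMap.add_apply, hx, hx']
  | tmul b b' => simp [γ.inv_one_right, h1]

theorem contractR_counit {P : Type*} [AddCommGroup P] [Module ℂ P] (p : A →ₗ[ℂ] A →ₗ[ℂ] P)
    (f : A →ₗ[ℂ] A →ₗ[ℂ] ℂ) (hf : ∀ a b, f a b = counit (R := ℂ) a * counit (R := ℂ) b) (a b : A) :
    contractR p f (comul a) (comul b) = p a b := by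
  conv_rhs => rw [← rid_counit_comul a, ← rid_counit_comul b]
  generalize comul (R := ℂ) a = x
  generalize comul (R := ℂ) b = y
  induction x with
  | zero => simp only [LinearMap.map_zero, LinearEquiv.map_zero, LinearMap.zero_apply]
  | add x x' hx hx' => simp only [LinearMap.map_add, LinearEquiv.map_add,
         LinearMap.add_apply, hx, hx']
  | tmul a a' =>
  induction y with
  | zero => simp only [LinearMap.map_zero, LinearEquiv.map_zero]
  | add x x' hx hx' => simp only [LinearMap.map_add, LinearEquiv.map_add, hx, hx']
  | tmul b b' => simp [hf, smul_smul, mul_comm]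

theorem TwoCocycle.contractR_mulA (a b : A) :
    contractR γ.mulA γ.toFun (comul a) (comul b)
      = contractL γ.toFun (LinearMap.mul ℂ A) (comul a) (comul b) := by
  refine (contractR_contractR (comul (R := ℂ) (A := A)) comul_coassoc γ.lmul γ.inv γ.toFun a b).trans ?_
  refine contractR_counit γ.lmul ((contractL γ.inv γ.toFun).compl₁₂ comul comul) ?_ a b
  intro a b
  rw [LinearMap.compl₁₂_apply]
  exact γ.inv_mul a b

theorem TwoCocycle.comul_mulA (a b : A) :
    comul (R := ℂ) (γ.mulA a b) = map₂ γ.mulA γ.mulA (comul a) (comul b) := by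
  have h0 : ∀ a b, comul (R := ℂ) (γ.lmul a b) = map₂ γ.mulA γ.lmul (comul a) (comul b) :=
    coact_twist comul (LinearMap.mul ℂ A) γ.mulA γ.toFun γ.contractR_mulA comul comul comul
      comul_coassoc comul_coassoc (LinearMap.mul ℂ A) comul_mul'
  have h1 : ∀ x y : A ⊗[ℂ] A, comul (R := ℂ) (contractR γ.lmul γ.inv x y)
      = contractR (map₂ γ.mulA γ.lmul) γ.inv
        ((comul (R := ℂ)).rTensor A x) ((comul (R := ℂ)).rTensor A y) := by
    intro x y
    induction x with
    | zero => simp only [LinearMap.map_zero, LinearMap.zero_apply]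
    | add x x' hx hx' => simp only [LinearMap.map_add, LinearMap.add_apply, hx, hx']
    | tmul a m =>
      induction y with
      | zero => simp only [LinearMap.map_zero]
      | add x x' hx hx' => simp only [LinearMap.map_add, hx, hx']
      | tmul b n => simp [h0]
  have h2 : ∀ x y, map₂ γ.mulA γ.mulA x y
      = map₂ γ.mulA (contractR γ.lmul γ.inv) ((comul (R := ℂ)).lTensor A x)
        ((comul (R := ℂ)).lTensor A y) := by
    intro x y
    induction x with
    | zero => simp only [LinearMap.map_zero, LinearMap.zero_apply]
    | add x x' hx hx' => simp only [LinearMap.map_add, LinearMap.add_apply, hx, hx']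
    | tmul a m =>
      induction y with
      | zero => simp only [LinearMap.map_zero]
      | add x x' hx hx' => simp only [LinearMap.map_add, hx, hx']
      | tmul b n =>
        simp only [map₂_apply_tmul, TensorProduct.map_tmul, LinearMap.lTensor_tmul]
        rfl
  refine (h1 _ _).trans ?_
  rw [h2, ← comul_coassoc, ← comul_coassoc]
  generalize (comul (R := ℂ)).rTensor A (comul (R := ℂ) a) = x
  generalize (comul (R := ℂ)).rTensor A (comul (R := ℂ) b) = y
  induction x with
  | zero => simp only [LinearMap.map_zero, LinearEquiv.map_zero, LinearMap.zero_apply]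
  | add x x' hx hx' => simp only [LinearMap.map_add, LinearEquiv.map_add,
         LinearMap.add_apply, hx, hx']
  | tmul x m =>
  induction y with
  | zero => simp only [LinearMap.map_zero, LinearEquiv.map_zero]
  | add x x' hx hx' => simp only [LinearMap.map_add, LinearEquiv.map_add, hx, hx']
  | tmul y n =>
  induction x with
  | zero => simp only [LinearMap.map_zero, LinearEquiv.map_zero, LinearMap.zero_apply, zero_tmul]
  | add x x' hx hx' => simp only [LinearMap.map_add, LinearEquiv.map_add,
         add_tmul, LinearMap.add_apply, hx, hx']
  | tmul a a' =>
  induction y with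
  | zero => simp only [LinearMap.map_zero, LinearEquiv.map_zero, zero_tmul]
  | add x x' hx hx' => simp only [LinearMap.map_add, LinearEquiv.map_add, add_tmul, hx, hx']
  | tmul b b' => simp

theorem TwoCocycle.counit_mulA (a b : A) :
    counit (R := ℂ) (γ.mulA a b) = counit (R := ℂ) a * counit (R := ℂ) b := by
  have h0 : ∀ a b, counit (R := ℂ) (γ.lmul a b) = γ.toFun a b := by
    intro a b
    rw [TwoCocycle.lmul, LinearMap.compl₁₂_apply]
    conv_rhs => rw [← rid_counit_comul a, ← rid_counit_comul b]
    generalize comul (R := ℂ) a = x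
    generalize comul (R := ℂ) b = y
    induction x with
    | zero => simp only [LinearMap.map_zero, LinearEquiv.map_zero, LinearMap.zero_apply]
    | add x x' hx hx' => simp only [LinearMap.map_add, LinearEquiv.map_add,
           LinearMap.add_apply, hx, hx']
    | tmul a a' =>
    induction y with
    | zero => simp only [LinearMap.map_zero, LinearEquiv.map_zero]
    | add x x' hx hx' => simp only [LinearMap.map_add, LinearEquiv.map_add, hx, hx']
    | tmul b b' => simp; ring
  rw [← γ.mul_inv, TwoCocycle.mulA, LinearMap.compl₁₂_apply]
  generalize comul (R := ℂ) a = x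
  generalize comul (R := ℂ) b = y
  induction x with
  | zero => simp only [LinearMap.map_zero, LinearMap.zero_apply]
  | add x x' hx hx' => simp only [LinearMap.map_add, LinearMap.add_apply, hx, hx']
  | tmul a a' =>
  induction y with
  | zero => simp only [LinearMap.map_zero]
  | add x x' hx hx' => simp only [LinearMap.map_add, hx, hx']
  | tmul b b' => simp [h0, mul_comm]

end cocycle

section objects
open Coalgebra

/-- `B` is a left `A`-comodule algebra: the coaction is an algebra map. -/
class ComoduleAlgebra (A B : Type*) [Ring A] [Bialgebra ℂ A] [Ring B] [Algebra ℂ B] where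
  coact : B →ₐ[ℂ] A ⊗[ℂ] B
  isCoaction : IsCoaction coact.toLinearMap

/-- The comultiplication is a `*`-homomorphism; with `HopfAlgebra ℂ A`, `StarRing A` and
`StarModule ℂ A` this says that `A` is a Hopf `*`-algebra. -/
class IsStarBialgebra (A : Type*) [Ring A] [Bialgebra ℂ A] [StarRing A] [StarModule ℂ A] :
    Prop where
  comul_star : ∀ a : A, comul (R := ℂ) (star a) = star (comul (R := ℂ) a)

/-- The coaction of a comodule algebra is a `*`-homomorphism. -/
class IsStarComoduleAlgebra (A B : Type*) [Ring A] [Bialgebra ℂ A] [StarRing A] [StarModule ℂ A]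
    [Ring B] [Algebra ℂ B] [ComoduleAlgebra A B] [StarRing B] [StarModule ℂ B] : Prop where
  coact_star : ∀ b : B, ComoduleAlgebra.coact (A := A) (star b)
    = star (ComoduleAlgebra.coact (A := A) b)

/-- The objects of the category of relative Hopf modules: `B`-bimodules with a left
`A`-coaction `δ` such that `δ(bm) = δ(b)δ(m)` and `δ(mb) = δ(m)δ(b)`. -/
structure RelHopf (A : Type u) (B : Type v) [Ring A] [Bialgebra ℂ A] [Ring B] [Algebra ℂ B]
    [ComoduleAlgebra A B] where
  carrier : Type v
  [addCommGroup : AddCommGroup carrier]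
  [module : Module ℂ carrier]
  lsmul : B →ₗ[ℂ] carrier →ₗ[ℂ] carrier
  rsmul : carrier →ₗ[ℂ] B →ₗ[ℂ] carrier
  one_lsmul : ∀ m, lsmul 1 m = m
  rsmul_one : ∀ m, rsmul m 1 = m
  mul_lsmul : ∀ a b m, lsmul (a * b) m = lsmul a (lsmul b m)
  rsmul_mul : ∀ m a b, rsmul m (a * b) = rsmul (rsmul m a) b
  lsmul_rsmul : ∀ a m b, rsmul (lsmul a m) b = lsmul a (rsmul m b)
  coact : carrier →ₗ[ℂ] A ⊗[ℂ] carrier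
  isCoaction : IsCoaction coact
  coact_lsmul : ∀ b m, coact (lsmul b m)
    = map₂ (LinearMap.mul ℂ A) lsmul (ComoduleAlgebra.coact (A := A) b) (coact m)
  coact_rsmul : ∀ m b, coact (rsmul m b)
    = map₂ (LinearMap.mul ℂ A) rsmul (coact m) (ComoduleAlgebra.coact (A := A) b)

attribute [instance] RelHopf.addCommGroup RelHopf.module

variable {A : Type u} {B : Type v} [Ring A] [Bialgebra ℂ A] [Ring B] [Algebra ℂ B]
    [ComoduleAlgebra A B]

theorem coact_mul (a b : B) : ComoduleAlgebra.coact (A := A) (LinearMap.mul ℂ B a b)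
    = map₂ (LinearMap.mul ℂ A) (LinearMap.mul ℂ B) (ComoduleAlgebra.coact (A := A) a)
      (ComoduleAlgebra.coact (A := A) b) := by
  rw [LinearMap.mul_apply', map_mul]
  generalize ComoduleAlgebra.coact (A := A) a = x
  generalize ComoduleAlgebra.coact (A := A) b = y
  induction x with
  | zero => simp only [LinearMap.map_zero, LinearMap.zero_apply, zero_mul]
  | add x x' hx hx' => simp only [LinearMap.map_add, LinearMap.add_apply, add_mul, hx, hx']
  | tmul a x =>
  induction y with
  | zero => simp only [LinearMap.map_zero, mul_zero]
  | add x x' hx hx' => simp only [LinearMap.map_add, mul_add, hx, hx']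
  | tmul b y => simp

namespace RelHopf

/-- Morphisms: `B`-bilinear `A`-colinear maps. -/
@[ext] structure Hom (M N : RelHopf A B) where
  hom : M.carrier →ₗ[ℂ] N.carrier
  map_lsmul : ∀ b m, hom (M.lsmul b m) = N.lsmul b (hom m)
  map_rsmul : ∀ m b, hom (M.rsmul m b) = N.rsmul (hom m) b
  map_coact : ∀ m, N.coact (hom m) = hom.lTensor A (M.coact m)

instance : Category (RelHopf A B) where
  Hom := Hom
  id M := ⟨LinearMap.id, fun _ _ => rfl, fun _ _ => rfl, fun m => by simp⟩
  comp f g := ⟨g.hom ∘ₗ f.hom, fun b m => by simp [f.map_lsmul, g.map_lsmul],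
    fun b m => by simp [f.map_rsmul, g.map_rsmul],
    fun m => by simp [g.map_coact, f.map_coact, LinearMap.lTensor_comp]⟩

/-- the linear map underlying a morphism -/
abbrev lin {M N : RelHopf A B} (f : M ⟶ N) : M.carrier →ₗ[ℂ] N.carrier := Hom.hom f

theorem hom_ext {M N : RelHopf A B} {f g : M ⟶ N} (h : ∀ m, lin f m = lin g m) : f = g :=
  Hom.ext (LinearMap.ext h)

@[simp] theorem lin_id (M : RelHopf A B) (m : M.carrier) : lin (𝟙 M) m = m := rfl
@[simp] theorem lin_comp {M N P : RelHopf A B} (f : M ⟶ N) (g : N ⟶ P) (m : M.carrier) :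
    lin (f ≫ g) m = lin g (lin f m) := rfl

/-- A morphism with a two-sided linear inverse is an isomorphism. -/
def isoOfInv {M N : RelHopf A B} (f : M ⟶ N) (g : N.carrier →ₗ[ℂ] M.carrier)
    (h₁ : ∀ m, g (lin f m) = m) (h₂ : ∀ n, lin f (g n) = n) : M ≅ N where
  hom := f
  inv := Hom.mk g
    (fun b n => by conv_lhs => rw [← h₂ n, ← f.map_lsmul, h₁])
    (fun n b => by conv_lhs => rw [← h₂ n, ← f.map_rsmul, h₁])
    (fun n => by
      conv_rhs => rw [← h₂ n, f.map_coact, ← LinearMap.comp_apply, ← LinearMap.lTensor_comp]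
      have : g ∘ₗ f.hom = LinearMap.id := LinearMap.ext h₁
      rw [this, LinearMap.lTensor_id]; rfl)
  hom_inv_id := hom_ext h₁
  inv_hom_id := hom_ext h₂

/-! ### The balanced tensor product -/

section BT
variable (M N P Q : RelHopf A B)

/-- The relations `mb ⊗ n = m ⊗ bn`. -/
def balanced : Submodule ℂ (M.carrier ⊗[ℂ] N.carrier) :=
  Submodule.span ℂ {x | ∃ m b n, x = M.rsmul m b ⊗ₜ[ℂ] n - m ⊗ₜ[ℂ] N.lsmul b n}

/-- The vector space `M ⊗_B N`. -/
abbrev BT : Type v := (M.carrier ⊗[ℂ] N.carrier) ⧸ balanced M N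

variable {M N P Q}

/-- The pure tensor `m ⊗_B n`. -/
noncomputable def bt : M.carrier →ₗ[ℂ] N.carrier →ₗ[ℂ] BT M N :=
  (TensorProduct.mk ℂ _ _).compr₂ (balanced M N).mkQ

theorem bt_balanced (m : M.carrier) (b : B) (n : N.carrier) :
    (bt (M.rsmul m b) n : BT M N) = bt m (N.lsmul b n) := by
  refine (Submodule.Quotient.eq _).2 (Submodule.subset_span ⟨m, b, n, rfl⟩)

variable {X : Type*} [AddCommGroup X] [Module ℂ X]

/-- The universal property of `M ⊗_B N`. -/
noncomputable def btLift (f : M.carrier →ₗ[ℂ] N.carrier →ₗ[ℂ] X)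
    (h : ∀ m b n, f (M.rsmul m b) n = f m (N.lsmul b n)) : BT M N →ₗ[ℂ] X :=
  (balanced M N).liftQ (TensorProduct.lift f) (by
    refine Submodule.span_le.2 ?_
    rintro _ ⟨m, b, n, rfl⟩
    simp [h])

@[simp] theorem btLift_bt (f : M.carrier →ₗ[ℂ] N.carrier →ₗ[ℂ] X)
    (h : ∀ m b n, f (M.rsmul m b) n = f m (N.lsmul b n)) (m : M.carrier) (n : N.carrier) :
    btLift f h (bt m n) = f m n := rfl

theorem bt_induction {p : BT M N → Prop} (h0 : p 0) (hadd : ∀ x y, p x → p y → p (x + y))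
    (h : ∀ m n, p (bt m n)) (x : BT M N) : p x := by
  obtain ⟨x, rfl⟩ := Submodule.mkQ_surjective _ x
  induction x with
  | zero => simpa using h0
  | add x y hx hy => rw [map_add]; exact hadd _ _ hx hy
  | tmul m n => exact h m n

theorem bt_ext {f g : BT M N →ₗ[ℂ] X} (h : ∀ m n, f (bt m n) = g (bt m n)) : f = g :=
  LinearMap.ext (bt_induction (by simp) (fun x y hx hy => by simp only [LinearMap.map_add, hx, hy]) h)

variable (M N)

/-- `b(m ⊗ n) = bm ⊗ n` -/
noncomputable def btLsmul : B →ₗ[ℂ] BT M N →ₗ[ℂ] BT M N :=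
  (btLift (LinearMap.mk₂ ℂ (fun m n => bt.flip n ∘ₗ M.lsmul.flip m)
    (fun m m' n => by ext; simp) (fun c m n => by ext; simp)
    (fun m n n' => by ext; simp) (fun c m n => by ext; simp)) (by
      intro m b n; ext b'; simp [← M.lsmul_rsmul, bt_balanced])).flip

/-- `(m ⊗ n)b = m ⊗ nb` -/
noncomputable def btRsmul : BT M N →ₗ[ℂ] B →ₗ[ℂ] BT M N :=
  btLift (LinearMap.mk₂ ℂ (fun m n => bt m ∘ₗ N.rsmul n)
    (fun m m' n => by ext; simp) (fun c m n => by ext; simp)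
    (fun m n n' => by ext; simp) (fun c m n => by ext; simp)) (by
      intro m b n; ext b'; simp [N.lsmul_rsmul, bt_balanced])

@[simp] theorem btLsmul_bt (b : B) (m : M.carrier) (n : N.carrier) :
    btLsmul M N b (bt m n) = bt (M.lsmul b m) n := rfl
@[simp] theorem btRsmul_bt (b : B) (m : M.carrier) (n : N.carrier) :
    btRsmul M N (bt m n) b = bt m (N.rsmul n b) := rfl

/-- `map₂ mul p (map₂ mul q x y) z = map₂ mul p' x (map₂ mul q' y z)` -/
theorem map₂_assoc {X Y Z U V W : Type*} [AddCommGroup X] [Module ℂ X]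
    [AddCommGroup Y] [Module ℂ Y] [AddCommGroup Z] [Module ℂ Z] [AddCommGroup U] [Module ℂ U]
    [AddCommGroup V] [Module ℂ V] [AddCommGroup W] [Module ℂ W]
    (q : X →ₗ[ℂ] Y →ₗ[ℂ] U) (p : U →ₗ[ℂ] Z →ₗ[ℂ] W) (q' : Y →ₗ[ℂ] Z →ₗ[ℂ] V)
    (p' : X →ₗ[ℂ] V →ₗ[ℂ] W) (h : ∀ x y z, p (q x y) z = p' x (q' y z))
    (x : A ⊗[ℂ] X) (y : A ⊗[ℂ] Y) (z : A ⊗[ℂ] Z) :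
    map₂ (LinearMap.mul ℂ A) p (map₂ (LinearMap.mul ℂ A) q x y) z
      = map₂ (LinearMap.mul ℂ A) p' x (map₂ (LinearMap.mul ℂ A) q' y z) := by
  induction x with
  | zero => simp only [LinearMap.map_zero, LinearMap.zero_apply]
  | add x x' hx hx' => simp only [LinearMap.map_add, LinearMap.add_apply, hx, hx']
  | tmul a x =>
  induction y with
  | zero => simp only [LinearMap.map_zero, LinearMap.zero_apply]
  | add x x' hx hx' => simp only [LinearMap.map_add, LinearMap.add_apply, hx, hx']
  | tmul b y =>
  induction z with
  | zero => simp only [LinearMap.map_zero]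
  | add x x' hx hx' => simp only [LinearMap.map_add, hx, hx']
  | tmul c z => simp [h, mul_assoc]

theorem map₂_lTensor {X Y Z W : Type*} [AddCommGroup X] [Module ℂ X]
    [AddCommGroup Y] [Module ℂ Y] [AddCommGroup Z] [Module ℂ Z] [AddCommGroup W] [Module ℂ W]
    (q : X →ₗ[ℂ] Y →ₗ[ℂ] Z) (f : Z →ₗ[ℂ] W) (x : A ⊗[ℂ] X) (y : A ⊗[ℂ] Y) :
    f.lTensor A (map₂ (LinearMap.mul ℂ A) q x y)
      = map₂ (LinearMap.mul ℂ A) (q.compr₂ f) x y := by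
  induction x with
  | zero => simp only [LinearMap.map_zero, LinearMap.zero_apply]
  | add x x' hx hx' => simp only [LinearMap.map_add, LinearMap.add_apply, hx, hx']
  | tmul a x =>
  induction y with
  | zero => simp only [LinearMap.map_zero]
  | add x x' hx hx' => simp only [LinearMap.map_add, hx, hx']
  | tmul b y => simp

theorem map₂_lTensor_lTensor {X Y X' Y' Z : Type*} [AddCommGroup X] [Module ℂ X]
    [AddCommGroup Y] [Module ℂ Y] [AddCommGroup Z] [Module ℂ Z] [AddCommGroup X'] [Module ℂ X']
    [AddCommGroup Y'] [Module ℂ Y']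
    (q : X →ₗ[ℂ] Y →ₗ[ℂ] Z) (f : X' →ₗ[ℂ] X) (g : Y' →ₗ[ℂ] Y) (x : A ⊗[ℂ] X') (y : A ⊗[ℂ] Y') :
    map₂ (LinearMap.mul ℂ A) q (f.lTensor A x) (g.lTensor A y)
      = map₂ (LinearMap.mul ℂ A) (q.compl₁₂ f g) x y := by
  induction x with
  | zero => simp only [LinearMap.map_zero, LinearMap.zero_apply]
  | add x x' hx hx' => simp only [LinearMap.map_add, LinearMap.add_apply, hx, hx']
  | tmul a x =>
  induction y with
  | zero => simp only [LinearMap.map_zero]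
  | add x x' hx hx' => simp only [LinearMap.map_add, hx, hx']
  | tmul b y => simp

/-- The diagonal coaction `m ⊗ n ↦ m₍₋₁₎n₍₋₁₎ ⊗ (m₍₀₎ ⊗ n₍₀₎)`. -/
noncomputable def btCoact : BT M N →ₗ[ℂ] A ⊗[ℂ] BT M N :=
  btLift ((map₂ (LinearMap.mul ℂ A) bt).compl₁₂ M.coact N.coact) (by
    intro m b n
    simp only [LinearMap.compl₁₂_apply, M.coact_rsmul, N.coact_lsmul]
    exact map₂_assoc _ _ _ _ bt_balanced _ _ _)

@[simp] theorem btCoact_bt (m : M.carrier) (n : N.carrier) :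
    btCoact M N (bt m n) = map₂ (LinearMap.mul ℂ A) bt (M.coact m) (N.coact n) := rfl

theorem btCoact_isCoaction : IsCoaction (btCoact M N) where
  counit := by
    refine bt_induction (by simp) (fun x y hx hy => by simp only [LinearMap.map_add, LinearEquiv.map_add,
           hx, hy]) fun m n => ?_
    rw [btCoact_bt]
    conv_rhs => rw [← M.isCoaction.counit m, ← N.isCoaction.counit n]
    generalize M.coact m = x
    generalize N.coact n = y
    induction x with
    | zero => simp only [LinearMap.map_zero, LinearEquiv.map_zero, LinearMap.zero_apply]
    | add x x' hx hx' => simp only [LinearMap.map_add, LinearEquiv.map_add,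
           LinearMap.add_apply, hx, hx']
    | tmul a x =>
    induction y with
    | zero => simp only [LinearMap.map_zero, LinearEquiv.map_zero]
    | add x x' hx hx' => simp only [LinearMap.map_add, LinearEquiv.map_add, hx, hx']
    | tmul b y => simp [smul_smul, mul_comm]
  coassoc := by
    refine bt_induction (by simp) (fun x y hx hy => by simp only [LinearMap.map_add, LinearEquiv.map_add,
           hx, hy]) fun m n => ?_
    rw [btCoact_bt, map₂_lTensor]
    have h1 : (bt (M := M) (N := N)).compr₂ (btCoact M N)
        = (map₂ (LinearMap.mul ℂ A) bt).compl₁₂ M.coact N.coact := rfl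
    rw [h1, ← map₂_lTensor_lTensor, ← M.isCoaction.coassoc, ← N.isCoaction.coassoc]
    generalize M.coact m = x
    generalize N.coact n = y
    induction x with
    | zero => simp only [LinearMap.map_zero, LinearEquiv.map_zero, LinearMap.zero_apply]
    | add x x' hx hx' => simp only [LinearMap.map_add, LinearEquiv.map_add,
           LinearMap.add_apply, hx, hx']
    | tmul a m =>
    induction y with
    | zero => simp only [LinearMap.map_zero, LinearEquiv.map_zero]
    | add x x' hx hx' => simp only [LinearMap.map_add, LinearEquiv.map_add, hx, hx']
    | tmul b n =>
    simp only [map₂_apply_tmul, TensorProduct.map_tmul, LinearMap.rTensor_tmul, comul_mul']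
    generalize comul (R := ℂ) a = x
    generalize comul (R := ℂ) b = y
    induction x with
    | zero => simp only [LinearMap.map_zero, LinearEquiv.map_zero, LinearMap.zero_apply, zero_tmul]
    | add x x' hx hx' => simp only [LinearMap.map_add, LinearEquiv.map_add,
           add_tmul, LinearMap.add_apply, hx, hx']
    | tmul a a' =>
    induction y with
    | zero => simp only [LinearMap.map_zero, LinearEquiv.map_zero, zero_tmul]
    | add x x' hx hx' => simp only [LinearMap.map_add, LinearEquiv.map_add, add_tmul, hx, hx']
    | tmul b b' => simp

/-- The object `M ⊗_B N`. -/
noncomputable abbrev tensor : RelHopf A B where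
  carrier := BT M N
  lsmul := btLsmul M N
  rsmul := btRsmul M N
  one_lsmul := bt_induction (by simp) (fun x y hx hy => by simp only [LinearMap.map_add, hx, hy])
    fun m n => by simp [M.one_lsmul]
  rsmul_one := bt_induction (by simp)
    (fun x y hx hy => by simp only [LinearMap.map_add, LinearMap.add_apply, hx, hy])
    fun m n => by simp [N.rsmul_one]
  mul_lsmul a b := bt_induction (by simp) (fun x y hx hy => by simp only [LinearMap.map_add, hx, hy])
    fun m n => by simp [M.mul_lsmul]
  rsmul_mul x a b := bt_induction
    (p := fun x => btRsmul M N x (a * b) = btRsmul M N (btRsmul M N x a) b) (by simp)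
    (fun x y hx hy => by simp only [LinearMap.map_add, LinearMap.add_apply, hx, hy])
    (fun m n => by simp [N.rsmul_mul]) x
  lsmul_rsmul a x b := bt_induction
    (p := fun x => btRsmul M N (btLsmul M N a x) b = btLsmul M N a (btRsmul M N x b)) (by simp)
    (fun x y hx hy => by simp only [LinearMap.map_add, LinearMap.add_apply, hx, hy]) (fun m n => by simp) x
  coact := btCoact M N
  isCoaction := btCoact_isCoaction M N
  coact_lsmul b := bt_induction (by simp) (fun x y hx hy => by simp only [LinearMap.map_add, hx, hy])
    fun m n => by
      simp only [btLsmul_bt, btCoact_bt, M.coact_lsmul]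
      exact map₂_assoc _ _ _ _ (fun _ _ _ => rfl) _ _ _
  coact_rsmul x b := bt_induction
    (p := fun x => btCoact M N (btRsmul M N x b) = map₂ (LinearMap.mul ℂ A) (btRsmul M N)
      (btCoact M N x) (ComoduleAlgebra.coact (A := A) b)) (by simp)
    (fun x y hx hy => by simp only [LinearMap.map_add, LinearMap.add_apply, hx, hy])
    (fun m n => by
      simp only [btRsmul_bt, btCoact_bt, N.coact_rsmul]
      exact (map₂_assoc bt (btRsmul M N) N.rsmul bt (fun _ _ _ => rfl) _ _ _).symm) x

variable (A B) in
/-- The unit object `B`. -/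
noncomputable abbrev unit : RelHopf A B where
  carrier := B
  lsmul := LinearMap.mul ℂ B
  rsmul := LinearMap.mul ℂ B
  one_lsmul := by simp
  rsmul_one := by simp
  mul_lsmul := by simp [mul_assoc]
  rsmul_mul := by simp [mul_assoc]
  lsmul_rsmul := by simp [mul_assoc]
  coact := (ComoduleAlgebra.coact (A := A) (B := B)).toLinearMap
  isCoaction := ComoduleAlgebra.isCoaction
  coact_lsmul a b := coact_mul a b
  coact_rsmul a b := coact_mul a b
end BT

section monoidal
variable {M N P Q M' N' P' : RelHopf A B}

/-- To check that a linear map out of `M ⊗_B N` is colinear, test on pure tensors. -/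
noncomputable def tensorHomMk (f : M.carrier →ₗ[ℂ] N.carrier →ₗ[ℂ] P.carrier)
    (h : ∀ m b n, f (M.rsmul m b) n = f m (N.lsmul b n))
    (hl : ∀ b m n, f (M.lsmul b m) n = P.lsmul b (f m n))
    (hr : ∀ m n b, f m (N.rsmul n b) = P.rsmul (f m n) b)
    (hc : ∀ m n, P.coact (f m n) = map₂ (LinearMap.mul ℂ A) f (M.coact m) (N.coact n)) :
    tensor M N ⟶ P :=
  Hom.mk (btLift f h)
    (fun b => bt_induction (by simp) (fun x y hx hy => by simp only [LinearMap.map_add, hx, hy])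
      (fun m n => hl b m n))
    (fun x b => bt_induction (p := fun x => btLift f h (btRsmul M N x b) = P.rsmul (btLift f h x) b)
      (by simp)
      (fun x y hx hy => by simp only [LinearMap.map_add, LinearMap.add_apply, hx, hy])
      (fun m n => hr m n b) x)
    (bt_induction (by simp) (fun x y hx hy => by simp only [LinearMap.map_add, hx, hy])
      (fun m n => by
        refine (hc m n).trans ?_
        rw [btCoact_bt, map₂_lTensor]
        rfl))

/-- The tensor product of morphisms. -/
noncomputable def tensorMap (f : M ⟶ M') (g : N ⟶ N') : tensor M N ⟶ tensor M' N' :=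
  tensorHomMk (bt.compl₁₂ (lin f) (lin g))
    (fun m b n => by
      simp only [LinearMap.compl₁₂_apply, f.map_rsmul, g.map_lsmul]; exact bt_balanced _ _ _)
    (fun b m n => by simp only [LinearMap.compl₁₂_apply, f.map_lsmul]; rfl)
    (fun b m n => by simp only [LinearMap.compl₁₂_apply, g.map_rsmul]; rfl)
    (fun m n => by
      rw [← map₂_lTensor_lTensor, ← f.map_coact, ← g.map_coact]; rfl)

/-- `B ⊗_B M ≅ M` -/
noncomputable def leftUnitor (M : RelHopf A B) : tensor (unit A B) M ≅ M :=
  isoOfInv (tensorHomMk (M := unit A B) M.lsmul (fun m b n => M.mul_lsmul m b n)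
      (fun b m n => M.mul_lsmul b m n) (fun m n b => (M.lsmul_rsmul m n b).symm)
      (fun b m => M.coact_lsmul b m))
    (bt (M := unit A B) (1 : B))
    (bt_induction (by simp) (fun x y hx hy => by simp only [LinearMap.map_add, hx, hy]) (fun b m => by
      refine (bt_balanced (M := unit A B) (1 : B) b m).symm.trans ?_
      exact congrArg (fun x => bt (M := unit A B) (N := M) x m) (one_mul (M := B) b)))
    (fun m => M.one_lsmul m)

/-- `M ⊗_B B ≅ M` -/
noncomputable def rightUnitor (M : RelHopf A B) : tensor M (unit A B) ≅ M :=
  isoOfInv (tensorHomMk (N := unit A B) M.rsmul (fun m b n => (M.rsmul_mul m b n).symm)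
      (fun b m n => M.lsmul_rsmul b m n) (fun m n b => M.rsmul_mul m n b)
      (fun b m => M.coact_rsmul b m))
    ((bt (N := unit A B)).flip (1 : B))
    (bt_induction (by simp) (fun x y hx hy => by simp only [LinearMap.map_add, hx, hy]) (fun m b => by
      refine (bt_balanced (N := unit A B) m b (1 : B)).trans ?_
      exact congrArg (fun x => bt (M := M) (N := unit A B) m x) (mul_one (M := B) b)))
    (fun m => M.rsmul_one m)

variable (M N P) in
/-- `(m ⊗ n) ⊗ p ↦ m ⊗ (n ⊗ p)` -/
noncomputable def assocAux : BT M N →ₗ[ℂ] P.carrier →ₗ[ℂ] BT M (tensor N P) :=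
  btLift (LinearMap.mk₂ ℂ (fun m n => bt (M := M) (N := tensor N P) m ∘ₗ bt n)
    (fun m m' n => by ext; simp) (fun c m n => by ext; simp)
    (fun m n n' => by ext; simp) (fun c m n => by ext; simp)) (by
      intro m b n; ext p
      exact bt_balanced (N := tensor N P) m b (bt n p))

variable (M N P) in
/-- `m ⊗ (n ⊗ p) ↦ (m ⊗ n) ⊗ p` -/
noncomputable def assocInvAux : M.carrier →ₗ[ℂ] BT N P →ₗ[ℂ] BT (tensor M N) P :=
  (btLift (LinearMap.mk₂ ℂ (fun n p => (bt (M := tensor M N) (N := P)).flip p ∘ₗ bt.flip n)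
    (fun m m' n => by ext; simp) (fun c m n => by ext; simp)
    (fun m n n' => by ext; simp) (fun c m n => by ext; simp)) (by
      intro n b p; ext m
      exact bt_balanced (M := tensor M N) (bt m n) b p)).flip

variable (M N P) in
/-- `(m ⊗ n) ⊗ p ↦ m ⊗ (n ⊗ p)` as a morphism -/
noncomputable def assocHom : tensor (tensor M N) P ⟶ tensor M (tensor N P) :=
  tensorHomMk (M := tensor M N) (assocAux M N P)
    (fun x b p => bt_induction (M := M) (N := N)
      (p := fun x => assocAux M N P (btRsmul M N x b) p = assocAux M N P x (P.lsmul b p))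
      (by simp) (fun x y hx hy => by simp only [LinearMap.map_add, LinearMap.add_apply, hx, hy])
      (fun m n => congrArg (bt (M := M) (N := tensor N P) m) (bt_balanced n b p)) x)
    (fun b x p => bt_induction (M := M) (N := N)
      (p := fun x => assocAux M N P (btLsmul M N b x) p
        = btLsmul M (tensor N P) b (assocAux M N P x p))
      (by simp) (fun x y hx hy => by simp only [LinearMap.map_add, LinearMap.add_apply, hx, hy])
      (fun m n => rfl) x)
    (fun x p b => bt_induction (M := M) (N := N)
      (p := fun x => assocAux M N P x (P.rsmul p b)
        = btRsmul M (tensor N P) (assocAux M N P x p) b)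
      (by simp) (fun x y hx hy => by simp only [LinearMap.map_add, LinearMap.add_apply, hx, hy])
      (fun m n => rfl) x)
    (fun x p => bt_induction (M := M) (N := N)
      (p := fun x => btCoact M (tensor N P) (assocAux M N P x p)
        = map₂ (LinearMap.mul ℂ A) (assocAux M N P) (btCoact M N x) (P.coact p))
      (by simp) (fun x y hx hy => by simp only [LinearMap.map_add, LinearMap.add_apply, hx, hy])
      (fun m n => (map₂_assoc (bt (M := M) (N := N)) (assocAux M N P) (bt (M := N) (N := P))
        (bt (M := M) (N := tensor N P)) (fun _ _ _ => rfl) _ _ _).symm) x)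

variable (M N P) in
/-- `m ⊗ (n ⊗ p) ↦ (m ⊗ n) ⊗ p` as a linear map -/
noncomputable def assocInv : BT M (tensor N P) →ₗ[ℂ] BT (tensor M N) P :=
  btLift (N := tensor N P) (assocInvAux M N P)
    (fun m b x => bt_induction (M := N) (N := P)
      (p := fun x => assocInvAux M N P (M.rsmul m b) x = assocInvAux M N P m (btLsmul N P b x))
      (by simp) (fun x y hx hy => by simp only [LinearMap.map_add, hx, hy])
      (fun n p => congrArg (fun x => bt (M := tensor M N) (N := P) x p) (bt_balanced m b n)) x)

variable (M N P) in
/-- The associator. -/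
noncomputable def associator : tensor (tensor M N) P ≅ tensor M (tensor N P) :=
  isoOfInv (assocHom M N P) (assocInv M N P)
    (bt_induction (M := tensor M N) (by simp) (fun x y hx hy => by simp only [LinearMap.map_add, hx, hy])
      (fun x p => bt_induction (M := M) (N := N)
        (p := fun x => assocInv M N P (lin (assocHom M N P) (bt (M := tensor M N) x p))
          = bt (M := tensor M N) x p)
        (by simp) (fun x y hx hy => by simp only [LinearMap.map_add, LinearMap.add_apply, hx, hy])
        (fun m n => rfl) x))
    (bt_induction (N := tensor N P) (by simp) (fun x y hx hy => by simp only [LinearMap.map_add, hx, hy])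
      (fun m x => bt_induction (M := N) (N := P)
        (p := fun x => lin (assocHom M N P) (assocInv M N P (bt (N := tensor N P) m x))
          = bt (N := tensor N P) m x)
        (by simp) (fun x y hx hy => by simp only [LinearMap.map_add, hx, hy])
        (fun m n => rfl) x))

noncomputable instance : MonoidalCategoryStruct (RelHopf A B) where
  tensorObj := tensor
  tensorUnit := unit A B
  tensorHom := tensorMap
  whiskerLeft X _ _ f := tensorMap (𝟙 X) f
  whiskerRight f X := tensorMap f (𝟙 X)
  associator := associator
  leftUnitor := leftUnitor
  rightUnitor := rightUnitor

theorem tensor_hom_ext {f g : tensor M N ⟶ P} (h : ∀ m n, lin f (bt m n) = lin g (bt m n)) :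
    f = g := Hom.ext (bt_ext h)

theorem tensor_hom_ext₃ {f g : tensor (tensor M N) P ⟶ Q}
    (h : ∀ m n p, lin f (bt (M := tensor M N) (bt m n) p)
      = lin g (bt (M := tensor M N) (bt m n) p)) : f = g :=
  tensor_hom_ext fun x p => bt_induction (M := M) (N := N)
    (p := fun x => lin f (bt (M := tensor M N) x p) = lin g (bt (M := tensor M N) x p))
    (by simp) (fun x y hx hy => by simp only [LinearMap.map_add, LinearMap.add_apply, hx, hy])
    (fun m n => h m n p) x

noncomputable instance : MonoidalCategory (RelHopf A B) := MonoidalCategory.ofTensorHom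
  (id_tensorHom_id := fun _ _ => tensor_hom_ext fun _ _ => rfl)
  (id_tensorHom := fun _ _ _ _ => rfl)
  (tensorHom_id := fun _ _ => rfl)
  (tensorHom_comp_tensorHom := fun _ _ _ _ => tensor_hom_ext fun _ _ => rfl)
  (associator_naturality := fun _ _ _ => tensor_hom_ext₃ fun _ _ _ => rfl)
  (leftUnitor_naturality := fun f => tensor_hom_ext fun b m => (f.map_lsmul b m).symm)
  (rightUnitor_naturality := fun f => tensor_hom_ext fun m b => (f.map_rsmul m b).symm)
  (pentagon := fun W X Y Z => tensor_hom_ext (M := tensor (tensor W X) Y) fun x z =>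
    bt_induction (M := tensor W X) (N := Y)
      (p := fun x => lin (tensorMap (associator W X Y).hom (𝟙 Z) ≫ (associator W (tensor X Y) Z).hom
        ≫ tensorMap (𝟙 W) (associator X Y Z).hom) (bt (M := tensor (tensor W X) Y) x z)
        = lin ((associator (tensor W X) Y Z).hom ≫ (associator W X (tensor Y Z)).hom)
          (bt (M := tensor (tensor W X) Y) x z))
      (by simp only [map_zero, LinearMap.zero_apply])
      (fun x y hx hy => by simp only [LinearMap.map_add, LinearMap.add_apply, hx, hy])
      (fun x y => bt_induction (M := W) (N := X)
        (p := fun x => lin (tensorMap (associator W X Y).hom (𝟙 Z) ≫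
          (associator W (tensor X Y) Z).hom ≫ tensorMap (𝟙 W) (associator X Y Z).hom)
          (bt (M := tensor (tensor W X) Y) (bt (M := tensor W X) x y) z)
          = lin ((associator (tensor W X) Y Z).hom ≫ (associator W X (tensor Y Z)).hom)
          (bt (M := tensor (tensor W X) Y) (bt (M := tensor W X) x y) z))
        (by simp only [map_zero, LinearMap.zero_apply])
        (fun x y hx hy => by simp only [LinearMap.map_add, LinearMap.add_apply, hx, hy])
        (fun _ _ => rfl) x) x)
  (triangle := fun _ _ => tensor_hom_ext₃ fun m b n => (bt_balanced m b n).symm)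
end monoidal

end RelHopf
end objects

section conj

/-- The conjugate vector space `M̄`. -/
def Conj (M : Type*) : Type _ := M

variable {M N : Type*} [AddCommGroup M] [Module ℂ M] [AddCommGroup N] [Module ℂ N]

instance : AddCommGroup (Conj M) := inferInstanceAs (AddCommGroup M)

/-- `c • m̄` is the conjugate of `c̄ • m` -/
noncomputable instance : Module ℂ (Conj M) :=
  letI : Module ℂ M := inferInstance
  (Module.compHom M (starRingEnd ℂ) : Module ℂ M)

/-- `m ↦ m̄` -/
def toConj : M →ₛₗ[starRingEnd ℂ] Conj M where
  toFun m := m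
  map_add' _ _ := rfl
  map_smul' c m := by
    change c • m = starRingEnd ℂ (starRingEnd ℂ c) • m
    simp

/-- `m̄ ↦ m` -/
def ofConj : Conj M →ₛₗ[starRingEnd ℂ] M where
  toFun m := m
  map_add' _ _ := rfl
  map_smul' _ _ := rfl

@[simp] theorem ofConj_toConj (m : M) : ofConj (toConj m) = m := rfl
@[simp] theorem toConj_ofConj (m : Conj M) : toConj (ofConj m) = m := rfl

/-- A linear map `f : M → N` induces `f̄ : M̄ → N̄`. -/
noncomputable def conjMap (f : M →ₗ[ℂ] N) : Conj M →ₗ[ℂ] Conj N :=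
  (toConj.comp f).comp ofConj

@[simp] theorem conjMap_apply (f : M →ₗ[ℂ] N) (m : Conj M) :
    conjMap f m = toConj (f (ofConj m)) := rfl

/-- `m ↦ \overline{\overline{m}}` -/
noncomputable def bbLin (M : Type*) [AddCommGroup M] [Module ℂ M] : M →ₗ[ℂ] Conj (Conj M) :=
  toConj.comp toConj

/-- `b ↦ \overline{b^*}` -/
noncomputable def starLin (B : Type*) [AddCommGroup B] [Module ℂ B] [StarAddMonoid B]
    [StarModule ℂ B] : B →ₗ[ℂ] Conj B :=
  toConj.comp (starLinearEquiv ℂ (A := B)).toLinearMap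

@[simp] theorem bbLin_apply (m : M) : bbLin M m = toConj (toConj m) := rfl

/-- A semilinear map `M → N` regarded as a linear map `M̄ → N`. -/
noncomputable def ofConjLin (f : M →ₛₗ[starRingEnd ℂ] N) : Conj M →ₗ[ℂ] N := f.comp ofConj

@[simp] theorem ofConjLin_apply (f : M →ₛₗ[starRingEnd ℂ] N) (m : Conj M) :
    ofConjLin f m = f (ofConj m) := rfl

variable {A : Type*} [AddCommGroup A] [Module ℂ A] [StarAddMonoid A] [StarModule ℂ A]

@[simp] theorem starLin_apply (a : A) : starLin A a = toConj (star a) := rfl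

/-- `a ⊗ m ↦ a^* ⊗ m̄` -/
noncomputable def starConj (A M : Type*) [AddCommGroup M] [Module ℂ M]
    [AddCommGroup A] [Module ℂ A] [StarAddMonoid A] [StarModule ℂ A] :
    A ⊗[ℂ] M →ₛₗ[starRingEnd ℂ] A ⊗[ℂ] Conj M :=
  TensorProduct.map (starLinearEquiv ℂ (A := A)).toLinearMap toConj

@[simp] theorem starConj_tmul (a : A) (m : M) : starConj A M (a ⊗ₜ m) = star a ⊗ₜ toConj m := rfl

end conj
section bar
open Coalgebra

section
variable {A : Type*} [Ring A] [Bialgebra ℂ A] [StarRing A] [StarModule ℂ A] [IsStarBialgebra A]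

theorem counit_star (a : A) : counit (R := ℂ) (star a) = star (counit (R := ℂ) a) := by
  let e : A →ₗ[ℂ] ℂ :=
    { toFun := fun a => star (counit (R := ℂ) (star a))
      map_add' := by simp
      map_smul' := by simp }
  have h1 : ∀ x : A ⊗[ℂ] A, TensorProduct.lid ℂ A ((counit (R := ℂ) (A := A)).rTensor A (star x))
      = star (TensorProduct.lid ℂ A (e.rTensor A x)) := by
    intro x
    induction x with
    | zero => simp only [LinearMap.map_zero, LinearEquiv.map_zero, star_zero]
    | add x x' hx hx' => simp only [LinearMap.map_add, LinearEquiv.map_add, star_add, hx, hx']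
    | tmul a b => simp [e]
  have h2 : ∀ x : A ⊗[ℂ] A, counit (R := ℂ) (TensorProduct.lid ℂ A (e.rTensor A x))
      = e (TensorProduct.rid ℂ A ((counit (R := ℂ) (A := A)).lTensor A x)) := by
    intro x
    induction x with
    | zero => simp only [LinearMap.map_zero, LinearEquiv.map_zero]
    | add x x' hx hx' => simp only [LinearMap.map_add, LinearEquiv.map_add, hx, hx']
    | tmul a b => simp only [LinearMap.rTensor_tmul, LinearMap.lTensor_tmul, TensorProduct.lid_tmul,
        TensorProduct.rid_tmul, map_smul, smul_eq_mul, mul_comm]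
  have h3 := lid_counit_comul (star a)
  rw [IsStarBialgebra.comul_star, h1] at h3
  have h4 := congrArg (counit (R := ℂ)) (star_injective h3)
  rw [h2, rid_counit_comul] at h4
  rw [← h4]
  simp [e]

end

variable {A : Type u} {B : Type v} [Ring A] [Bialgebra ℂ A] [Ring B] [Algebra ℂ B]
    [ComoduleAlgebra A B] [StarRing A] [StarModule ℂ A] [IsStarBialgebra A]
    [StarRing B] [StarModule ℂ B] [IsStarComoduleAlgebra A B]

namespace RelHopf

section
variable (M : RelHopf A B)

/-- `b m̄ = \overline{m b^*}` -/
noncomputable def barLsmul : B →ₗ[ℂ] Conj M.carrier →ₗ[ℂ] Conj M.carrier :=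
  LinearMap.mk₂ ℂ (fun b m => toConj (M.rsmul (ofConj m) (star b)))
    (by simp) (by simp) (by simp) (by simp)

/-- `m̄ b = \overline{b^* m}` -/
noncomputable def barRsmul : Conj M.carrier →ₗ[ℂ] B →ₗ[ℂ] Conj M.carrier :=
  LinearMap.mk₂ ℂ (fun m b => toConj (M.lsmul (star b) (ofConj m)))
    (by simp) (by simp) (by simp) (by simp)

/-- `δ(m̄) = m₍₋₁₎^* ⊗ \overline{m₍₀₎}` -/
noncomputable def barCoact : Conj M.carrier →ₗ[ℂ] A ⊗[ℂ] Conj M.carrier :=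
  ofConjLin ((starConj A M.carrier).comp M.coact)

@[simp] theorem barLsmul_apply (b : B) (m : Conj M.carrier) :
    barLsmul M b m = toConj (M.rsmul (ofConj m) (star b)) := rfl
@[simp] theorem barRsmul_apply (b : B) (m : Conj M.carrier) :
    barRsmul M m b = toConj (M.lsmul (star b) (ofConj m)) := rfl
@[simp] theorem barCoact_apply (m : Conj M.carrier) :
    barCoact M m = starConj A M.carrier (M.coact (ofConj m)) := rfl

theorem barCoact_isCoaction : IsCoaction (barCoact M) where
  counit m := by
    have h : ∀ x, TensorProduct.lid ℂ _ ((counit (R := ℂ) (A := A)).rTensor _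
        (starConj A M.carrier x)) = toConj (TensorProduct.lid ℂ _
          ((counit (R := ℂ) (A := A)).rTensor _ x)) := by
      intro x
      induction x with
      | zero => simp only [LinearMap.map_zero, LinearEquiv.map_zero]
      | add x x' hx hx' => simp only [LinearMap.map_add, LinearEquiv.map_add, hx, hx']
      | tmul a m => simp [counit_star]
    rw [barCoact_apply, h, M.isCoaction.counit, toConj_ofConj]
  coassoc m := by
    let K : A ⊗[ℂ] (A ⊗[ℂ] M.carrier) →ₛₗ[starRingEnd ℂ] A ⊗[ℂ] (A ⊗[ℂ] Conj M.carrier) :=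
      TensorProduct.map (starLinearEquiv ℂ (A := A)).toLinearMap (starConj A M.carrier)
    have h1 : ∀ x, TensorProduct.assoc ℂ _ _ _ ((comul (R := ℂ) (A := A)).rTensor _
        (starConj A M.carrier x)) = K (TensorProduct.assoc ℂ _ _ _
          ((comul (R := ℂ) (A := A)).rTensor _ x)) := by
      intro x
      induction x with
      | zero => simp only [LinearMap.map_zero, LinearEquiv.map_zero]
      | add x x' hx hx' => simp only [LinearMap.map_add, LinearEquiv.map_add, hx, hx']
      | tmul a m =>
        simp only [starConj_tmul, LinearMap.rTensor_tmul, IsStarBialgebra.comul_star]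
        generalize comul (R := ℂ) a = y
        induction y with
        | zero => simp only [LinearMap.map_zero, LinearEquiv.map_zero, zero_tmul, star_zero]
        | add x x' hx hx' => simp only [LinearMap.map_add, LinearEquiv.map_add,
               star_add, add_tmul, hx, hx']
        | tmul b c => simp [K]
    have h2 : ∀ x, (barCoact M).lTensor A (starConj A M.carrier x) = K (M.coact.lTensor A x) := by
      intro x
      induction x with
      | zero => simp only [LinearMap.map_zero]
      | add x x' hx hx' => simp only [LinearMap.map_add, hx, hx']
      | tmul a m => simp [K]
    rw [barCoact_apply, h1, M.isCoaction.coassoc, h2]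

theorem starConj_map₂_rsmul (x : A ⊗[ℂ] M.carrier) (y : A ⊗[ℂ] B) :
    starConj A M.carrier (map₂ (LinearMap.mul ℂ A) M.rsmul x (star y))
      = map₂ (LinearMap.mul ℂ A) (barLsmul M) y (starConj A M.carrier x) := by
  induction x with
  | zero => simp only [LinearMap.map_zero, LinearMap.zero_apply]
  | add x x' hx hx' => simp only [LinearMap.map_add, LinearMap.add_apply, hx, hx']
  | tmul a x =>
  induction y with
  | zero => simp only [LinearMap.map_zero, LinearMap.zero_apply, star_zero]
  | add x x' hx hx' => simp only [LinearMap.map_add, star_add, LinearMap.add_apply, hx, hx']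
  | tmul b y => simp

theorem starConj_map₂_lsmul (x : A ⊗[ℂ] M.carrier) (y : A ⊗[ℂ] B) :
    starConj A M.carrier (map₂ (LinearMap.mul ℂ A) M.lsmul (star y) x)
      = map₂ (LinearMap.mul ℂ A) (barRsmul M) (starConj A M.carrier x) y := by
  induction x with
  | zero => simp only [LinearMap.map_zero, LinearMap.zero_apply]
  | add x x' hx hx' => simp only [LinearMap.map_add, LinearMap.add_apply, hx, hx']
  | tmul a x =>
  induction y with
  | zero => simp only [LinearMap.map_zero, LinearMap.zero_apply, star_zero]
  | add x x' hx hx' => simp only [LinearMap.map_add, star_add, LinearMap.add_apply, hx, hx']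
  | tmul b y => simp

/-- The conjugate object `M̄`. -/
noncomputable abbrev barObj : RelHopf A B where
  carrier := Conj M.carrier
  lsmul := barLsmul M
  rsmul := barRsmul M
  one_lsmul m := by simp [M.rsmul_one]
  rsmul_one m := by simp [M.one_lsmul]
  mul_lsmul a b m := by simp [M.rsmul_mul]
  rsmul_mul m a b := by simp [M.mul_lsmul]
  lsmul_rsmul a m b := by simp [M.lsmul_rsmul]
  coact := barCoact M
  isCoaction := barCoact_isCoaction M
  coact_lsmul b m := by
    rw [barLsmul_apply, barCoact_apply, barCoact_apply, ofConj_toConj, M.coact_rsmul,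
      IsStarComoduleAlgebra.coact_star, starConj_map₂_rsmul]
  coact_rsmul m b := by
    rw [barRsmul_apply, barCoact_apply, barCoact_apply, ofConj_toConj, M.coact_lsmul,
      IsStarComoduleAlgebra.coact_star, starConj_map₂_lsmul]

end

variable {M N : RelHopf A B}

theorem starConj_lTensor {X Y : Type*} [AddCommGroup X] [Module ℂ X] [AddCommGroup Y] [Module ℂ Y]
    (f : X →ₗ[ℂ] Y) (x : A ⊗[ℂ] X) :
    starConj A Y (f.lTensor A x) = (conjMap f).lTensor A (starConj A X x) := by
  induction x with
  | zero => simp only [LinearMap.map_zero]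
  | add x x' hx hx' => simp only [LinearMap.map_add, hx, hx']
  | tmul a x => simp

/-- `f̄(m̄) = \overline{f(m)}` -/
noncomputable def barMap (f : M ⟶ N) : barObj M ⟶ barObj N :=
  Hom.mk (M := barObj M) (N := barObj N) (conjMap (M := M.carrier) (N := N.carrier) (Hom.hom f))
    (fun b m => congrArg (toConj (M := N.carrier)) (f.map_rsmul (ofConj m) (star b)))
    (fun m b => congrArg (toConj (M := N.carrier)) (f.map_lsmul (star b) (ofConj m)))
    (fun m => (congrArg (starConj A N.carrier) (f.map_coact (ofConj m))).trans
      (starConj_lTensor _ _))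

variable (A B) in
/-- The functor `bar`. -/
noncomputable def barFunctor : RelHopf A B ⥤ RelHopf A B where
  obj := barObj
  map := barMap
  map_id _ := hom_ext fun _ => rfl
  map_comp _ _ := hom_ext fun _ => rfl

theorem starConj_starConj {X : Type*} [AddCommGroup X] [Module ℂ X] (x : A ⊗[ℂ] X) :
    starConj A (Conj X) (starConj A X x) = (bbLin X).lTensor A x := by
  induction x with
  | zero => simp only [LinearMap.map_zero]
  | add x x' hx hx' => simp only [LinearMap.map_add, hx, hx']
  | tmul a x => simp

/-- `m ↦ \overline{\overline{m}}` -/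
noncomputable def bbIso (M : RelHopf A B) : M ≅ barObj (barObj M) :=
  isoOfInv (Hom.mk (M := M) (N := barObj (barObj M)) (bbLin M.carrier)
      (fun b m => congrArg (fun b => bbLin M.carrier (M.lsmul b m)) (star_star b).symm)
      (fun m b => congrArg (fun b => bbLin M.carrier (M.rsmul m b)) (star_star b).symm)
      (fun m => starConj_starConj (X := M.carrier) (M.coact m)))
    (ofConjLin (M := Conj M.carrier) (N := M.carrier) (ofConj (M := M.carrier))) (fun _ => rfl) (fun _ => rfl)

theorem starConj_star (x : A ⊗[ℂ] B) : starConj A B (star x) = (starLin B).lTensor A x := by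
  induction x with
  | zero => simp only [LinearMap.map_zero, star_zero]
  | add x x' hx hx' => simp only [LinearMap.map_add, star_add, hx, hx']
  | tmul a x => simp

variable (A B) in
/-- `b ↦ \overline{b^*}` -/
noncomputable def starIso : unit A B ≅ barObj (unit A B) :=
  isoOfInv (M := unit A B) (N := barObj (unit A B))
    (Hom.mk (M := unit A B) (N := barObj (unit A B)) (starLin B)
      (fun b m => congrArg (toConj (M := B)) (star_mul b m))
      (fun m b => congrArg (toConj (M := B)) (star_mul m b))
      (fun m => (congrArg (starConj A B) (IsStarComoduleAlgebra.coact_star (A := A) m)).trans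
        (starConj_star _)))
    (ofConjLin (M := B) (N := B) (starLinearEquiv ℂ (A := B)).toLinearMap)
    (fun b => star_star (R := B) b) (fun b => star_star (R := B) b)

variable (M N) in
/-- `n̄ ⊗ m̄ ↦ \overline{m ⊗ n}` -/
noncomputable def upsilonInvAux :
    Conj N.carrier →ₗ[ℂ] Conj M.carrier →ₗ[ℂ] Conj (BT M N) :=
  LinearMap.mk₂ ℂ (fun n m => toConj (bt (ofConj m) (ofConj n)))
    (by simp) (by simp) (by simp) (by simp)

theorem starConj_map₂_bt (x : A ⊗[ℂ] M.carrier) (y : A ⊗[ℂ] N.carrier) :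
    starConj A (BT M N) (map₂ (LinearMap.mul ℂ A) bt x y) = map₂ (LinearMap.mul ℂ A)
      (upsilonInvAux M N) (starConj A N.carrier y) (starConj A M.carrier x) := by
  induction x with
  | zero => simp only [LinearMap.map_zero, LinearMap.zero_apply]
  | add x x' hx hx' => simp only [LinearMap.map_add, LinearMap.add_apply, hx, hx']
  | tmul a x =>
  induction y with
  | zero => simp only [LinearMap.map_zero, LinearMap.zero_apply]
  | add x x' hx hx' => simp only [LinearMap.map_add, LinearMap.add_apply, hx, hx']
  | tmul b y => simp [upsilonInvAux]

variable (M N) in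
/-- `n̄ ⊗ m̄ ↦ \overline{m ⊗ n}` -/
noncomputable def upsilonInv : tensor (barObj N) (barObj M) ⟶ barObj (tensor M N) :=
  tensorHomMk (M := barObj N) (N := barObj M) (P := barObj (tensor M N)) (upsilonInvAux M N)
    (fun n b m => congrArg (toConj (M := BT M N))
      (bt_balanced (M := M) (N := N) (ofConj m) (star b) (ofConj n)).symm)
    (fun _ _ _ => rfl) (fun _ _ _ => rfl)
    (fun _ _ => starConj_map₂_bt _ _)

/-- `m, n ↦ n̄ ⊗ m̄` as a bilinear map to the conjugate space -/
noncomputable def upsilonAux₀ {X Y Z : Type*} [AddCommGroup X] [Module ℂ X] [AddCommGroup Y]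
    [Module ℂ Y] [AddCommGroup Z] [Module ℂ Z] (f : Conj Y →ₗ[ℂ] Conj X →ₗ[ℂ] Z) :
    X →ₗ[ℂ] Y →ₗ[ℂ] Conj Z :=
  LinearMap.mk₂ ℂ (fun m n => toConj (f (toConj n) (toConj m)))
    (by simp) (by simp) (by simp) (by simp)

variable (M N) in
/-- `m ⊗ n ↦ n̄ ⊗ m̄`, as a linear map to the conjugate space -/
noncomputable def upsilonAux : BT M N →ₗ[ℂ] Conj (BT (barObj N) (barObj M)) :=
  btLift (upsilonAux₀ (bt (M := barObj N) (N := barObj M)))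
    (fun m b n => by
      have h := bt_balanced (M := barObj N) (N := barObj M) (toConj n) (star b) (toConj m)
      have h1 : barLsmul M (star b) (toConj m) = toConj (M.rsmul m b) := by simp
      have h2 : barRsmul N (toConj n) (star b) = toConj (N.lsmul b n) := by simp
      change bt (M := barObj N) (N := barObj M) (barRsmul N (toConj n) (star b)) (toConj m) =
        bt (M := barObj N) (N := barObj M) (toConj n) (barLsmul M (star b) (toConj m)) at h
      rw [h1, h2] at h
      exact congrArg (toConj (M := BT (barObj N) (barObj M))) h.symm)

variable (M N) in
/-- `Υ_{M,N} : \overline{m ⊗ n} ↦ n̄ ⊗ m̄` -/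
noncomputable def upsilon : barObj (tensor M N) ≅ tensor (barObj N) (barObj M) :=
  (isoOfInv (upsilonInv M N)
    (ofConjLin (M := BT M N) (N := BT (barObj N) (barObj M))
      ((ofConj (M := BT (barObj N) (barObj M))).comp (upsilonAux M N)))
    (bt_induction (M := barObj N) (N := barObj M) (by simp)
      (fun x y hx hy => by simp only [LinearMap.map_add, hx, hy]) (fun n m => rfl))
    (fun x => bt_induction (M := M) (N := N)
      (p := fun x => lin (upsilonInv M N) (ofConj (upsilonAux M N x)) = toConj (M := BT M N) x)
      (by simp only [map_zero])
      (fun x y hx hy => by simp only [LinearMap.map_add, hx, hy]) (fun m n => rfl) (ofConj x))).symm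

end RelHopf
end bar

section barCategory
universe v₁ v₂ u₁ u₂
open Functor.LaxMonoidal Functor.OplaxMonoidal

/-- A bar category: a monoidal category with a functor `bar`, written `X ↦ X̄`, natural
isomorphisms `bb : X ≅ \overline{\overline{X}}` and `Υ : \overline{X ⊗ Y} ≅ Ȳ ⊗ X̄`, and an
isomorphism `⋆ : 1 ≅ \overline{1}`. -/
class BarCategory (C : Type u₁) [Category.{v₁} C] [MonoidalCategory C] where
  bar : C ⥤ C
  bb : 𝟭 C ≅ bar ⋙ bar
  star : 𝟙_ C ≅ bar.obj (𝟙_ C)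
  upsilon : ∀ X Y : C, bar.obj (X ⊗ Y) ≅ bar.obj Y ⊗ bar.obj X
  upsilon_natural : ∀ {X Y X' Y' : C} (f : X ⟶ X') (g : Y ⟶ Y'),
    bar.map (f ⊗ₘ g) ≫ (upsilon X' Y').hom = (upsilon X Y).hom ≫ (bar.map g ⊗ₘ bar.map f)
  right_unit : ∀ X : C, bar.map (ρ_ X).inv ≫ (upsilon X (𝟙_ C)).hom ≫
    (star.inv ⊗ₘ 𝟙 (bar.obj X)) ≫ (λ_ (bar.obj X)).hom = 𝟙 (bar.obj X)
  left_unit : ∀ X : C, bar.map (λ_ X).inv ≫ (upsilon (𝟙_ C) X).hom ≫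
    (𝟙 (bar.obj X) ⊗ₘ star.inv) ≫ (ρ_ (bar.obj X)).hom = 𝟙 (bar.obj X)
  /-- `(Υ_{Y,Z} ⊗ id) Υ_{X,Y⊗Z} = (id ⊗ Υ_{X,Y}) Υ_{X⊗Y,Z}`, with the associators written out -/
  hexagon : ∀ X Y Z : C,
    bar.map (α_ X Y Z).hom ≫ (upsilon X (Y ⊗ Z)).hom ≫ ((upsilon Y Z).hom ⊗ₘ 𝟙 (bar.obj X)) ≫
        (α_ (bar.obj Z) (bar.obj Y) (bar.obj X)).hom
      = (upsilon (X ⊗ Y) Z).hom ≫ (𝟙 (bar.obj Z) ⊗ₘ (upsilon X Y).hom)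
  star_star : star.hom ≫ bar.map star.hom = bb.hom.app (𝟙_ C)
  bar_bb : ∀ X : C, bar.map (bb.hom.app X) = bb.hom.app (bar.obj X)

/-- The structure of a bar functor on a (strong) monoidal functor `F` with structure maps
`ε : 1 → F 1` and `μ_{X,Y} : F X ⊗ F Y → F (X ⊗ Y)`, where `δ = μ⁻¹`. -/
structure BarFunctor {C : Type u₁} [Category.{v₁} C] [MonoidalCategory C] [BarCategory C]
    {D : Type u₂} [Category.{v₂} D] [MonoidalCategory D] [BarCategory D]
    (F : C ⥤ D) [F.Monoidal] where
  fb : F ⋙ BarCategory.bar ≅ BarCategory.bar ⋙ F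
  fb_unit : (BarCategory.star (C := D)).hom ≫ BarCategory.bar.map (ε F) ≫ fb.hom.app (𝟙_ C)
    = ε F ≫ F.map (BarCategory.star (C := C)).hom
  map_bb : ∀ Y : C, F.map (BarCategory.bb.hom.app Y)
    = BarCategory.bb.hom.app (F.obj Y) ≫ BarCategory.bar.map (fb.hom.app Y) ≫
      fb.hom.app (BarCategory.bar.obj Y)
  map_upsilon : ∀ X Y : C,
    BarCategory.bar.map (δ F X Y) ≫ (BarCategory.upsilon (F.obj X) (F.obj Y)).hom ≫
        (fb.hom.app Y ⊗ₘ fb.hom.app X)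
      = fb.hom.app (X ⊗ Y) ≫ F.map (BarCategory.upsilon X Y).hom ≫
        δ F (BarCategory.bar.obj Y) (BarCategory.bar.obj X)

end barCategory

section instBar
variable {A : Type u} {B : Type v} [Ring A] [Bialgebra ℂ A] [Ring B] [Algebra ℂ B]
    [ComoduleAlgebra A B] [StarRing A] [StarModule ℂ A] [IsStarBialgebra A]
    [StarRing B] [StarModule ℂ B] [IsStarComoduleAlgebra A B]
namespace RelHopf

theorem conj_bt_ext {M N : RelHopf A B} {X : Type*} [AddCommGroup X] [Module ℂ X]
    {f g : Conj (BT M N) →ₗ[ℂ] X}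
    (h : ∀ m n, f (toConj (M := BT M N) (bt m n)) = g (toConj (M := BT M N) (bt m n))) : f = g :=
  LinearMap.ext fun x => bt_induction (M := M) (N := N)
    (p := fun x => f (toConj (M := BT M N) x) = g (toConj (M := BT M N) x))
    (by simp only [map_zero]) (fun x y hx hy => by simp only [LinearMap.map_add, hx, hy]) h (ofConj x)

/-- to compare morphisms out of `\overline{M ⊗ N}`, test on pure tensors -/
theorem bar_tensor_ext {M N P : RelHopf A B} {f g : barObj (tensor M N) ⟶ P}
    (h : ∀ m n, lin f (toConj (M := BT M N) (bt m n)) = lin g (toConj (M := BT M N) (bt m n))) :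
    f = g := Hom.ext (conj_bt_ext h)

theorem bar_tensor_ext₃ {M N P Q : RelHopf A B} {f g : barObj (tensor (tensor M N) P) ⟶ Q}
    (h : ∀ m n p, lin f (toConj (M := BT (tensor M N) P) (bt (M := tensor M N) (bt m n) p))
      = lin g (toConj (M := BT (tensor M N) P) (bt (M := tensor M N) (bt m n) p))) : f = g :=
  bar_tensor_ext (M := tensor M N) fun x p =>
    bt_induction (M := M) (N := N)
      (p := fun x => lin f (toConj (M := BT (tensor M N) P) (bt (M := tensor M N) x p))
        = lin g (toConj (M := BT (tensor M N) P) (bt (M := tensor M N) x p)))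
      (by simp only [map_zero, LinearMap.zero_apply])
      (fun x y hx hy => by
        simp only [LinearMap.map_add, LinearMap.add_apply]
        exact congrArg₂ (· + ·) hx hy)
      (fun m n => h m n p) x

/-- The category of relative Hopf modules over a comodule `*`-algebra is a bar category. -/
noncomputable instance : BarCategory (RelHopf A B) where
  bar := barFunctor A B
  bb := NatIso.ofComponents bbIso (fun _ => hom_ext fun _ => rfl)
  star := starIso A B
  upsilon := upsilon
  upsilon_natural _ _ := bar_tensor_ext fun _ _ => rfl
  right_unit M := hom_ext fun m => by
    have h : star (star (1 : B)) = 1 := star_star 1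
    exact (congrArg (fun b => toConj (M := M.carrier) (M.rsmul (ofConj m) b)) h).trans
      (congrArg (toConj (M := M.carrier)) (M.rsmul_one (ofConj m)))
  left_unit M := hom_ext fun m => by
    have h : star (star (1 : B)) = 1 := star_star 1
    exact (congrArg (fun b => toConj (M := M.carrier) (M.lsmul b (ofConj m))) h).trans
      (congrArg (toConj (M := M.carrier)) (M.one_lsmul (ofConj m)))
  hexagon _ _ _ := bar_tensor_ext₃ fun _ _ _ => rfl
  star_star := hom_ext fun b => congrArg (bbLin B) (_root_.star_star b)
  bar_bb _ := hom_ext fun _ => rfl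

end RelHopf
end instBar

section transfer
variable {A A' M M' : Type*} [AddCommGroup A] [Module ℂ A] [AddCommGroup A'] [Module ℂ A']
  [AddCommGroup M] [Module ℂ M] [AddCommGroup M'] [Module ℂ M']

theorem assoc_rTensor_map (Δ : A →ₗ[ℂ] A ⊗[ℂ] A) (Δ' : A' →ₗ[ℂ] A' ⊗[ℂ] A') (s : A →ₗ[ℂ] A')
    (hΔ : ∀ a, Δ' (s a) = TensorProduct.map s s (Δ a)) (t : M →ₗ[ℂ] M') (x : A ⊗[ℂ] M) :
    TensorProduct.assoc ℂ A' A' M' (Δ'.rTensor M' (TensorProduct.map s t x))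
      = TensorProduct.map s (TensorProduct.map s t)
        (TensorProduct.assoc ℂ A A M (Δ.rTensor M x)) := by
  induction x with
  | zero => simp only [LinearMap.map_zero, LinearEquiv.map_zero]
  | add x y hx hy => simp only [LinearMap.map_add, LinearEquiv.map_add, hx, hy]
  | tmul a m =>
    simp only [TensorProduct.map_tmul, LinearMap.rTensor_tmul, hΔ]
    generalize Δ a = y
    induction y with
    | zero => simp only [LinearMap.map_zero, LinearEquiv.map_zero, zero_tmul]
    | add x y hx hy => simp only [LinearMap.map_add, LinearEquiv.map_add, add_tmul, hx, hy]
    | tmul b c => simp only [TensorProduct.map_tmul, TensorProduct.assoc_tmul]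

theorem lTensor_map (δ : M →ₗ[ℂ] A ⊗[ℂ] M) (δ' : M' →ₗ[ℂ] A' ⊗[ℂ] M') (s : A →ₗ[ℂ] A')
    (t : M →ₗ[ℂ] M') (hδ : ∀ m, δ' (t m) = TensorProduct.map s t (δ m)) (x : A ⊗[ℂ] M) :
    δ'.lTensor A' (TensorProduct.map s t x)
      = TensorProduct.map s (TensorProduct.map s t) (δ.lTensor A x) := by
  induction x with
  | zero => simp only [LinearMap.map_zero]
  | add x y hx hy => simp only [LinearMap.map_add, hx, hy]
  | tmul a m => simp only [TensorProduct.map_tmul, LinearMap.lTensor_tmul, hδ]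

theorem lid_rTensor_map (ε : A →ₗ[ℂ] ℂ) (ε' : A' →ₗ[ℂ] ℂ) (s : A →ₗ[ℂ] A')
    (hε : ∀ a, ε' (s a) = ε a) (t : M →ₗ[ℂ] M') (x : A ⊗[ℂ] M) :
    TensorProduct.lid ℂ M' (ε'.rTensor M' (TensorProduct.map s t x))
      = t (TensorProduct.lid ℂ M (ε.rTensor M x)) := by
  induction x with
  | zero => simp only [LinearMap.map_zero, LinearEquiv.map_zero]
  | add x y hx hy => simp only [LinearMap.map_add, LinearEquiv.map_add, hx, hy]
  | tmul a m =>
    simp only [TensorProduct.map_tmul, LinearMap.rTensor_tmul, hε, TensorProduct.lid_tmul,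
      LinearMap.map_smul]

/-- Coactions can be transported along a coalgebra map and a surjective linear map. -/
theorem IsCoaction.transfer {A A' : Type*} [AddCommGroup A] [Module ℂ A] [AddCommGroup A']
    [Module ℂ A'] [Coalgebra ℂ A] [Coalgebra ℂ A'] {δ : M →ₗ[ℂ] A ⊗[ℂ] M} (h : IsCoaction δ)
    {δ' : M' →ₗ[ℂ] A' ⊗[ℂ] M'} (s : A →ₗ[ℂ] A')
    (hΔ : ∀ a, Coalgebra.comul (R := ℂ) (s a) = TensorProduct.map s s (Coalgebra.comul (R := ℂ) a))
    (hε : ∀ a, Coalgebra.counit (R := ℂ) (s a) = Coalgebra.counit (R := ℂ) a)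
    (t : M →ₗ[ℂ] M') (ht : Function.Surjective t)
    (hδ : ∀ m, δ' (t m) = TensorProduct.map s t (δ m)) : IsCoaction δ' where
  counit m := by
    obtain ⟨m, rfl⟩ := ht m
    rw [hδ, lid_rTensor_map _ _ s hε, h.counit]
  coassoc m := by
    obtain ⟨m, rfl⟩ := ht m
    rw [hδ, assoc_rTensor_map _ _ s hΔ, h.coassoc, lTensor_map _ _ s t hδ]

theorem map_map₂ {N N' P P' Q Q' : Type*} [AddCommGroup N] [Module ℂ N] [AddCommGroup N']
    [Module ℂ N'] [AddCommGroup P] [Module ℂ P] [AddCommGroup P'] [Module ℂ P']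
    [AddCommGroup Q] [Module ℂ Q] [AddCommGroup Q'] [Module ℂ Q']
    (p : A →ₗ[ℂ] A →ₗ[ℂ] A) (p' : A' →ₗ[ℂ] A' →ₗ[ℂ] A') (s : A →ₗ[ℂ] A')
    (hp : ∀ a b, s (p a b) = p' (s a) (s b))
    (q : N →ₗ[ℂ] P →ₗ[ℂ] Q) (q' : N' →ₗ[ℂ] P' →ₗ[ℂ] Q') (i : N →ₗ[ℂ] N') (j : P →ₗ[ℂ] P')
    (k : Q →ₗ[ℂ] Q') (hq : ∀ a b, k (q a b) = q' (i a) (j b)) (x : A ⊗[ℂ] N) (y : A ⊗[ℂ] P) :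
    TensorProduct.map s k (map₂ p q x y)
      = map₂ p' q' (TensorProduct.map s i x) (TensorProduct.map s j y) := by
  induction x with
  | zero => simp only [LinearMap.map_zero, LinearMap.zero_apply]
  | add x x' hx hx' => simp only [LinearMap.map_add, LinearMap.add_apply, hx, hx']
  | tmul a m =>
  induction y with
  | zero => simp only [LinearMap.map_zero]
  | add x x' hx hx' => simp only [LinearMap.map_add, hx, hx']
  | tmul b n => simp only [TensorProduct.map_tmul, map₂_apply_tmul, hp, hq]

theorem map₂_mul_mul {A B : Type*} [Ring A] [Algebra ℂ A] [Ring B] [Algebra ℂ B]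
    (x y : A ⊗[ℂ] B) : map₂ (LinearMap.mul ℂ A) (LinearMap.mul ℂ B) x y = x * y := by
  induction x with
  | zero => simp only [LinearMap.map_zero, LinearMap.zero_apply, zero_mul]
  | add x x' hx hx' => simp only [LinearMap.map_add, LinearMap.add_apply, hx, hx', add_mul]
  | tmul a m =>
  induction y with
  | zero => simp only [LinearMap.map_zero, mul_zero]
  | add x x' hx hx' => simp only [LinearMap.map_add, hx, hx', mul_add]
  | tmul b n =>
    simp only [map₂_apply_tmul, TensorProduct.map_tmul, LinearMap.mul_apply',
      Algebra.TensorProduct.tmul_mul_tmul]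

end transfer

section twistAlg
open Coalgebra

section
variable {A : Type u} [Ring A] [Bialgebra ℂ A]

/-- The twist `A_γ`: the coalgebra `A` with the multiplication `·_γ`. -/
def TwoCocycle.Alg (_ : TwoCocycle A) : Type u := A

variable (γ : TwoCocycle A)

noncomputable instance : Ring γ.Alg :=
  { (inferInstanceAs (AddCommGroup A) : AddCommGroup γ.Alg) with
    mul := fun a b => γ.mulA a b
    one := (1 : A)
    left_distrib := fun a b c => (γ.mulA a).map_add b c
    right_distrib := fun a b c => LinearMap.map_add₂ γ.mulA a b c
    zero_mul := fun a => LinearMap.map_zero₂ γ.mulA a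
    mul_zero := fun a => (γ.mulA a).map_zero
    mul_assoc := γ.mulA_assoc
    one_mul := γ.one_mulA
    mul_one := γ.mulA_one }

noncomputable instance : Algebra ℂ γ.Alg :=
  letI : Module ℂ γ.Alg := inferInstanceAs (Module ℂ A)
  Algebra.ofModule (fun c a b => LinearMap.map_smul₂ γ.mulA c a b)
    (fun c a b => (γ.mulA a).map_smul c b)

/-- The identity map `A → A_γ`. -/
noncomputable def TwoCocycle.toAlg : A ≃ₗ[ℂ] γ.Alg where
  toFun a := a
  invFun a := a
  map_add' _ _ := rfl
  map_smul' _ _ := rfl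

theorem TwoCocycle.toAlg_one : γ.toAlg 1 = 1 := rfl
theorem TwoCocycle.toAlg_mulA (a b : A) : γ.toAlg (γ.mulA a b) = γ.toAlg a * γ.toAlg b := rfl

/-- The comultiplication of `A_γ`. -/
noncomputable def TwoCocycle.comulAlg : γ.Alg →ₗ[ℂ] γ.Alg ⊗[ℂ] γ.Alg :=
  TensorProduct.map γ.toAlg.toLinearMap γ.toAlg.toLinearMap ∘ₗ comul ∘ₗ γ.toAlg.symm.toLinearMap

/-- The counit of `A_γ`. -/
noncomputable def TwoCocycle.counitAlg : γ.Alg →ₗ[ℂ] ℂ := counit ∘ₗ γ.toAlg.symm.toLinearMap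

theorem TwoCocycle.comulAlg_toAlg (a : A) : γ.comulAlg (γ.toAlg.toLinearMap a)
    = TensorProduct.map γ.toAlg.toLinearMap γ.toAlg.toLinearMap (comul (R := ℂ) a) := by
  simp only [TwoCocycle.comulAlg, LinearMap.comp_apply, LinearEquiv.coe_coe,
    LinearEquiv.symm_apply_apply]

theorem TwoCocycle.counitAlg_toAlg (a : A) :
    γ.counitAlg (γ.toAlg.toLinearMap a) = counit (R := ℂ) a := by
  simp only [TwoCocycle.counitAlg, LinearMap.comp_apply, LinearEquiv.coe_coe,
    LinearEquiv.symm_apply_apply]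

theorem rid_lTensor_map {A A' : Type*} [AddCommGroup A] [Module ℂ A] [AddCommGroup A']
    [Module ℂ A'] (ε : A →ₗ[ℂ] ℂ) (ε' : A' →ₗ[ℂ] ℂ) (s : A →ₗ[ℂ] A')
    (hε : ∀ a, ε' (s a) = ε a) (x : A ⊗[ℂ] A) :
    TensorProduct.rid ℂ A' (ε'.lTensor A' (TensorProduct.map s s x))
      = s (TensorProduct.rid ℂ A (ε.lTensor A x)) := by
  induction x with
  | zero => simp only [LinearMap.map_zero, LinearEquiv.map_zero]
  | add x y hx hy => simp only [LinearMap.map_add, LinearEquiv.map_add, hx, hy]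
  | tmul a m =>
    simp only [TensorProduct.map_tmul, LinearMap.lTensor_tmul, hε, TensorProduct.rid_tmul,
      LinearMap.map_smul]

noncomputable instance : Coalgebra ℂ γ.Alg where
  comul := γ.comulAlg
  counit := γ.counitAlg
  coassoc := by
    refine LinearMap.ext fun a => ?_
    obtain ⟨a, rfl⟩ := γ.toAlg.surjective a
    change TensorProduct.assoc ℂ _ _ _ (γ.comulAlg.rTensor _ (γ.comulAlg (γ.toAlg.toLinearMap a)))
      = γ.comulAlg.lTensor _ (γ.comulAlg (γ.toAlg.toLinearMap a))
    rw [γ.comulAlg_toAlg, assoc_rTensor_map comul _ _ γ.comulAlg_toAlg,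
      lTensor_map comul _ _ _ γ.comulAlg_toAlg, comul_coassoc]
  rTensor_counit_comp_comul := by
    refine LinearMap.ext fun a => (TensorProduct.lid ℂ γ.Alg).injective ?_
    obtain ⟨a, rfl⟩ := γ.toAlg.surjective a
    change TensorProduct.lid ℂ _ (γ.counitAlg.rTensor _ (γ.comulAlg (γ.toAlg.toLinearMap a)))
      = TensorProduct.lid ℂ _ ((1 : ℂ) ⊗ₜ[ℂ] γ.toAlg a)
    rw [γ.comulAlg_toAlg, lid_rTensor_map counit _ _ γ.counitAlg_toAlg, lid_counit_comul,
      TensorProduct.lid_tmul, one_smul, LinearEquiv.coe_coe]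
  lTensor_counit_comp_comul := by
    refine LinearMap.ext fun a => (TensorProduct.rid ℂ γ.Alg).injective ?_
    obtain ⟨a, rfl⟩ := γ.toAlg.surjective a
    change TensorProduct.rid ℂ _ (γ.counitAlg.lTensor _ (γ.comulAlg (γ.toAlg.toLinearMap a)))
      = TensorProduct.rid ℂ _ (γ.toAlg a ⊗ₜ[ℂ] (1 : ℂ))
    rw [γ.comulAlg_toAlg, rid_lTensor_map counit _ _ γ.counitAlg_toAlg, rid_counit_comul,
      TensorProduct.rid_tmul, one_smul, LinearEquiv.coe_coe]

noncomputable instance : Bialgebra ℂ γ.Alg := Bialgebra.mk' ℂ γ.Alg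
  (Bialgebra.counit_one (R := ℂ) (A := A))
  (fun {a b} => by
    obtain ⟨a, rfl⟩ := γ.toAlg.surjective a
    obtain ⟨b, rfl⟩ := γ.toAlg.surjective b
    rw [← γ.toAlg_mulA]
    exact γ.counit_mulA a b)
  (by
    rw [← γ.toAlg_one]
    refine (γ.comulAlg_toAlg 1).trans ?_
    rw [Bialgebra.comul_one, Algebra.TensorProduct.one_def, TensorProduct.map_tmul,
      Algebra.TensorProduct.one_def]
    rfl)
  (fun {a b} => by
    obtain ⟨a, rfl⟩ := γ.toAlg.surjective a
    obtain ⟨b, rfl⟩ := γ.toAlg.surjective b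
    rw [← γ.toAlg_mulA]
    refine (γ.comulAlg_toAlg _).trans ?_
    rw [γ.comul_mulA, map_map₂ γ.mulA (LinearMap.mul ℂ γ.Alg) _ γ.toAlg_mulA γ.mulA
      (LinearMap.mul ℂ γ.Alg) _ _ _ γ.toAlg_mulA, map₂_mul_mul, ← γ.comulAlg_toAlg,
      ← γ.comulAlg_toAlg]
    rfl)

theorem TwoCocycle.comul_toAlg (a : A) : comul (R := ℂ) (γ.toAlg.toLinearMap a)
    = TensorProduct.map γ.toAlg.toLinearMap γ.toAlg.toLinearMap (comul (R := ℂ) a) :=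
  γ.comulAlg_toAlg a

theorem TwoCocycle.counit_toAlg (a : A) :
    counit (R := ℂ) (γ.toAlg.toLinearMap a) = counit (R := ℂ) a := γ.counitAlg_toAlg a

end

variable {A : Type u} [Ring A] [Bialgebra ℂ A] (γ : TwoCocycle A)

/-- The twist `B_γ` of a comodule algebra `B`. -/
def TwoCocycle.ComodAlg (_ : TwoCocycle A) (B : Type v) : Type v := B

section
variable (B : Type v) [Ring B] [Algebra ℂ B] [ComoduleAlgebra A B]

variable (A) in
/-- The coaction of a comodule algebra, as a linear map. -/
noncomputable abbrev coactB : B →ₗ[ℂ] A ⊗[ℂ] B := (ComoduleAlgebra.coact (A := A)).toLinearMap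

/-- `a ·_γ b = γ(a₍₋₁₎ ⊗ b₍₋₁₎) a₍₀₎b₍₀₎` -/
noncomputable def TwoCocycle.mulB : B →ₗ[ℂ] B →ₗ[ℂ] B :=
  (contractL γ.toFun (LinearMap.mul ℂ B)).compl₁₂ (coactB A B) (coactB A B)

theorem coactB_coassoc (b : B) : TensorProduct.assoc ℂ A A B
    ((comul (R := ℂ)).rTensor B (coactB A B b)) = (coactB A B).lTensor A (coactB A B b) :=
  ComoduleAlgebra.isCoaction.coassoc b

theorem coactB_one : coactB A B 1 = 1 ⊗ₜ 1 := map_one (ComoduleAlgebra.coact (A := A) (B := B))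

theorem TwoCocycle.mulB_assoc (a b c : B) :
    γ.mulB B (γ.mulB B a b) c = γ.mulB B a (γ.mulB B b c) :=
  twist_assoc comul (LinearMap.mul ℂ A) γ.toFun γ.cocycle (coactB A B) (coactB A B) (coactB A B)
    (coactB A B) (coactB A B) (coactB_coassoc B) (coactB_coassoc B) (coactB_coassoc B)
    _ coact_mul _ coact_mul (LinearMap.mul ℂ B)
    (LinearMap.mul ℂ B) (fun a b c => mul_assoc a b c) a b c

theorem TwoCocycle.one_mulB (b : B) : γ.mulB B 1 b = b := by
  rw [TwoCocycle.mulB, LinearMap.compl₁₂_apply, coactB_one,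
    γ.twist_one_left _ _ (fun m => by simp)]
  exact ComoduleAlgebra.isCoaction.counit b

theorem TwoCocycle.mulB_one (b : B) : γ.mulB B b 1 = b := by
  rw [TwoCocycle.mulB, LinearMap.compl₁₂_apply, coactB_one,
    γ.twist_one_right _ _ (fun m => by simp)]
  exact ComoduleAlgebra.isCoaction.counit b

noncomputable instance : Ring (γ.ComodAlg B) :=
  { (inferInstanceAs (AddCommGroup B) : AddCommGroup (γ.ComodAlg B)) with
    mul := fun a b => γ.mulB B a b
    one := (1 : B)
    left_distrib := fun a b c => (γ.mulB B a).map_add b c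
    right_distrib := fun a b c => LinearMap.map_add₂ (γ.mulB B) a b c
    zero_mul := fun a => LinearMap.map_zero₂ (γ.mulB B) a
    mul_zero := fun a => (γ.mulB B a).map_zero
    mul_assoc := γ.mulB_assoc B
    one_mul := γ.one_mulB B
    mul_one := γ.mulB_one B }

noncomputable instance : Algebra ℂ (γ.ComodAlg B) :=
  letI : Module ℂ (γ.ComodAlg B) := inferInstanceAs (Module ℂ B)
  Algebra.ofModule (fun c a b => LinearMap.map_smul₂ (γ.mulB B) c a b)
    (fun c a b => (γ.mulB B a).map_smul c b)

/-- The identity map `B → B_γ`. -/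
noncomputable def TwoCocycle.toComodAlg : B ≃ₗ[ℂ] γ.ComodAlg B where
  toFun b := b
  invFun b := b
  map_add' _ _ := rfl
  map_smul' _ _ := rfl

theorem TwoCocycle.toComodAlg_one : γ.toComodAlg B 1 = 1 := rfl
theorem TwoCocycle.toComodAlg_mulB (a b : B) :
    γ.toComodAlg B (γ.mulB B a b) = γ.toComodAlg B a * γ.toComodAlg B b := rfl

/-- The coaction of `B`, regarded as a map `B_γ → A_γ ⊗ B_γ`. -/
noncomputable def TwoCocycle.coactTwist : γ.ComodAlg B →ₗ[ℂ] γ.Alg ⊗[ℂ] γ.ComodAlg B :=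
  TensorProduct.map γ.toAlg.toLinearMap (γ.toComodAlg B).toLinearMap ∘ₗ coactB A B ∘ₗ
    (γ.toComodAlg B).symm.toLinearMap

theorem TwoCocycle.coactTwist_apply (b : B) : γ.coactTwist B ((γ.toComodAlg B).toLinearMap b)
    = TensorProduct.map γ.toAlg.toLinearMap (γ.toComodAlg B).toLinearMap (coactB A B b) := by
  simp only [TwoCocycle.coactTwist, LinearMap.comp_apply, LinearEquiv.coe_coe,
    LinearEquiv.symm_apply_apply]

theorem TwoCocycle.coactB_mulB (a b : B) : coactB A B (γ.mulB B a b)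
    = map₂ γ.mulA (γ.mulB B) (coactB A B a) (coactB A B b) :=
  coact_twist comul (LinearMap.mul ℂ A) γ.mulA γ.toFun γ.contractR_mulA (coactB A B)
    (coactB A B) (coactB A B) (coactB_coassoc B) (coactB_coassoc B) (LinearMap.mul ℂ B)
    coact_mul a b

theorem TwoCocycle.coactTwist_one : γ.coactTwist B 1 = 1 := by
  rw [← γ.toComodAlg_one B]
  refine (γ.coactTwist_apply B 1).trans ?_
  rw [coactB_one, TensorProduct.map_tmul, Algebra.TensorProduct.one_def]
  rfl

theorem TwoCocycle.coactTwist_mul (a b : γ.ComodAlg B) :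
    γ.coactTwist B (a * b) = γ.coactTwist B a * γ.coactTwist B b := by
  obtain ⟨a, rfl⟩ := (γ.toComodAlg B).surjective a
  obtain ⟨b, rfl⟩ := (γ.toComodAlg B).surjective b
  rw [← γ.toComodAlg_mulB]
  refine (γ.coactTwist_apply B _).trans ?_
  rw [γ.coactB_mulB, map_map₂ γ.mulA (LinearMap.mul ℂ γ.Alg) _ γ.toAlg_mulA (γ.mulB B)
      (LinearMap.mul ℂ (γ.ComodAlg B)) _ _ _ (γ.toComodAlg_mulB B), map₂_mul_mul,
      ← γ.coactTwist_apply, ← γ.coactTwist_apply]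
  rfl

noncomputable instance : ComoduleAlgebra γ.Alg (γ.ComodAlg B) where
  coact := AlgHom.ofLinearMap (γ.coactTwist B) (γ.coactTwist_one B) (γ.coactTwist_mul B)
  isCoaction := (ComoduleAlgebra.isCoaction (A := A) (B := B)).transfer γ.toAlg.toLinearMap
    γ.comul_toAlg γ.counit_toAlg (γ.toComodAlg B).toLinearMap (γ.toComodAlg B).surjective
    (γ.coactTwist_apply B)

theorem TwoCocycle.coact_toComodAlg (b : B) :
    ComoduleAlgebra.coact (A := γ.Alg) (γ.toComodAlg B b)
      = TensorProduct.map γ.toAlg.toLinearMap (γ.toComodAlg B).toLinearMap (coactB A B b) :=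
  γ.coactTwist_apply B b
end

section
variable {B : Type v} [Ring B] [Algebra ℂ B] [ComoduleAlgebra A B]

/-- `b ·_γ m = γ(b₍₋₁₎ ⊗ m₍₋₁₎) b₍₀₎m₍₀₎` -/
noncomputable def TwoCocycle.lsmulM (M : RelHopf A B) : B →ₗ[ℂ] M.carrier →ₗ[ℂ] M.carrier :=
  (contractL γ.toFun M.lsmul).compl₁₂ (coactB A B) M.coact

/-- `m ·_γ b = γ(m₍₋₁₎ ⊗ b₍₋₁₎) m₍₀₎b₍₀₎` -/
noncomputable def TwoCocycle.rsmulM (M : RelHopf A B) : M.carrier →ₗ[ℂ] B →ₗ[ℂ] M.carrier :=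
  (contractL γ.toFun M.rsmul).compl₁₂ M.coact (coactB A B)

/-- The object `Γ(M)`: the comodule `M` with the actions `b ·_γ m` and `m ·_γ b`. -/
noncomputable def TwoCocycle.functorObj (M : RelHopf A B) : RelHopf γ.Alg (γ.ComodAlg B) where
  carrier := M.carrier
  lsmul := γ.lsmulM M ∘ₗ (γ.toComodAlg B).symm.toLinearMap
  rsmul := (γ.rsmulM M).compl₂ (γ.toComodAlg B).symm.toLinearMap
  one_lsmul m := by
    refine Eq.trans ?_ (M.isCoaction.counit m)
    refine Eq.trans ?_ (γ.twist_one_left M.lsmul 1 M.one_lsmul (M.coact m))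
    exact congrArg (fun x => contractL γ.toFun M.lsmul x (M.coact m)) (coactB_one B)
  rsmul_one m := by
    refine Eq.trans ?_ (M.isCoaction.counit m)
    refine Eq.trans ?_ (γ.twist_one_right M.rsmul 1 M.rsmul_one (M.coact m))
    exact congrArg (fun x => contractL γ.toFun M.rsmul (M.coact m) x) (coactB_one B)
  mul_lsmul a b m :=
    twist_assoc comul (LinearMap.mul ℂ A) γ.toFun γ.cocycle (coactB A B) (coactB A B) (coactB A B)
      M.coact M.coact (coactB_coassoc B) (coactB_coassoc B) M.isCoaction.coassoc
      (LinearMap.mul ℂ B) coact_mul M.lsmul M.coact_lsmul M.lsmul M.lsmul M.mul_lsmul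
      ((γ.toComodAlg B).symm a) ((γ.toComodAlg B).symm b) m
  rsmul_mul m a b :=
    (twist_assoc comul (LinearMap.mul ℂ A) γ.toFun γ.cocycle M.coact (coactB A B) M.coact
      (coactB A B) (coactB A B) M.isCoaction.coassoc (coactB_coassoc B) (coactB_coassoc B)
      M.rsmul M.coact_rsmul (LinearMap.mul ℂ B) coact_mul M.rsmul M.rsmul
      (fun m a b => (M.rsmul_mul m a b).symm) m ((γ.toComodAlg B).symm a)
      ((γ.toComodAlg B).symm b)).symm
  lsmul_rsmul a m b :=
    twist_assoc comul (LinearMap.mul ℂ A) γ.toFun γ.cocycle (coactB A B) M.coact M.coact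
      (coactB A B) M.coact (coactB_coassoc B) M.isCoaction.coassoc (coactB_coassoc B)
      M.lsmul M.coact_lsmul M.rsmul M.coact_rsmul M.rsmul M.lsmul M.lsmul_rsmul
      ((γ.toComodAlg B).symm a) m ((γ.toComodAlg B).symm b)
  coact := TensorProduct.map γ.toAlg.toLinearMap LinearMap.id ∘ₗ M.coact
  isCoaction := M.isCoaction.transfer γ.toAlg.toLinearMap
    γ.comul_toAlg γ.counit_toAlg LinearMap.id Function.surjective_id (fun _ => rfl)
  coact_lsmul b m := by
    obtain ⟨b, rfl⟩ := (γ.toComodAlg B).surjective b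
    have h := coact_twist comul (LinearMap.mul ℂ A) γ.mulA γ.toFun γ.contractR_mulA
      (coactB A B) M.coact M.coact (coactB_coassoc B) M.isCoaction.coassoc M.lsmul
      M.coact_lsmul b m
    rw [γ.coact_toComodAlg]
    refine (congrArg (TensorProduct.map γ.toAlg.toLinearMap LinearMap.id) h).trans ?_
    exact map_map₂ γ.mulA (LinearMap.mul ℂ γ.Alg) γ.toAlg.toLinearMap γ.toAlg_mulA (γ.lsmulM M)
      (γ.lsmulM M ∘ₗ (γ.toComodAlg B).symm.toLinearMap) (γ.toComodAlg B).toLinearMap LinearMap.id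
      LinearMap.id (fun _ _ => rfl) (coactB A B b) (M.coact m)
  coact_rsmul m b := by
    obtain ⟨b, rfl⟩ := (γ.toComodAlg B).surjective b
    have h := coact_twist comul (LinearMap.mul ℂ A) γ.mulA γ.toFun γ.contractR_mulA
      M.coact (coactB A B) M.coact M.isCoaction.coassoc (coactB_coassoc B) M.rsmul
      M.coact_rsmul m b
    rw [γ.coact_toComodAlg]
    refine (congrArg (TensorProduct.map γ.toAlg.toLinearMap LinearMap.id) h).trans ?_
    exact map_map₂ γ.mulA (LinearMap.mul ℂ γ.Alg) γ.toAlg.toLinearMap γ.toAlg_mulA (γ.rsmulM M)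
      ((γ.rsmulM M).compl₂ (γ.toComodAlg B).symm.toLinearMap) LinearMap.id
      (γ.toComodAlg B).toLinearMap LinearMap.id (fun _ _ => rfl) (M.coact m) (coactB A B b)

theorem map_twist {X Y X' Y' P Q : Type*} [AddCommGroup X] [Module ℂ X] [AddCommGroup Y]
    [Module ℂ Y] [AddCommGroup X'] [Module ℂ X'] [AddCommGroup Y'] [Module ℂ Y']
    [AddCommGroup P] [Module ℂ P] [AddCommGroup Q] [Module ℂ Q]
    (f : A →ₗ[ℂ] A →ₗ[ℂ] ℂ) (p : X →ₗ[ℂ] Y →ₗ[ℂ] P) (q : X' →ₗ[ℂ] Y' →ₗ[ℂ] Q)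
    (g : X →ₗ[ℂ] X') (h : Y →ₗ[ℂ] Y') (k : P →ₗ[ℂ] Q)
    (e : ∀ x y, k (p x y) = q (g x) (h y)) (x : A ⊗[ℂ] X) (y : A ⊗[ℂ] Y) :
    k (contractL f p x y) = contractL f q (g.lTensor A x) (h.lTensor A y) := by
  induction x with
  | zero => simp only [LinearMap.map_zero, LinearMap.zero_apply]
  | add x x' hx hx' => simp only [LinearMap.map_add, LinearMap.add_apply, hx, hx']
  | tmul a m =>
  induction y with
  | zero => simp only [LinearMap.map_zero]
  | add x x' hx hx' => simp only [LinearMap.map_add, hx, hx']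
  | tmul b n => simp [e]

theorem lTensor_map_id {X Y : Type*} [AddCommGroup X] [Module ℂ X] [AddCommGroup Y] [Module ℂ Y]
    {A' : Type*} [AddCommGroup A'] [Module ℂ A'] (s : A →ₗ[ℂ] A') (f : X →ₗ[ℂ] Y)
    (x : A ⊗[ℂ] X) : TensorProduct.map s LinearMap.id (f.lTensor A x)
      = f.lTensor A' (TensorProduct.map s LinearMap.id x) := by
  induction x with
  | zero => simp only [LinearMap.map_zero]
  | add x y hx hy => simp only [LinearMap.map_add, hx, hy]
  | tmul a m => simp only [TensorProduct.map_tmul, LinearMap.lTensor_tmul, LinearMap.id_apply]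

/-- `Γ(f) = f` as a linear map. -/
noncomputable def TwoCocycle.functorMap {M N : RelHopf A B} (f : M ⟶ N) :
    γ.functorObj M ⟶ γ.functorObj N :=
  RelHopf.Hom.mk (M := γ.functorObj M) (N := γ.functorObj N) f.hom
    (fun b m =>
      (map_twist γ.toFun M.lsmul N.lsmul LinearMap.id f.hom f.hom f.map_lsmul
        (coactB A B ((γ.toComodAlg B).symm b))
        (M.coact m)).trans (congrArg₂ (fun x y => contractL γ.toFun N.lsmul x y)
          (LinearMap.lTensor_id_apply A B _) (f.map_coact m).symm))
    (fun m b =>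
      (map_twist γ.toFun M.rsmul N.rsmul f.hom LinearMap.id f.hom f.map_rsmul (M.coact m)
        (coactB A B ((γ.toComodAlg B).symm b))).trans
          (congrArg₂ (fun x y => contractL γ.toFun N.rsmul x y)
          (f.map_coact m).symm (LinearMap.lTensor_id_apply A B _)))
    (fun m => (congrArg (TensorProduct.map γ.toAlg.toLinearMap LinearMap.id)
      (f.map_coact m)).trans (lTensor_map_id γ.toAlg.toLinearMap f.hom (M.coact m)))

variable (B) in
/-- The cocycle deformation functor `Γ`. -/
noncomputable def TwoCocycle.functor : RelHopf A B ⥤ RelHopf γ.Alg (γ.ComodAlg B) where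
  obj := γ.functorObj
  map := γ.functorMap
  map_id _ := rfl
  map_comp _ _ := rfl

end
end twistAlg

section starTwist
open Coalgebra

section
variable (A : Type*) [Ring A] [HopfAlgebra ℂ A] [StarRing A] [StarModule ℂ A]

/-- The inverse `S⁻¹ = * ∘ S ∘ *` of the antipode of a Hopf `*`-algebra. -/
noncomputable def antipodeInv : A →ₗ[ℂ] A where
  toFun a := star (HopfAlgebra.antipode ℂ (star a))
  map_add' _ _ := by simp
  map_smul' _ _ := by simp

variable {A}
variable [IsStarBialgebra A]

theorem antipode_antipodeInv (a : A) : HopfAlgebra.antipode ℂ (antipodeInv A a) = a := by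
  have h1 : ∀ x : A ⊗[ℂ] A, LinearMap.mul' ℂ A
      (TensorProduct.map ((HopfAlgebra.antipode ℂ).comp (antipodeInv A)) (HopfAlgebra.antipode ℂ) x)
      = HopfAlgebra.antipode ℂ (star (LinearMap.mul' ℂ A
        ((HopfAlgebra.antipode ℂ).rTensor A (star x)))) := by
    intro x
    induction x with
    | zero => simp only [LinearMap.map_zero, star_zero]
    | add x x' hx hx' => simp only [LinearMap.map_add, star_add, hx, hx']
    | tmul a b => simp [HopfAlgebra.antipode_mul_antidistrib, antipodeInv]
  have h2 : WithConv.toConv ((HopfAlgebra.antipode ℂ).comp (antipodeInv A))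
      * WithConv.toConv (HopfAlgebra.antipode ℂ (A := A)) = 1 := by
    apply WithConv.ofConv_injective
    ext a
    refine (h1 (comul a)).trans ?_
    rw [← IsStarBialgebra.comul_star, HopfAlgebra.mul_antipode_rTensor_comul_apply, counit_star]
    simp [Algebra.algebraMap_eq_smul_one, HopfAlgebra.antipode_one]
  have h3 := left_inv_eq_right_inv h2 LinearMap.antipode_mul_id
  exact congrArg (fun f : WithConv (A →ₗ[ℂ] A) => f.ofConv a) h3

theorem antipodeInv_antipode (a : A) : antipodeInv A (HopfAlgebra.antipode ℂ a) = a := by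
  have h := congrArg star (antipode_antipodeInv (star a))
  simpa [antipodeInv] using h
end

section
variable {A : Type*} [Ring A] [HopfAlgebra ℂ A] (γ : TwoCocycle A)

/-- `U(k) = γ(k₁ ⊗ S(k₂))` -/
noncomputable def TwoCocycle.U : A →ₗ[ℂ] ℂ :=
  TensorProduct.lift γ.toFun ∘ₗ (HopfAlgebra.antipode ℂ).lTensor A ∘ₗ comul

/-- `Ū(k) = γ̄(S(k₁) ⊗ k₂)` -/
noncomputable def TwoCocycle.Ubar : A →ₗ[ℂ] ℂ :=
  TensorProduct.lift γ.inv ∘ₗ (HopfAlgebra.antipode ℂ).rTensor A ∘ₗ comul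

/-- `h₁ ⊗ h₂ ⊗ h₃ ↦ f(h₁) g(h₃) T(h₂)` -/
noncomputable def sandwich (f : A →ₗ[ℂ] ℂ) (T : A →ₗ[ℂ] A) (g : A →ₗ[ℂ] ℂ) :
    A ⊗[ℂ] (A ⊗[ℂ] A) →ₗ[ℂ] A :=
  (TensorProduct.lid ℂ A).toLinearMap ∘ₗ
    TensorProduct.map f ((TensorProduct.rid ℂ A).toLinearMap ∘ₗ TensorProduct.map T g)

/-- `h ↦ h₁ ⊗ h₂ ⊗ h₃` -/
noncomputable def comul₃ (A : Type*) [Ring A] [HopfAlgebra ℂ A] : A →ₗ[ℂ] A ⊗[ℂ] (A ⊗[ℂ] A) :=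
  comul.lTensor A ∘ₗ comul

/-- `S_γ(h) = U(h₁) S(h₂) Ū(h₃)` -/
noncomputable def TwoCocycle.antipodeTwist : γ.Alg →ₗ[ℂ] γ.Alg :=
  γ.toAlg.toLinearMap ∘ₗ (sandwich γ.U (HopfAlgebra.antipode ℂ) γ.Ubar ∘ₗ comul₃ A) ∘ₗ
    γ.toAlg.symm.toLinearMap

/-- `S` is an antipode for the bialgebra `H`. -/
def IsAntipode {H : Type*} [Ring H] [Bialgebra ℂ H] (S : H →ₗ[ℂ] H) : Prop :=
  (∀ h, LinearMap.mul' ℂ H (S.rTensor H (comul h)) = algebraMap ℂ H (counit h)) ∧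
  (∀ h, LinearMap.mul' ℂ H (S.lTensor H (comul h)) = algebraMap ℂ H (counit h))
end

variable {A : Type*} [Ring A] [HopfAlgebra ℂ A] [StarRing A] [StarModule ℂ A] (γ : TwoCocycle A)

/-- `γ` is unitary: `\overline{γ(a ⊗ b)} = γ̄(S(a)^* ⊗ S(b)^*)`. -/
def TwoCocycle.IsUnitary : Prop :=
  ∀ a b, star (γ.toFun a b)
    = γ.inv (star (HopfAlgebra.antipode ℂ a)) (star (HopfAlgebra.antipode ℂ b))

/-- `V(k) = U(S⁻¹(k)) = γ(S⁻¹(k₂) ⊗ k₁)` -/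
noncomputable def TwoCocycle.V : A →ₗ[ℂ] ℂ :=
  TensorProduct.lift γ.toFun ∘ₗ (antipodeInv A).rTensor A ∘ₗ
    (TensorProduct.comm ℂ A A).toLinearMap ∘ₗ comul

/-- `V̄(k) = Ū(S⁻¹(k)) = γ̄(k₂ ⊗ S⁻¹(k₁))` -/
noncomputable def TwoCocycle.Vbar : A →ₗ[ℂ] ℂ :=
  TensorProduct.lift γ.inv ∘ₗ (antipodeInv A).lTensor A ∘ₗ
    (TensorProduct.comm ℂ A A).toLinearMap ∘ₗ comul

/-- `h^{*_γ} = V̄(h₁^*) h₂^* V(h₃^*)` -/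
noncomputable def TwoCocycle.starA (h : A) : A :=
  sandwich γ.Vbar LinearMap.id γ.V (star (comul₃ A h))

/-- `b^{*_γ} = V̄(b₍₋₁₎^*) b₍₀₎^*` -/
noncomputable def TwoCocycle.starB {B : Type*} [Ring B] [Algebra ℂ B] [ComoduleAlgebra A B]
    [StarRing B] [StarModule ℂ B] (b : B) : B :=
  TensorProduct.lid ℂ B (γ.Vbar.rTensor B (star (ComoduleAlgebra.coact (A := A) b)))

/-- `𝔑(ē) = V̄(e₍₋₁₎^*) \overline{e₍₀₎}` -/
noncomputable def TwoCocycle.frakN {A : Type u} {B : Type v} [Ring A] [HopfAlgebra ℂ A]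
    [StarRing A] [StarModule ℂ A] [Ring B] [Algebra ℂ B] [ComoduleAlgebra A B]
    (γ : TwoCocycle A) (M : RelHopf A B) : Conj M.carrier →ₗ[ℂ] Conj M.carrier :=
  (TensorProduct.lid ℂ (Conj M.carrier)).toLinearMap ∘ₗ γ.Vbar.rTensor (Conj M.carrier) ∘ₗ
    RelHopf.barCoact M

end starTwist

end RelativeHopf

open RelativeHopf

/-!
Every map in the theorem is built from operators `m ↦ u(m₍₋₁₎) m₍₀₎` of functionals `u` on `A`
(`coactBy`), and every product from twists of a comodule pairing by a bilinear functional on `A`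
(`contractL`). The proof is the calculus of these two operations.

*Convolution inverses.* `U, Ū` and `V, V̄` are mutually inverse for convolution, because an antipode
is a two-sided inverse of the identity (`IsAntiCoalgMap.diagR_conv_diagL`, applied to the product of
`A` with antipode `S` and to the opposite product with antipode `S⁻¹`). Together with
`γ̄ * (·_γ) = (·) * γ̄` and `(·_γ) * γ = γ * (·)` this shows that `S_γ` is an antipode of `A_γ`
(`TwoCocycle.antipodeTwist_isAntipode`).

*The key identity.* The identity of `A`, as a map to `A` with the one-sided twisted product
`γ(a₁ ⊗ b₁) a₂b₂`, is multiplicative up to `γ`; its convolution inverse `h ↦ S(h₁) Ū(h₂)` is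
therefore antimultiplicative up to `γ̄` (`convInverse_antimul`). Applying the counit and composing
with `S⁻¹` gives
`γ(a₁ ⊗ b₁) V(a₂b₂) = V(a₁) V(b₁) γ̄(S⁻¹(b₂) ⊗ S⁻¹(a₂))` (`TwoCocycle.conv₂_mul_V`).
If `γ` is unitary, `γ̄(S⁻¹(b) ⊗ S⁻¹(a))` is the complex conjugate of `γ(b^* ⊗ a^*)`; so the operator
of `V` turns the twist of any comodule pairing by `γ` into the twist by the conjugate cocycle
(`TwoCocycle.coactBy_V_contractL`).

*Involutions and `𝔑`.* Unitarity also says that complex conjugation exchanges `V` and `V̄`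
(`TwoCocycle.IsUnitary.star_V`). Hence `b^{*_γ}` and `𝔑(ē)` are the ordinary involution and
conjugation after the operator of `V`, and `h^{*_γ}` is the ordinary involution after `V` on the left
and `V̄` on the right. They are involutive, or invertible, since `V` and `V̄` are inverse, and
since conjugation turns the conjugate cocycle back into `γ`, the key identity makes the involutions
antimultiplicative, `𝔑` bilinear, and `𝔑` compatible with `Υ` and `φ`
(`TwoCocycle.IsUnitary.starA_mulA`, `starB_mulB`, `fbIso`, `fbIso_upsilon`).

*The functor `Γ`.* Twisting by `γ̄`, a cocycle on `A_γ`, undoes the twist by `γ`; this gives the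
inverse of `Γ` on objects and morphisms, and that of `φ` (`TwoCocycle.untwist`,
`TwoCocycle.preimage`, `TwoCocycle.muInv`). The coherence of `φ` is the cocycle identity in the form
that twisting preserves associativity of pairings (`twist_assoc`).
-/

namespace RelativeHopf

/-! ### Operators given by functionals on a coalgebra -/

section functionals
open Coalgebra

variable {A M N P : Type*} [AddCommGroup A] [Module ℂ A] [Coalgebra ℂ A]
  [AddCommGroup M] [Module ℂ M] [AddCommGroup N] [Module ℂ N] [AddCommGroup P] [Module ℂ P]

/-- The operator `m ↦ u(m₍₋₁₎) m₍₀₎` on a comodule given by a functional `u` on the coalgebra. -/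
noncomputable def coactBy (δ : M →ₗ[ℂ] A ⊗[ℂ] M) (u : A →ₗ[ℂ] ℂ) : M →ₗ[ℂ] M :=
  (TensorProduct.lid ℂ M).toLinearMap ∘ₗ u.rTensor M ∘ₗ δ

/-- `h ↦ u(h₁) h₂` -/
noncomputable abbrev lact (u : A →ₗ[ℂ] ℂ) : A →ₗ[ℂ] A := coactBy comul u

/-- `h ↦ h₁ u(h₂)` -/
noncomputable def ract (u : A →ₗ[ℂ] ℂ) : A →ₗ[ℂ] A :=
  (TensorProduct.rid ℂ A).toLinearMap ∘ₗ u.lTensor A ∘ₗ comul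

theorem comul_isCoaction : IsCoaction (comul (R := ℂ) (A := A)) where
  counit a := by rw [Coalgebra.rTensor_counit_comul]; simp
  coassoc a := Coalgebra.coassoc_apply a

theorem IsCoaction.coactBy_counit {δ : M →ₗ[ℂ] A ⊗[ℂ] M} (hδ : IsCoaction δ) :
    coactBy δ Coalgebra.counit = LinearMap.id := LinearMap.ext hδ.counit

theorem ract_counit : ract (counit (R := ℂ) (A := A)) = LinearMap.id := by
  ext a; simp [ract]

/-- A linear map `δ` commutes with contracting the left leg by `u`. -/
theorem lid_rTensor_lTensor (u : A →ₗ[ℂ] ℂ) (δ : M →ₗ[ℂ] N) (x : A ⊗[ℂ] M) :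
    δ (TensorProduct.lid ℂ M (u.rTensor M x))
      = TensorProduct.lid ℂ N (u.rTensor N (δ.lTensor A x)) := by
  induction x with
  | zero => simp
  | add x y hx hy => simp only [map_add, hx, hy]
  | tmul a m => simp

/-- `δ(u(m₍₋₁₎) m₍₀₎) = u(m₍₋₂₎) m₍₋₁₎ ⊗ m₍₀₎` -/
theorem IsCoaction.coact_coactBy {δ : M →ₗ[ℂ] A ⊗[ℂ] M} (hδ : IsCoaction δ) (u : A →ₗ[ℂ] ℂ)
    (m : M) : δ (coactBy δ u m) = (lact u).rTensor M (δ m) := by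
  simp only [coactBy, LinearMap.comp_apply, LinearEquiv.coe_coe]
  rw [lid_rTensor_lTensor, ← hδ.coassoc]
  generalize δ m = x
  induction x with
  | zero => simp
  | add x y hx hy => simp only [map_add, hx, hy]
  | tmul a m =>
    simp only [LinearMap.rTensor_tmul, LinearMap.comp_apply, LinearEquiv.coe_coe]
    generalize comul (R := ℂ) a = y
    induction y with
    | zero => simp
    | add x y hx hy => simp only [map_add, add_tmul, hx, hy]
    | tmul b c => simp [smul_tmul']

/-- `m₍₋₁₎ ⊗ u(m₍₀₎₍₋₁₎) m₍₀₎₍₀₎ = m₍₋₂₎ u(m₍₋₁₎) ⊗ m₍₀₎` -/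
theorem IsCoaction.lTensor_coactBy {δ : M →ₗ[ℂ] A ⊗[ℂ] M} (hδ : IsCoaction δ) (u : A →ₗ[ℂ] ℂ)
    (m : M) : (coactBy δ u).lTensor A (δ m) = (ract u).rTensor M (δ m) := by
  simp only [coactBy, LinearMap.lTensor_comp, LinearMap.comp_apply]
  rw [← hδ.coassoc]
  generalize δ m = x
  induction x with
  | zero => simp
  | add x y hx hy => simp only [map_add, hx, hy]
  | tmul a m =>
    simp only [LinearMap.rTensor_tmul, ract, LinearMap.comp_apply, LinearEquiv.coe_coe]
    generalize comul (R := ℂ) a = y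
    induction y with
    | zero => simp
    | add x y hx hy => simp only [map_add, add_tmul, hx, hy]
    | tmul b c => simp [smul_tmul']

/-- `u(m₍₋₂₎) v(m₍₋₁₎) m₍₀₎`, with the convolution product `u * v` written as `v ∘ lact u`. -/
theorem IsCoaction.coactBy_coactBy {δ : M →ₗ[ℂ] A ⊗[ℂ] M} (hδ : IsCoaction δ)
    (u v : A →ₗ[ℂ] ℂ) (m : M) : coactBy δ v (coactBy δ u m) = coactBy δ (v ∘ₗ lact u) m := by
  conv_lhs => rw [coactBy, LinearMap.comp_apply, LinearMap.comp_apply, hδ.coact_coactBy]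
  rw [← LinearMap.rTensor_comp_apply]
  rfl

theorem comul_lact (u : A →ₗ[ℂ] ℂ) (a : A) :
    comul (R := ℂ) (lact u a) = (lact u).rTensor A (comul a) :=
  comul_isCoaction.coact_coactBy u a

theorem lTensor_lact_comul (u : A →ₗ[ℂ] ℂ) (a : A) :
    (lact u).lTensor A (comul a) = (ract u).rTensor A (comul (R := ℂ) a) :=
  comul_isCoaction.lTensor_coactBy u a

theorem comul_ract (u : A →ₗ[ℂ] ℂ) (a : A) :
    comul (R := ℂ) (ract u a) = (ract u).lTensor A (comul a) := by
  have h1 : ∀ x : A ⊗[ℂ] A, comul (R := ℂ) (TensorProduct.rid ℂ A (u.lTensor A x))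
      = (TensorProduct.rid ℂ A).toLinearMap.lTensor A ((u.lTensor A).lTensor A
        (TensorProduct.assoc ℂ A A A ((comul (R := ℂ)).rTensor A x))) := by
    intro x
    induction x with
    | zero => simp
    | add x y hx hy => simp only [map_add, hx, hy]
    | tmul a b =>
      simp only [LinearMap.lTensor_tmul, LinearMap.rTensor_tmul, TensorProduct.rid_tmul, map_smul]
      generalize comul (R := ℂ) a = y
      induction y with
      | zero => simp
      | add x y hx hy => simp only [map_add, add_tmul, smul_add, hx, hy]
      | tmul c d => simp
  refine (h1 _).trans ?_
  rw [Coalgebra.coassoc_apply]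
  simp only [ract, LinearMap.lTensor_comp, LinearMap.comp_apply]

theorem counit_ract (u : A →ₗ[ℂ] ℂ) (a : A) : counit (R := ℂ) (ract u a) = u a := by
  conv_rhs => rw [← comul_isCoaction.counit a]
  simp only [ract, LinearMap.comp_apply, LinearEquiv.coe_coe]
  generalize comul (R := ℂ) a = x
  induction x with
  | zero => simp
  | add x y hx hy => simp only [map_add, hx, hy]
  | tmul a b => simp [mul_comm]

/-- Both sides are the convolution product `(u * v)(a)`. -/
theorem apply_ract_eq_apply_lact (u v : A →ₗ[ℂ] ℂ) (a : A) : u (ract v a) = v (lact u a) := by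
  simp only [coactBy, ract, LinearMap.comp_apply, LinearEquiv.coe_coe]
  generalize comul (R := ℂ) a = x
  induction x with
  | zero => simp
  | add x y hx hy => simp only [map_add, hx, hy]
  | tmul a b => simp [mul_comm]

theorem ract_lact (u v : A →ₗ[ℂ] ℂ) (a : A) : ract v (lact u a) = lact u (ract v a) := by
  change ract v (TensorProduct.lid ℂ A (u.rTensor A (comul a)))
    = TensorProduct.lid ℂ A (u.rTensor A (comul (ract v a)))
  rw [lid_rTensor_lTensor, comul_ract]

theorem ract_ract (u v : A →ₗ[ℂ] ℂ) (a : A) : ract u (ract v a) = ract (u ∘ₗ ract v) a := by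
  conv_lhs => rw [ract, LinearMap.comp_apply, LinearMap.comp_apply, comul_ract]
  rw [← LinearMap.lTensor_comp_apply]
  rfl

/-! ### Twisting pairings by bilinear functionals -/

/-- The convolution product of bilinear maps: `(a, b) ↦ f(a₁, b₁) p(a₂, b₂)`. -/
noncomputable def conv₂ (f : A →ₗ[ℂ] A →ₗ[ℂ] ℂ) (p : A →ₗ[ℂ] A →ₗ[ℂ] P) : A →ₗ[ℂ] A →ₗ[ℂ] P :=
  (contractL f p).compl₁₂ comul comul

/-- The bilinear functional `ε ⊗ ε`. -/
noncomputable def counit₂ (A : Type*) [AddCommGroup A] [Module ℂ A] [Coalgebra ℂ A] :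
    A →ₗ[ℂ] A →ₗ[ℂ] ℂ := (LinearMap.mul ℂ ℂ).compl₁₂ counit counit

variable {δM : M →ₗ[ℂ] A ⊗[ℂ] M} {δN : N →ₗ[ℂ] A ⊗[ℂ] N}

theorem contractL_map (f : A →ₗ[ℂ] A →ₗ[ℂ] ℂ) {M' N' A' : Type*} [AddCommGroup M'] [Module ℂ M']
    [AddCommGroup N'] [Module ℂ N'] [AddCommGroup A'] [Module ℂ A']
    (p : M →ₗ[ℂ] N →ₗ[ℂ] P) (i j : A' →ₗ[ℂ] A)
    (k : M' →ₗ[ℂ] M) (l : N' →ₗ[ℂ] N) (x : A' ⊗[ℂ] M') (y : A' ⊗[ℂ] N') :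
    contractL f p (TensorProduct.map i k x) (TensorProduct.map j l y)
      = contractL (f.compl₁₂ i j) (p.compl₁₂ k l) x y := by
  induction x with
  | zero => simp
  | add x x' hx hx' => simp only [map_add, LinearMap.add_apply, hx, hx']
  | tmul a m =>
  induction y with
  | zero => simp
  | add x x' hx hx' => simp only [map_add, hx, hx']
  | tmul b n => simp

theorem contractR_map (f : A →ₗ[ℂ] A →ₗ[ℂ] ℂ) {M' N' A' : Type*} [AddCommGroup M'] [Module ℂ M']
    [AddCommGroup N'] [Module ℂ N'] [AddCommGroup A'] [Module ℂ A']
    (p : M →ₗ[ℂ] N →ₗ[ℂ] P) (i j : A' →ₗ[ℂ] A)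
    (k : M' →ₗ[ℂ] M) (l : N' →ₗ[ℂ] N) (x : M' ⊗[ℂ] A') (y : N' ⊗[ℂ] A') :
    contractR p f (TensorProduct.map k i x) (TensorProduct.map l j y)
      = contractR (p.compl₁₂ k l) (f.compl₁₂ i j) x y := by
  induction x with
  | zero => simp
  | add x x' hx hx' => simp only [map_add, LinearMap.add_apply, hx, hx']
  | tmul a m =>
  induction y with
  | zero => simp
  | add x x' hx hx' => simp only [map_add, hx, hx']
  | tmul b n => simp

theorem contractL_compr₂ (f : A →ₗ[ℂ] A →ₗ[ℂ] ℂ) {Q : Type*} [AddCommGroup Q] [Module ℂ Q]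
    (p : M →ₗ[ℂ] N →ₗ[ℂ] P) (k : P →ₗ[ℂ] Q) (x : A ⊗[ℂ] M) (y : A ⊗[ℂ] N) :
    k (contractL f p x y) = contractL f (p.compr₂ k) x y := by
  induction x with
  | zero => simp
  | add x x' hx hx' => simp only [map_add, LinearMap.add_apply, hx, hx']
  | tmul a m =>
  induction y with
  | zero => simp
  | add x x' hx hx' => simp only [map_add, hx, hx']
  | tmul b n => simp

theorem contractR_compr₂ (f : A →ₗ[ℂ] A →ₗ[ℂ] ℂ) {Q : Type*} [AddCommGroup Q] [Module ℂ Q]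
    (p : M →ₗ[ℂ] N →ₗ[ℂ] P) (k : P →ₗ[ℂ] Q) (x : M ⊗[ℂ] A) (y : N ⊗[ℂ] A) :
    k (contractR p f x y) = contractR (p.compr₂ k) f x y := by
  induction x with
  | zero => simp
  | add x x' hx hx' => simp only [map_add, LinearMap.add_apply, hx, hx']
  | tmul a m =>
  induction y with
  | zero => simp
  | add x x' hx hx' => simp only [map_add, hx, hx']
  | tmul b n => simp

/-- The bilinear functionals act on pairings of comodules, compatibly with convolution. -/
theorem contractL_contractL (hM : IsCoaction δM) (hN : IsCoaction δN)
    (f g : A →ₗ[ℂ] A →ₗ[ℂ] ℂ) (p : M →ₗ[ℂ] N →ₗ[ℂ] P) (m : M) (n : N) :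
    contractL f ((contractL g p).compl₁₂ δM δN) (δM m) (δN n)
      = contractL (conv₂ f g) p (δM m) (δN n) := by
  have h := contractL_map f (contractL g p) LinearMap.id LinearMap.id δM δN (δM m) (δN n)
  refine h.symm.trans ?_
  change contractL f (contractL g p) (δM.lTensor A (δM m)) (δN.lTensor A (δN n)) = _
  rw [← hM.coassoc, ← hN.coassoc]
  generalize δM m = x
  generalize δN n = y
  induction x with
  | zero => simp
  | add x x' hx hx' => simp only [map_add, LinearMap.add_apply, hx, hx']
  | tmul a m =>
  induction y with
  | zero => simp
  | add x x' hx hx' => simp only [map_add, hx, hx']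
  | tmul b n =>
  simp only [LinearMap.rTensor_tmul, contractL_tmul, conv₂, LinearMap.compl₁₂_apply]
  generalize comul (R := ℂ) a = x
  generalize comul (R := ℂ) b = y
  induction x with
  | zero => simp
  | add x x' hx hx' => simp only [map_add, LinearMap.add_apply, add_tmul, add_smul, hx, hx']
  | tmul a a' =>
  induction y with
  | zero => simp
  | add x x' hx hx' => simp only [map_add, add_tmul, add_smul, hx, hx']
  | tmul b b' => simp [smul_smul]

theorem contractL_counit₂ (hM : IsCoaction δM) (hN : IsCoaction δN)
    (p : M →ₗ[ℂ] N →ₗ[ℂ] P) (m : M) (n : N) :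
    contractL (counit₂ A) p (δM m) (δN n) = p m n := by
  conv_rhs => rw [← hM.counit m, ← hN.counit n]
  generalize δM m = x
  generalize δN n = y
  induction x with
  | zero => simp
  | add x x' hx hx' => simp only [map_add, LinearMap.add_apply, hx, hx']
  | tmul a m =>
  induction y with
  | zero => simp
  | add x x' hx hx' => simp only [map_add, hx, hx']
  | tmul b n => simp [counit₂, smul_smul, mul_comm]

/-- Twisting on the left commutes with twisting on the right: both sides are
`(a, b) ↦ f(a₁, b₁) g(a₃, b₃) p(a₂, b₂)`. -/
theorem contractR_conv₂ (f g : A →ₗ[ℂ] A →ₗ[ℂ] ℂ) (p : A →ₗ[ℂ] A →ₗ[ℂ] P) :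
    (contractR (conv₂ f p) g).compl₁₂ comul comul
      = conv₂ f ((contractR p g).compl₁₂ comul comul) := by
  refine LinearMap.ext₂ fun a b => ?_
  have h1 := contractR_map g (contractL f p) LinearMap.id LinearMap.id comul comul
    (comul (R := ℂ) a) (comul (R := ℂ) b)
  have h2 := contractL_map f (contractR p g) LinearMap.id LinearMap.id comul comul
    (comul (R := ℂ) a) (comul (R := ℂ) b)
  refine h1.symm.trans (Eq.trans ?_ h2)
  change contractR (contractL f p) g ((comul (R := ℂ)).rTensor A (comul a))
      ((comul (R := ℂ)).rTensor A (comul b)) = contractL f (contractR p g)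
      ((comul (R := ℂ)).lTensor A (comul a)) ((comul (R := ℂ)).lTensor A (comul b))
  rw [← Coalgebra.coassoc_apply, ← Coalgebra.coassoc_apply]
  generalize (comul (R := ℂ)).rTensor A (comul (R := ℂ) a) = x
  generalize (comul (R := ℂ)).rTensor A (comul (R := ℂ) b) = y
  induction x with
  | zero => simp
  | add x x' hx hx' => simp only [map_add, LinearMap.add_apply, hx, hx']
  | tmul x a =>
  induction y with
  | zero => simp
  | add x x' hx hx' => simp only [map_add, hx, hx']
  | tmul y b =>
  induction x with
  | zero => simp
  | add x x' hx hx' => simp only [map_add, LinearMap.add_apply, add_tmul, hx, hx']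
  | tmul c c' =>
  induction y with
  | zero => simp
  | add x x' hx hx' => simp only [map_add, add_tmul, hx, hx']
  | tmul d d' => simp [smul_smul, mul_comm]

theorem conv₂_assoc (f g : A →ₗ[ℂ] A →ₗ[ℂ] ℂ) (p : A →ₗ[ℂ] A →ₗ[ℂ] P) :
    conv₂ (conv₂ f g) p = conv₂ f (conv₂ g p) :=
  LinearMap.ext₂ fun a b =>
    (contractL_contractL comul_isCoaction comul_isCoaction f g p a b).symm

theorem counit₂_conv₂ (p : A →ₗ[ℂ] A →ₗ[ℂ] P) : conv₂ (counit₂ A) p = p :=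
  LinearMap.ext₂ fun a b => contractL_counit₂ comul_isCoaction comul_isCoaction p a b

theorem contractR_counit₂ (p : A →ₗ[ℂ] A →ₗ[ℂ] P) (a b : A) :
    contractR p (counit₂ A) (comul a) (comul b) = p a b := by
  conv_rhs => rw [← LinearMap.id_apply (R := ℂ) a, ← LinearMap.id_apply (R := ℂ) b, ← ract_counit]
  simp only [ract, LinearMap.comp_apply, LinearEquiv.coe_coe]
  generalize comul (R := ℂ) a = x
  generalize comul (R := ℂ) b = y
  induction x with
  | zero => simp
  | add x x' hx hx' => simp only [map_add, LinearMap.add_apply, hx, hx']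
  | tmul a m =>
  induction y with
  | zero => simp
  | add x x' hx hx' => simp only [map_add, hx, hx']
  | tmul b n => simp [counit₂, smul_smul, mul_comm]

/-- For scalar-valued pairings the two contractions agree, as `ℂ` is commutative. -/
theorem contractL_eq_contractR (f g : A →ₗ[ℂ] A →ₗ[ℂ] ℂ) (x y : A ⊗[ℂ] A) :
    contractL f g x y = contractR f g x y := by
  induction x with
  | zero => simp
  | add x x' hx hx' => simp only [map_add, LinearMap.add_apply, hx, hx']
  | tmul a m =>
  induction y with
  | zero => simp
  | add x x' hx hx' => simp only [map_add, hx, hx']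
  | tmul b n => simp [mul_comm]

theorem conv₂_counit₂ (f : A →ₗ[ℂ] A →ₗ[ℂ] ℂ) : conv₂ f (counit₂ A) = f :=
  LinearMap.ext₂ fun a b =>
    (contractL_eq_contractR f _ _ _).trans (contractR_counit₂ f a b)

/-- Twisting by `f` and then by its convolution inverse changes nothing. -/
theorem contractL_contractL_of_inverse (hM : IsCoaction δM) (hN : IsCoaction δN)
    {f g : A →ₗ[ℂ] A →ₗ[ℂ] ℂ} (hfg : conv₂ f g = counit₂ A) (p : M →ₗ[ℂ] N →ₗ[ℂ] P) (m : M)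
    (n : N) : contractL f ((contractL g p).compl₁₂ δM δN) (δM m) (δN n) = p m n := by
  rw [contractL_contractL hM hN, hfg, contractL_counit₂ hM hN]

theorem contractL_lact (hM : IsCoaction δM) (hN : IsCoaction δN) (u : A →ₗ[ℂ] ℂ)
    (f : A →ₗ[ℂ] A →ₗ[ℂ] ℂ) (p : M →ₗ[ℂ] N →ₗ[ℂ] P) (m : M) (n : N) :
    contractL f p (δM (coactBy δM u m)) (δN (coactBy δN u n))
      = contractL (f.compl₁₂ (lact u) (lact u)) p (δM m) (δN n) := by
  rw [hM.coact_coactBy, hN.coact_coactBy]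
  exact contractL_map f p _ _ LinearMap.id LinearMap.id _ _

/-- The operator of a functional `u` on a twisted product is the twist by `f * (u ∘ mul)`. -/
theorem coactBy_contractL (hM : IsCoaction δM) (hN : IsCoaction δN) {δP : P →ₗ[ℂ] A ⊗[ℂ] P}
    (mul : A →ₗ[ℂ] A →ₗ[ℂ] A) (u : A →ₗ[ℂ] ℂ)
    (f : A →ₗ[ℂ] A →ₗ[ℂ] ℂ) (p : M →ₗ[ℂ] N →ₗ[ℂ] P)
    (hp : ∀ m n, δP (p m n) = map₂ mul p (δM m) (δN n)) (m : M) (n : N) :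
    coactBy δP u (contractL f p (δM m) (δN n))
      = contractL (conv₂ f (mul.compr₂ u)) p (δM m) (δN n) := by
  rw [contractL_compr₂, ← contractL_contractL hM hN]
  refine congrArg (fun q => contractL f q (δM m) (δN n)) (LinearMap.ext₂ fun m n => ?_)
  simp only [LinearMap.compr₂_apply, LinearMap.compl₁₂_apply, coactBy, LinearMap.comp_apply, hp,
    LinearEquiv.coe_coe]
  generalize δM m = x
  generalize δN n = y
  induction x with
  | zero => simp
  | add x x' hx hx' => simp only [map_add, LinearMap.add_apply, hx, hx']
  | tmul a m =>
  induction y with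
  | zero => simp
  | add x x' hx hx' => simp only [map_add, hx, hx']
  | tmul b n => simp

end functionals

/-! ### Contractions along the iterated comultiplication -/

section diagonal
open Coalgebra

variable {A P Q : Type*} [AddCommGroup A] [Module ℂ A] [Coalgebra ℂ A]
  [AddCommGroup P] [Module ℂ P] [AddCommGroup Q] [Module ℂ Q]

/-- `(Δ ⊗ Δ)(Δ(a))` as the fourfold comultiplication in which the two inner legs
are produced last. -/
theorem map_comul_comul (a : A) : TensorProduct.map comul comul (comul (R := ℂ) a)
    = (TensorProduct.assoc ℂ A A (A ⊗[ℂ] A)).symm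
      ((TensorProduct.assoc ℂ A A A).toLinearMap.lTensor A (((comul (R := ℂ)).rTensor A).lTensor A
        ((comul (R := ℂ)).lTensor A (comul a)))) := by
  have h : TensorProduct.map comul comul ∘ₗ comul (R := ℂ) (A := A)
      = (TensorProduct.assoc ℂ A A (A ⊗[ℂ] A)).symm.toLinearMap ∘ₗ
        (TensorProduct.assoc ℂ A A A).toLinearMap.lTensor A ∘ₗ
        ((comul (R := ℂ)).rTensor A).lTensor A ∘ₗ (comul (R := ℂ)).lTensor A ∘ₗ comul := by
    simp only [coassoc_simps]
  exact LinearMap.congr_fun h a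

/-- `F(h₂, h₃) ⊗ G(h₁, h₄)`, computed by contracting the two inner legs first. -/
theorem lift_map₂_comm_left (F : A →ₗ[ℂ] A →ₗ[ℂ] P) (G : A →ₗ[ℂ] A →ₗ[ℂ] Q) (h : A) :
    TensorProduct.lift ((map₂ F G).compl₁₂ ((TensorProduct.comm ℂ A A).toLinearMap ∘ₗ comul) comul)
      (comul h) = TensorProduct.map (TensorProduct.lift F ∘ₗ comul) (TensorProduct.lift G)
        (TensorProduct.leftComm ℂ A A A ((comul (R := ℂ)).lTensor A (comul h))) := by
  have h1 : ∀ x : A ⊗[ℂ] A, TensorProduct.lift ((map₂ F G).compl₁₂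
      ((TensorProduct.comm ℂ A A).toLinearMap ∘ₗ comul) comul) x
      = TensorProduct.lift ((map₂ F G).compl₁₂ (TensorProduct.comm ℂ A A).toLinearMap
        LinearMap.id) (TensorProduct.map comul comul x) := by
    intro x
    induction x with
    | zero => simp
    | add x y hx hy => simp only [map_add, hx, hy]
    | tmul a b => simp
  rw [h1, map_comul_comul]
  generalize (comul (R := ℂ)).lTensor A (comul (R := ℂ) h) = x
  induction x with
  | zero => simp
  | add x y hx hy => simp only [map_add, hx, hy]
  | tmul a x =>
  induction x with
  | zero => simp
  | add x y hx hy => simp only [map_add, tmul_add, hx, hy]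
  | tmul b c =>
  simp only [LinearMap.lTensor_tmul, LinearMap.rTensor_tmul, TensorProduct.leftComm_tmul,
    TensorProduct.map_tmul, LinearMap.comp_apply, TensorProduct.lift.tmul]
  generalize comul (R := ℂ) b = x
  induction x with
  | zero => simp
  | add x y hx hy => simp only [map_add, tmul_add, add_tmul, hx, hy]
  | tmul b b' => simp

/-- `F(h₁, h₄) ⊗ G(h₂, h₃)`, computed by contracting the two inner legs first. -/
theorem lift_map₂_comm_right (F : A →ₗ[ℂ] A →ₗ[ℂ] P) (G : A →ₗ[ℂ] A →ₗ[ℂ] Q) (h : A) :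
    TensorProduct.lift ((map₂ F G).compl₁₂ comul ((TensorProduct.comm ℂ A A).toLinearMap ∘ₗ comul))
      (comul h) = TensorProduct.comm ℂ Q P (TensorProduct.map (TensorProduct.lift G ∘ₗ comul)
        (TensorProduct.lift F)
        (TensorProduct.leftComm ℂ A A A ((comul (R := ℂ)).lTensor A (comul h)))) := by
  rw [← lift_map₂_comm_left]
  generalize comul (R := ℂ) h = x
  induction x with
  | zero => simp
  | add x y hx hy => simp only [map_add, hx, hy]
  | tmul a b =>
  simp only [TensorProduct.lift.tmul, LinearMap.compl₁₂_apply, LinearMap.comp_apply,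
    LinearEquiv.coe_coe]
  generalize comul (R := ℂ) a = x
  generalize comul (R := ℂ) b = y
  induction x with
  | zero => simp
  | add x x' hx hx' => simp only [map_add, LinearMap.add_apply, hx, hx']
  | tmul a m =>
  induction y with
  | zero => simp
  | add x x' hx hx' => simp only [map_add, hx, hx']
  | tmul b n => simp

/-- `h ↦ F(S(h₁), h₂)` -/
noncomputable def diagL (S : A →ₗ[ℂ] A) (F : A →ₗ[ℂ] A →ₗ[ℂ] P) : A →ₗ[ℂ] P :=
  TensorProduct.lift (F ∘ₗ S) ∘ₗ comul

/-- `h ↦ F(h₁, S(h₂))` -/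
noncomputable def diagR (S : A →ₗ[ℂ] A) (F : A →ₗ[ℂ] A →ₗ[ℂ] P) : A →ₗ[ℂ] P :=
  TensorProduct.lift (F.compl₂ S) ∘ₗ comul

/-- `S` reverses the comultiplication: `Δ(S(a)) = S(a₂) ⊗ S(a₁)`. -/
def IsAntiCoalgMap (S : A →ₗ[ℂ] A) : Prop :=
  ∀ a, comul (R := ℂ) (S a) = TensorProduct.map S S (TensorProduct.comm ℂ A A (comul a))

/-- `F(h₂) ⊗ G(h₁ ⊗ h₃) = p ⊗ G(h₁ ⊗ h₂)` if the inner contraction is `F(h) = ε(h) p`. -/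
theorem leftComm_inner_counit (p : P) (F : A →ₗ[ℂ] P) (hF : ∀ h, F h = counit (R := ℂ) h • p)
    (G : A ⊗[ℂ] A →ₗ[ℂ] Q) (h : A) : TensorProduct.map F G
      (TensorProduct.leftComm ℂ A A A ((comul (R := ℂ)).lTensor A (comul h)))
      = p ⊗ₜ G (comul h) := by
  have h1 : ∀ x : A ⊗[ℂ] A, TensorProduct.map F G
      (TensorProduct.leftComm ℂ A A A ((comul (R := ℂ)).lTensor A x))
      = p ⊗ₜ G ((TensorProduct.lid ℂ A).toLinearMap.lTensor A
        (((counit (R := ℂ)).rTensor A).lTensor A ((comul (R := ℂ)).lTensor A x))) := by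
    intro x
    induction x with
    | zero => simp
    | add x y hx hy => simp only [map_add, tmul_add, hx, hy]
    | tmul a b =>
    simp only [LinearMap.lTensor_tmul]
    generalize comul (R := ℂ) b = x
    induction x with
    | zero => simp
    | add x y hx hy => simp only [map_add, tmul_add, hx, hy]
    | tmul b b' =>
      simp only [TensorProduct.leftComm_tmul, TensorProduct.map_tmul, hF, LinearMap.lTensor_tmul,
        LinearMap.rTensor_tmul, LinearEquiv.coe_coe, TensorProduct.lid_tmul]
      rw [← smul_tmul', tmul_smul, map_smul, tmul_smul]
  rw [h1, ← LinearMap.lTensor_comp_apply, ← LinearMap.lTensor_comp_apply]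
  have h2 : ((TensorProduct.lid ℂ A).toLinearMap ∘ₗ (counit (R := ℂ)).rTensor A) ∘ₗ comul
      = LinearMap.id := LinearMap.ext comul_isCoaction.counit
  rw [h2, LinearMap.lTensor_id_apply]

/-- `u(h₂) G(h₁, h₃)`, with the inner functional moved to the right leg. -/
theorem leftComm_inner (u : A →ₗ[ℂ] ℂ) (G : A →ₗ[ℂ] A →ₗ[ℂ] Q) (h : A) :
    TensorProduct.lid ℂ Q (TensorProduct.map u (TensorProduct.lift G)
      (TensorProduct.leftComm ℂ A A A ((comul (R := ℂ)).lTensor A (comul h))))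
      = TensorProduct.lift (G.compl₂ (lact u)) (comul h) := by
  generalize comul (R := ℂ) h = x
  induction x with
  | zero => simp
  | add x y hx hy => simp only [map_add, hx, hy]
  | tmul a b =>
  simp only [LinearMap.lTensor_tmul, TensorProduct.lift.tmul, LinearMap.compl₂_apply, coactBy,
    LinearMap.comp_apply, LinearEquiv.coe_coe]
  generalize comul (R := ℂ) b = x
  induction x with
  | zero => simp
  | add x y hx hy => simp only [map_add, tmul_add, hx, hy]
  | tmul b b' => simp

/-- In `G(h₁, h₃) u(h₂)` the functional may be attached to either leg. -/
theorem lift_compl₂_lact (u : A →ₗ[ℂ] ℂ) (G : A →ₗ[ℂ] A →ₗ[ℂ] Q) (h : A) :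
    TensorProduct.lift (G.compl₂ (lact u)) (comul h)
      = TensorProduct.lift (G ∘ₗ ract u) (comul h) := by
  have h1 : ∀ (i j : A →ₗ[ℂ] A) (x : A ⊗[ℂ] A), TensorProduct.lift (G.compl₁₂ i j) x
      = TensorProduct.lift G (TensorProduct.map i j x) := by
    intro i j x
    induction x with
    | zero => simp
    | add x y hx hy => simp only [map_add, hx, hy]
    | tmul a b => simp
  refine (h1 LinearMap.id (lact u) _).trans (Eq.trans ?_ (h1 (ract u) LinearMap.id _).symm)
  exact congrArg _ (lTensor_lact_comul u h)

variable {S : A →ₗ[ℂ] A}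

/-- `F(S(h₂), h₃) ⊗ G(S(h₁), h₄)`: since `S` reverses the comultiplication, the legs of `F` are the
inner ones. -/
theorem IsAntiCoalgMap.diagL_map₂ (hS : IsAntiCoalgMap S) (F : A →ₗ[ℂ] A →ₗ[ℂ] P)
    (G : A →ₗ[ℂ] A →ₗ[ℂ] Q) (h : A) :
    diagL S ((map₂ F G).compl₁₂ comul comul) h
      = TensorProduct.map (diagL S F) (TensorProduct.lift (G ∘ₗ S))
        (TensorProduct.leftComm ℂ A A A ((comul (R := ℂ)).lTensor A (comul h))) := by
  refine Eq.trans ?_ (lift_map₂_comm_left (F ∘ₗ S) (G ∘ₗ S) h)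
  refine congrArg (fun q => TensorProduct.lift q (comul h)) (LinearMap.ext₂ fun a b => ?_)
  simp only [LinearMap.comp_apply, LinearMap.compl₁₂_apply, LinearEquiv.coe_coe]
  rw [hS]
  generalize TensorProduct.comm ℂ A A (comul (R := ℂ) a) = x
  generalize comul (R := ℂ) b = y
  induction x with
  | zero => simp
  | add x x' hx hx' => simp only [map_add, LinearMap.add_apply, hx, hx']
  | tmul a m =>
  induction y with
  | zero => simp
  | add x x' hx hx' => simp only [map_add, hx, hx']
  | tmul b n => simp

/-- `F(h₁, S(h₄)) ⊗ G(h₂, S(h₃))`: here the legs of `G` are the inner ones. -/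
theorem IsAntiCoalgMap.diagR_map₂ (hS : IsAntiCoalgMap S) (F : A →ₗ[ℂ] A →ₗ[ℂ] P)
    (G : A →ₗ[ℂ] A →ₗ[ℂ] Q) (h : A) :
    diagR S ((map₂ F G).compl₁₂ comul comul) h
      = TensorProduct.comm ℂ Q P (TensorProduct.map (diagR S G) (TensorProduct.lift (F.compl₂ S))
        (TensorProduct.leftComm ℂ A A A ((comul (R := ℂ)).lTensor A (comul h)))) := by
  refine Eq.trans ?_ (lift_map₂_comm_right (F.compl₂ S) (G.compl₂ S) h)
  refine congrArg (fun q => TensorProduct.lift q (comul h)) (LinearMap.ext₂ fun a b => ?_)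
  simp only [LinearMap.comp_apply, LinearMap.compl₁₂_apply, LinearEquiv.coe_coe,
    LinearMap.compl₂_apply]
  rw [hS]
  generalize TensorProduct.comm ℂ A A (comul (R := ℂ) b) = y
  generalize comul (R := ℂ) a = x
  induction x with
  | zero => simp
  | add x x' hx hx' => simp only [map_add, LinearMap.add_apply, hx, hx']
  | tmul a m =>
  induction y with
  | zero => simp
  | add x x' hx hx' => simp only [map_add, hx, hx']
  | tmul b n => simp

theorem diagL_compr₂ (S : A →ₗ[ℂ] A) (F : A →ₗ[ℂ] A →ₗ[ℂ] P) (k : P →ₗ[ℂ] Q) :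
    diagL S (F.compr₂ k) = k ∘ₗ diagL S F := by
  have h : F.compr₂ k ∘ₗ S = (F ∘ₗ S).compr₂ k := rfl
  rw [diagL, h, TensorProduct.lift_compr₂, LinearMap.comp_assoc]
  rfl

theorem diagR_compr₂ (S : A →ₗ[ℂ] A) (F : A →ₗ[ℂ] A →ₗ[ℂ] P) (k : P →ₗ[ℂ] Q) :
    diagR S (F.compr₂ k) = k ∘ₗ diagR S F := by
  have h : (F.compr₂ k).compl₂ S = (F.compl₂ S).compr₂ k := rfl
  rw [diagR, h, TensorProduct.lift_compr₂, LinearMap.comp_assoc]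
  rfl

/-- `F(S(h₂), h₃) f(S(h₁), h₄) = f(S(h₁), h₂) p` if `F(S(h₁), h₂) = ε(h) p`. -/
theorem IsAntiCoalgMap.diagL_contractR (hS : IsAntiCoalgMap S) (F : A →ₗ[ℂ] A →ₗ[ℂ] P)
    (f : A →ₗ[ℂ] A →ₗ[ℂ] ℂ) (p : P) (hF : ∀ h, diagL S F h = counit (R := ℂ) h • p) (h : A) :
    diagL S ((contractR F f).compl₁₂ comul comul) h = diagL S f h • p := by
  have h1 : (contractR F f).compl₁₂ comul comul = ((map₂ F f).compl₁₂ (comul (R := ℂ) (A := A))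
    comul).compr₂ (TensorProduct.rid ℂ P).toLinearMap := rfl
  rw [h1, diagL_compr₂, LinearMap.comp_apply, hS.diagL_map₂, leftComm_inner_counit p _ hF]
  simp [diagL]

/-- `f(S(h₂), h₃) G(S(h₁), h₄)`, contracting the inner legs first. -/
theorem IsAntiCoalgMap.diagL_conv₂ (hS : IsAntiCoalgMap S) (f : A →ₗ[ℂ] A →ₗ[ℂ] ℂ)
    (G : A →ₗ[ℂ] A →ₗ[ℂ] P) (h : A) :
    diagL S (conv₂ f G) h = diagL (S ∘ₗ ract (diagL S f)) G h := by
  have h1 : conv₂ f G = ((map₂ f G).compl₁₂ (comul (R := ℂ) (A := A))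
    comul).compr₂ (TensorProduct.lid ℂ P).toLinearMap := rfl
  rw [h1, diagL_compr₂, LinearMap.comp_apply, hS.diagL_map₂]
  exact (leftComm_inner _ _ _).trans (lift_compl₂_lact _ _ _)

/-- `f(h₁, S(h₄)) G(h₂, S(h₃)) = f(h₁, S(h₂)) p` if `G(h₁, S(h₂)) = ε(h) p`. -/
theorem IsAntiCoalgMap.diagR_conv₂ (hS : IsAntiCoalgMap S) (f : A →ₗ[ℂ] A →ₗ[ℂ] ℂ)
    (G : A →ₗ[ℂ] A →ₗ[ℂ] P) (p : P) (hG : ∀ h, diagR S G h = counit (R := ℂ) h • p) (h : A) :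
    diagR S (conv₂ f G) h = diagR S f h • p := by
  have h1 : conv₂ f G = ((map₂ f G).compl₁₂ (comul (R := ℂ) (A := A))
    comul).compr₂ (TensorProduct.lid ℂ P).toLinearMap := rfl
  rw [h1, diagR_compr₂, LinearMap.comp_apply, hS.diagR_map₂, leftComm_inner_counit p _ hG]
  simp [diagR]

/-- `F(h₁, S(h₄)) g(h₂, S(h₃))`, contracting the inner legs first. -/
theorem IsAntiCoalgMap.diagR_contractR (hS : IsAntiCoalgMap S) (F : A →ₗ[ℂ] A →ₗ[ℂ] P)
    (g : A →ₗ[ℂ] A →ₗ[ℂ] ℂ) (h : A) :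
    diagR S ((contractR F g).compl₁₂ comul comul) h = diagR (S ∘ₗ lact (diagR S g)) F h := by
  have h1 : (contractR F g).compl₁₂ comul comul = ((map₂ F g).compl₁₂ (comul (R := ℂ) (A := A))
    comul).compr₂ (TensorProduct.rid ℂ P).toLinearMap := rfl
  rw [h1, diagR_compr₂, LinearMap.comp_apply, hS.diagR_map₂]
  refine Eq.trans ?_ (leftComm_inner (diagR S g) (F.compl₂ S) h)
  generalize TensorProduct.leftComm ℂ A A A ((comul (R := ℂ)).lTensor A (comul (R := ℂ) h)) = x
  induction x with
  | zero => simp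
  | add x y hx hy => simp only [map_add, hx, hy]
  | tmul a b => simp

/-- `g(S(h₁), h₂) f(h₃, S(h₄)) = ε(h)`, when `f` twists a product `mul` with antipode `S` to an
associative unital product `·` and `g` is the convolution inverse of `f`.

The map `ρ(h) = S(h₁) g(S(h₂), h₃)` satisfies `ρ(h₁) · h₂ = ε(h) e`, while `S` satisfies
`h₁ · S(h₂) = f(h₁, S(h₂)) e`. Associativity of `ρ(h₁) · h₂ · S(h₃)` gives
`ρ(h₁) f(h₂, S(h₃)) = S(h)`, and applying the counit yields the claim. -/
theorem IsAntiCoalgMap.diagR_conv_diagL (hS : IsAntiCoalgMap S)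
    (hε : ∀ a, counit (R := ℂ) (S a) = counit (R := ℂ) a)
    (mul : A →ₗ[ℂ] A →ₗ[ℂ] A) (e : A) (f g : A →ₗ[ℂ] A →ₗ[ℂ] ℂ) (hgf : conv₂ g f = counit₂ A)
    (assoc : ∀ a b c, conv₂ f mul (conv₂ f mul a b) c = conv₂ f mul a (conv₂ f mul b c))
    (one_mul : ∀ a, conv₂ f mul e a = a) (mul_one : ∀ a, conv₂ f mul a e = a)
    (hL : ∀ h, diagL S mul h = counit (R := ℂ) h • e)
    (hR : ∀ h, diagR S mul h = counit (R := ℂ) h • e) (h : A) :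
    diagL S g (ract (diagR S f) h) = counit (R := ℂ) h := by
  have hL' : ∀ h, diagL (S ∘ₗ ract (diagL S g)) (conv₂ f mul) h = counit (R := ℂ) h • e := by
    intro h
    rw [← hS.diagL_conv₂, ← conv₂_assoc, hgf, counit₂_conv₂, hL]
  have hR' : ∀ h, diagR S (conv₂ f mul) h = diagR S f h • e := fun h =>
    hS.diagR_conv₂ f mul e hR h
  set m := conv₂ f mul
  set ρ := S ∘ₗ ract (diagL S g) with hρ
  -- both sides of `(ρ(h₁) h₂) S(h₃) = ρ(h₁) (h₂ S(h₃))`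
  have e1 : ∀ x : A ⊗[ℂ] A, TensorProduct.lift (m ∘ₗ ρ)
      (((TensorProduct.lift (m.compl₂ S)).lTensor A) ((comul (R := ℂ)).lTensor A x))
      = S (ract (diagL S g) (TensorProduct.rid ℂ A ((diagR S f).lTensor A x))) := by
    intro x
    induction x with
    | zero => simp
    | add x y hx hy => simp only [map_add, hx, hy]
    | tmul a b =>
      have := hR' b
      simp only [diagR, LinearMap.comp_apply] at this
      simp [this, mul_one, hρ, diagR]
  have e2 : ∀ x : A ⊗[ℂ] A, TensorProduct.lift (m ∘ₗ ρ)
      (((TensorProduct.lift (m.compl₂ S)).lTensor A) (TensorProduct.assoc ℂ A A A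
        ((comul (R := ℂ)).rTensor A x)))
      = S (TensorProduct.lid ℂ A ((counit (R := ℂ)).rTensor A x)) := by
    intro x
    induction x with
    | zero => simp
    | add x y hx hy => simp only [map_add, hx, hy]
    | tmul a b =>
      have := hL' a
      simp only [diagL, LinearMap.comp_apply] at this
      have h3 : ∀ y : A ⊗[ℂ] A, TensorProduct.lift (m ∘ₗ ρ)
          (((TensorProduct.lift (m.compl₂ S)).lTensor A) (TensorProduct.assoc ℂ A A A (y ⊗ₜ b)))
          = m (TensorProduct.lift (m ∘ₗ ρ) y) (S b) := by
        intro y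
        induction y with
        | zero => simp
        | add x y hx hy => simp only [map_add, add_tmul, LinearMap.add_apply, hx, hy]
        | tmul c d => simp [assoc]
      rw [LinearMap.rTensor_tmul, h3, this]
      simp [one_mul]
  have h4 := e2 (comul h)
  rw [Coalgebra.coassoc_apply, e1] at h4
  have h5 := congrArg (counit (R := ℂ)) h4
  rw [hε, hε, comul_isCoaction.counit, counit_ract] at h5
  exact h5

end diagonal

/-! ### The functionals `U` and `V` and their convolution inverses -/

section antipode
open Coalgebra

section
variable {A : Type*} [Ring A] [HopfAlgebra ℂ A]

theorem diagL_antipode_mul (h : A) : diagL (HopfAlgebra.antipode ℂ) (LinearMap.mul ℂ A) h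
    = counit (R := ℂ) h • 1 := by
  rw [← Algebra.algebraMap_eq_smul_one, ← HopfAlgebra.mul_antipode_rTensor_comul_apply h]
  simp only [diagL, LinearMap.comp_apply]
  generalize comul (R := ℂ) h = x
  induction x with
  | zero => simp
  | add x y hx hy => simp only [map_add, hx, hy]
  | tmul a b => simp

theorem diagR_antipode_mul (h : A) : diagR (HopfAlgebra.antipode ℂ) (LinearMap.mul ℂ A) h
    = counit (R := ℂ) h • 1 := by
  rw [← Algebra.algebraMap_eq_smul_one, ← HopfAlgebra.mul_antipode_lTensor_comul_apply h]
  simp only [diagR, LinearMap.comp_apply]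
  generalize comul (R := ℂ) h = x
  induction x with
  | zero => simp
  | add x y hx hy => simp only [map_add, hx, hy]
  | tmul a b => simp

/-- `Δ ∘ S` and `(S ⊗ S) ∘ Δᶜᵒᵖ` are both convolution inverse to `Δ`. -/
theorem antipode_isAntiCoalgMap : IsAntiCoalgMap (HopfAlgebra.antipode ℂ (A := A)) := by
  let S : A →ₗ[ℂ] A := HopfAlgebra.antipode ℂ
  let G : A →ₗ[ℂ] A ⊗[ℂ] A :=
    TensorProduct.map S S ∘ₗ (TensorProduct.comm ℂ A A).toLinearMap ∘ₗ comul
  have h1 : WithConv.toConv G * WithConv.toConv (comul (R := ℂ) (A := A)) = 1 := by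
    apply WithConv.ofConv_injective
    refine LinearMap.ext fun h => ?_
    have h2 := lift_map₂_comm_left (LinearMap.mul ℂ A ∘ₗ S) (LinearMap.mul ℂ A ∘ₗ S) h
    have h3 : ∀ h, (TensorProduct.lift (LinearMap.mul ℂ A ∘ₗ S) ∘ₗ comul) h
        = counit (R := ℂ) h • (1 : A) := diagL_antipode_mul
    rw [leftComm_inner_counit 1 _ h3] at h2
    have h4 : TensorProduct.lift (LinearMap.mul ℂ A ∘ₗ S) (comul h) = counit (R := ℂ) h • (1 : A) :=
      diagL_antipode_mul h
    rw [h4] at h2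
    have h5 : (WithConv.toConv G * WithConv.toConv (comul (R := ℂ) (A := A))).ofConv h
        = TensorProduct.lift ((map₂ (LinearMap.mul ℂ A ∘ₗ S) (LinearMap.mul ℂ A ∘ₗ S)).compl₁₂
        ((TensorProduct.comm ℂ A A).toLinearMap ∘ₗ comul) comul) (comul h) := by
      change LinearMap.mul' ℂ (A ⊗[ℂ] A) (TensorProduct.map G comul (comul h)) = _
      generalize comul (R := ℂ) h = x
      induction x with
      | zero => simp
      | add x y hx hy => simp only [map_add, hx, hy]
      | tmul a b =>
      simp only [TensorProduct.map_tmul, LinearMap.mul'_apply, TensorProduct.lift.tmul,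
        LinearMap.compl₁₂_apply, LinearMap.comp_apply, G, LinearEquiv.coe_coe]
      generalize TensorProduct.comm ℂ A A (comul (R := ℂ) a) = x
      generalize comul (R := ℂ) b = y
      induction x with
      | zero => simp
      | add x x' hx hx' => simp only [map_add, LinearMap.add_apply, add_mul, hx, hx']
      | tmul a m =>
      induction y with
      | zero => simp
      | add x x' hx hx' => simp only [map_add, mul_add, hx, hx']
      | tmul b n => simp
    rw [h5, h2]
    simp [Algebra.algebraMap_eq_smul_one, Algebra.TensorProduct.one_def]
  have h2 := left_inv_eq_right_inv h1 LinearMap.comul_right_inv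
  intro a
  exact (congrArg (fun f : WithConv (A →ₗ[ℂ] A ⊗[ℂ] A) => f.ofConv a) h2).symm

variable [StarRing A] [StarModule ℂ A]

theorem antipodeInv_apply (a : A) :
    antipodeInv A a = star (HopfAlgebra.antipode ℂ (star a)) := rfl

variable [IsStarBialgebra A]

theorem counit_antipodeInv (a : A) : counit (R := ℂ) (antipodeInv A a) = counit (R := ℂ) a := by
  conv_rhs => rw [← antipode_antipodeInv a, HopfAlgebra.counit_antipode]

theorem star_antipode (a : A) :
    star (HopfAlgebra.antipode ℂ a) = antipodeInv A (star a) := by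
  rw [antipodeInv_apply, star_star]

theorem antipodeInv_isAntiCoalgMap : IsAntiCoalgMap (antipodeInv A) := by
  intro a
  rw [antipodeInv_apply, IsStarBialgebra.comul_star, antipode_isAntiCoalgMap,
    IsStarBialgebra.comul_star]
  generalize comul (R := ℂ) a = x
  induction x with
  | zero => simp
  | add x y hx hy => simp only [map_add, star_add, hx, hy]
  | tmul a b => simp [antipodeInv_apply]

theorem antipodeInv_mul (a b : A) :
    antipodeInv A (a * b) = antipodeInv A b * antipodeInv A a := by
  simp [antipodeInv_apply, HopfAlgebra.antipode_mul_antidistrib]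

theorem antipode_injective : Function.Injective (HopfAlgebra.antipode ℂ (A := A)) :=
  Function.LeftInverse.injective antipodeInv_antipode

theorem diagL_antipodeInv_mul (h : A) : diagL (antipodeInv A) (LinearMap.mul ℂ A).flip h
    = counit (R := ℂ) h • 1 := by
  apply antipode_injective
  rw [map_smul, HopfAlgebra.antipode_one, ← diagR_antipode_mul h]
  simp only [diagL, diagR, LinearMap.comp_apply]
  generalize comul (R := ℂ) h = x
  induction x with
  | zero => simp
  | add x y hx hy => simp only [map_add, hx, hy]
  | tmul a b => simp [HopfAlgebra.antipode_mul_antidistrib, antipode_antipodeInv]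

theorem diagR_antipodeInv_mul (h : A) : diagR (antipodeInv A) (LinearMap.mul ℂ A).flip h
    = counit (R := ℂ) h • 1 := by
  apply antipode_injective
  rw [map_smul, HopfAlgebra.antipode_one, ← diagL_antipode_mul h]
  simp only [diagL, diagR, LinearMap.comp_apply]
  generalize comul (R := ℂ) h = x
  induction x with
  | zero => simp
  | add x y hx hy => simp only [map_add, hx, hy]
  | tmul a b => simp [HopfAlgebra.antipode_mul_antidistrib, antipode_antipodeInv]

end

section
variable {A : Type*} [Ring A] [Bialgebra ℂ A] (γ : TwoCocycle A)

theorem TwoCocycle.conv₂_inv : conv₂ γ.toFun γ.inv = counit₂ A :=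
  LinearMap.ext₂ fun a b => γ.mul_inv a b

theorem TwoCocycle.inv_conv₂ : conv₂ γ.inv γ.toFun = counit₂ A :=
  LinearMap.ext₂ fun a b => γ.inv_mul a b

theorem TwoCocycle.lmul_one (b : A) : γ.lmul b 1 = b := by
  rw [TwoCocycle.lmul, LinearMap.compl₁₂_apply, Bialgebra.comul_one,
    Algebra.TensorProduct.one_def, γ.twist_one_right _ _ (fun m => by simp), lid_counit_comul]

theorem TwoCocycle.one_lmul (b : A) : γ.lmul 1 b = b := by
  rw [TwoCocycle.lmul, LinearMap.compl₁₂_apply, Bialgebra.comul_one,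
    Algebra.TensorProduct.one_def, γ.twist_one_left _ _ (fun m => by simp), lid_counit_comul]

/-- The cocycle is recovered from its one-sided twisted product by the counit. -/
theorem TwoCocycle.counit_lmul (a b : A) : counit (R := ℂ) (γ.lmul a b) = γ.toFun a b := by
  have h : (LinearMap.mul ℂ A).compr₂ (counit (R := ℂ)) = counit₂ A := by
    refine LinearMap.ext₂ fun a b => ?_
    simp [counit₂]
  rw [TwoCocycle.lmul, LinearMap.compl₁₂_apply, contractL_compr₂, h]
  exact LinearMap.congr_fun₂ (conv₂_counit₂ γ.toFun) a b

/-- `γ̄ * (·_γ) = (·) * γ̄` -/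
theorem TwoCocycle.conv₂_inv_mulA : conv₂ γ.inv γ.mulA
    = (contractR (LinearMap.mul ℂ A) γ.inv).compl₁₂ comul comul := by
  have h1 : γ.mulA = conv₂ γ.toFun ((contractR (LinearMap.mul ℂ A) γ.inv).compl₁₂ comul comul) :=
    contractR_conv₂ _ _ _
  rw [h1, ← conv₂_assoc, γ.inv_conv₂, counit₂_conv₂]

/-- `(·_γ) * γ = γ * (·)` -/
theorem TwoCocycle.contractR_mulA_eq : (contractR γ.mulA γ.toFun).compl₁₂ comul comul
    = conv₂ γ.toFun (LinearMap.mul ℂ A) :=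
  LinearMap.ext₂ fun a b => γ.contractR_mulA a b

end

section
variable {A : Type*} [Ring A] [HopfAlgebra ℂ A] (γ : TwoCocycle A)

theorem TwoCocycle.U_eq_diagR : γ.U = diagR (HopfAlgebra.antipode ℂ) γ.toFun := by
  ext h
  simp only [TwoCocycle.U, diagR, LinearMap.comp_apply]
  generalize comul (R := ℂ) h = x
  induction x with
  | zero => simp
  | add x y hx hy => simp only [map_add, hx, hy]
  | tmul a b => simp

theorem TwoCocycle.Ubar_eq_diagL : γ.Ubar = diagL (HopfAlgebra.antipode ℂ) γ.inv := by
  ext h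
  simp only [TwoCocycle.Ubar, diagL, LinearMap.comp_apply]
  generalize comul (R := ℂ) h = x
  induction x with
  | zero => simp
  | add x y hx hy => simp only [map_add, hx, hy]
  | tmul a b => simp

/-- `Ū * U = ε` -/
theorem TwoCocycle.Ubar_ract_U (h : A) : γ.Ubar (ract γ.U h) = counit (R := ℂ) h := by
  rw [γ.U_eq_diagR, γ.Ubar_eq_diagL]
  exact antipode_isAntiCoalgMap.diagR_conv_diagL HopfAlgebra.counit_antipode (LinearMap.mul ℂ A) 1
    γ.toFun γ.inv γ.inv_conv₂ γ.lmul_assoc γ.one_lmul γ.lmul_one diagL_antipode_mul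
    diagR_antipode_mul h

variable [StarRing A] [StarModule ℂ A]

theorem TwoCocycle.V_eq_diagR : γ.V = diagR (antipodeInv A) γ.toFun.flip := by
  ext h
  simp only [TwoCocycle.V, diagR, LinearMap.comp_apply, LinearEquiv.coe_coe]
  generalize comul (R := ℂ) h = x
  induction x with
  | zero => simp
  | add x y hx hy => simp only [map_add, hx, hy]
  | tmul a b => simp

theorem TwoCocycle.Vbar_eq_diagL : γ.Vbar = diagL (antipodeInv A) γ.inv.flip := by
  ext h
  simp only [TwoCocycle.Vbar, diagL, LinearMap.comp_apply, LinearEquiv.coe_coe]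
  generalize comul (R := ℂ) h = x
  induction x with
  | zero => simp
  | add x y hx hy => simp only [map_add, hx, hy]
  | tmul a b => simp

theorem contractL_flip {M N P : Type*} [AddCommGroup M] [Module ℂ M] [AddCommGroup N] [Module ℂ N]
    [AddCommGroup P] [Module ℂ P] (f : A →ₗ[ℂ] A →ₗ[ℂ] ℂ) (p : M →ₗ[ℂ] N →ₗ[ℂ] P)
    (x : A ⊗[ℂ] M) (y : A ⊗[ℂ] N) : contractL f.flip p.flip y x = contractL f p x y := by
  induction x with
  | zero => simp
  | add x x' hx hx' => simp only [map_add, LinearMap.add_apply, hx, hx']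
  | tmul a m =>
  induction y with
  | zero => simp
  | add x x' hx hx' => simp only [map_add, LinearMap.add_apply, hx, hx']
  | tmul b n => simp

theorem conv₂_flip {P : Type*} [AddCommGroup P] [Module ℂ P] (f : A →ₗ[ℂ] A →ₗ[ℂ] ℂ)
    (p : A →ₗ[ℂ] A →ₗ[ℂ] P) : conv₂ f.flip p.flip = (conv₂ f p).flip :=
  LinearMap.ext₂ fun _ _ => contractL_flip f p _ _

theorem counit₂_flip : (counit₂ A).flip = counit₂ A :=
  LinearMap.ext₂ fun _ _ => by simp [counit₂, mul_comm]

variable [IsStarBialgebra A]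

/-- `V̄ * V = ε`: this is the identity `Ū * U = ε` for the opposite product, whose antipode
is `S⁻¹`. -/
theorem TwoCocycle.Vbar_ract_V (h : A) : γ.Vbar (ract γ.V h) = counit (R := ℂ) h := by
  rw [γ.V_eq_diagR, γ.Vbar_eq_diagL]
  have hm : conv₂ γ.toFun.flip (LinearMap.mul ℂ A).flip = γ.lmul.flip := conv₂_flip _ _
  refine antipodeInv_isAntiCoalgMap.diagR_conv_diagL counit_antipodeInv (LinearMap.mul ℂ A).flip 1
    γ.toFun.flip γ.inv.flip ?_ ?_ ?_ ?_ diagL_antipodeInv_mul diagR_antipodeInv_mul h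
  · rw [conv₂_flip, γ.inv_conv₂, counit₂_flip]
  · intro a b c
    simp only [hm, LinearMap.flip_apply, γ.lmul_assoc]
  · intro a
    simp only [hm, LinearMap.flip_apply, γ.lmul_one]
  · intro a
    simp only [hm, LinearMap.flip_apply, γ.one_lmul]

theorem IsAntiCoalgMap.lact_comp {S : A →ₗ[ℂ] A} (hS : IsAntiCoalgMap S) (u : A →ₗ[ℂ] ℂ) (a : A) :
    lact u (S a) = S (ract (u ∘ₗ S) a) := by
  simp only [coactBy, ract, LinearMap.comp_apply, LinearEquiv.coe_coe, hS a]
  generalize comul (R := ℂ) a = x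
  induction x with
  | zero => simp
  | add x y hx hy => simp only [map_add, hx, hy]
  | tmul a b => simp

theorem IsAntiCoalgMap.ract_comp {S : A →ₗ[ℂ] A} (hS : IsAntiCoalgMap S) (u : A →ₗ[ℂ] ℂ) (a : A) :
    ract u (S a) = S (lact (u ∘ₗ S) a) := by
  simp only [coactBy, ract, LinearMap.comp_apply, LinearEquiv.coe_coe, hS a]
  generalize comul (R := ℂ) a = x
  induction x with
  | zero => simp
  | add x y hx hy => simp only [map_add, hx, hy]
  | tmul a b => simp

theorem TwoCocycle.V_eq_U_comp : γ.V = γ.U ∘ₗ antipodeInv A := by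
  ext h
  simp only [TwoCocycle.U, TwoCocycle.V, LinearMap.comp_apply, LinearEquiv.coe_coe,
    antipodeInv_isAntiCoalgMap h]
  generalize comul (R := ℂ) h = x
  induction x with
  | zero => simp
  | add x y hx hy => simp only [map_add, hx, hy]
  | tmul a b => simp [antipode_antipodeInv]

theorem TwoCocycle.Vbar_eq_Ubar_comp : γ.Vbar = γ.Ubar ∘ₗ antipodeInv A := by
  ext h
  simp only [TwoCocycle.Ubar, TwoCocycle.Vbar, LinearMap.comp_apply, LinearEquiv.coe_coe,
    antipodeInv_isAntiCoalgMap h]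
  generalize comul (R := ℂ) h = x
  induction x with
  | zero => simp
  | add x y hx hy => simp only [map_add, hx, hy]
  | tmul a b => simp [antipode_antipodeInv]

/-- `V * V̄ = ε`: composing with the anti-coalgebra map `S⁻¹` turns `Ū * U = ε` into this. -/
theorem TwoCocycle.V_ract_Vbar (h : A) : γ.V (ract γ.Vbar h) = counit (R := ℂ) h := by
  rw [γ.V_eq_U_comp, γ.Vbar_eq_Ubar_comp, LinearMap.comp_apply,
    ← antipodeInv_isAntiCoalgMap.lact_comp, ← apply_ract_eq_apply_lact, γ.Ubar_ract_U,
    counit_antipodeInv]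

/-- `U * Ū = ε`: composing `V̄ * V = ε` with `S` gives this. -/
theorem TwoCocycle.U_ract_Ubar (h : A) : γ.U (ract γ.Ubar h) = counit (R := ℂ) h := by
  have h1 := γ.Vbar_ract_V (HopfAlgebra.antipode ℂ h)
  rwa [γ.V_eq_U_comp, γ.Vbar_eq_Ubar_comp, LinearMap.comp_apply,
    ← antipodeInv_isAntiCoalgMap.lact_comp, ← apply_ract_eq_apply_lact,
    antipodeInv_antipode, HopfAlgebra.counit_antipode] at h1

theorem TwoCocycle.Vbar_comp_lact_V : γ.Vbar ∘ₗ lact γ.V = counit := by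
  ext h; rw [LinearMap.comp_apply, ← apply_ract_eq_apply_lact, γ.V_ract_Vbar]

theorem TwoCocycle.V_comp_lact_Vbar : γ.V ∘ₗ lact γ.Vbar = counit := by
  ext h; rw [LinearMap.comp_apply, ← apply_ract_eq_apply_lact, γ.Vbar_ract_V]

theorem TwoCocycle.coactBy_Vbar_V {M : Type*} [AddCommGroup M] [Module ℂ M]
    {δ : M →ₗ[ℂ] A ⊗[ℂ] M} (hδ : IsCoaction δ) (m : M) :
    coactBy δ γ.Vbar (coactBy δ γ.V m) = m := by
  rw [hδ.coactBy_coactBy, γ.Vbar_comp_lact_V, hδ.coactBy_counit, LinearMap.id_apply]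

theorem TwoCocycle.coactBy_V_Vbar {M : Type*} [AddCommGroup M] [Module ℂ M]
    {δ : M →ₗ[ℂ] A ⊗[ℂ] M} (hδ : IsCoaction δ) (m : M) :
    coactBy δ γ.V (coactBy δ γ.Vbar m) = m := by
  rw [hδ.coactBy_coactBy, γ.V_comp_lact_Vbar, hδ.coactBy_counit, LinearMap.id_apply]

end

/-! ### The antipode of the twisted Hopf algebra -/

section
variable {A : Type u} [Ring A] [HopfAlgebra ℂ A] (γ : TwoCocycle A)

/-- `f(h₁) g(h₃) T(h₂)`, in terms of the operators of `f` and `g`. -/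
theorem sandwich_comul₃ (f : A →ₗ[ℂ] ℂ) (T : A →ₗ[ℂ] A) (g : A →ₗ[ℂ] ℂ) (h : A) :
    sandwich f T g (comul₃ A h) = T (ract g (lact f h)) := by
  have h1 : T (ract g (lact f h)) = TensorProduct.rid ℂ A (TensorProduct.map T g
      (comul (lact f h))) := by
    simp only [ract, LinearMap.comp_apply, LinearEquiv.coe_coe]
    generalize comul (R := ℂ) (lact f h) = x
    induction x with
    | zero => simp
    | add x y hx hy => simp only [map_add, hx, hy]
    | tmul a b => simp
  rw [h1, comul_lact, ← comul_isCoaction.coact_coactBy]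
  simp only [coactBy, LinearMap.comp_apply, LinearEquiv.coe_coe]
  rw [lid_rTensor_lTensor]
  simp only [sandwich, comul₃, LinearMap.comp_apply, LinearEquiv.coe_coe]
  generalize (comul (R := ℂ)).lTensor A (comul (R := ℂ) h) = x
  induction x with
  | zero => simp
  | add x y hx hy => simp only [map_add, hx, hy]
  | tmul a x => simp

/-- `S_γ` as a linear map on the space underlying `A` and `A_γ`. -/
theorem TwoCocycle.antipodeTwist_toAlg (h : A) : γ.antipodeTwist (γ.toAlg h)
    = γ.toAlg (HopfAlgebra.antipode ℂ (ract γ.Ubar (lact γ.U h))) := by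
  rw [← sandwich_comul₃]
  rfl

variable [StarRing A] [StarModule ℂ A] [IsStarBialgebra A]

/-- `S_γ(h₁) ·_γ h₂ = ε(h) 1`: the factor `Ū` of `S_γ` turns `·_γ` into `γ̄ * (·_γ) = (·) * γ̄`, and
the remaining `γ̄` contracts to `Ū`, which cancels the factor `U`. -/
theorem TwoCocycle.diagL_antipodeTwist (h : A) :
    diagL (HopfAlgebra.antipode ℂ ∘ₗ ract γ.Ubar ∘ₗ lact γ.U) γ.mulA h
      = counit (R := ℂ) h • 1 := by
  have h1 : diagL (HopfAlgebra.antipode ℂ ∘ₗ ract γ.Ubar ∘ₗ lact γ.U) γ.mulA h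
      = diagL (HopfAlgebra.antipode ℂ ∘ₗ ract γ.Ubar) γ.mulA (lact γ.U h) := by
    simp only [diagL, LinearMap.comp_apply, comul_lact]
    generalize comul (R := ℂ) h = x
    induction x with
    | zero => simp
    | add x y hx hy => simp only [map_add, hx, hy]
    | tmul a b => simp
  rw [h1, γ.Ubar_eq_diagL, ← antipode_isAntiCoalgMap.diagL_conv₂, γ.conv₂_inv_mulA,
    antipode_isAntiCoalgMap.diagL_contractR _ _ 1 diagL_antipode_mul, ← γ.Ubar_eq_diagL,
    ← apply_ract_eq_apply_lact, γ.U_ract_Ubar]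

/-- `h₁ ·_γ S_γ(h₂) = ε(h) 1`: the factor `U` of `S_γ` turns `·_γ` into `(·_γ) * γ = γ * (·)`, and
the remaining `γ` contracts to `U`, which cancels the factor `Ū`. -/
theorem TwoCocycle.diagR_antipodeTwist (h : A) :
    diagR (HopfAlgebra.antipode ℂ ∘ₗ ract γ.Ubar ∘ₗ lact γ.U) γ.mulA h
      = counit (R := ℂ) h • 1 := by
  have h1 : diagR (HopfAlgebra.antipode ℂ ∘ₗ ract γ.Ubar ∘ₗ lact γ.U) γ.mulA h
      = diagR (HopfAlgebra.antipode ℂ ∘ₗ lact γ.U) γ.mulA (ract γ.Ubar h) := by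
    simp only [diagR, LinearMap.comp_apply, comul_ract]
    generalize comul (R := ℂ) h = x
    induction x with
    | zero => simp
    | add x y hx hy => simp only [map_add, hx, hy]
    | tmul a b => simp [ract_lact]
  rw [h1, γ.U_eq_diagR, ← antipode_isAntiCoalgMap.diagR_contractR, γ.contractR_mulA_eq,
    antipode_isAntiCoalgMap.diagR_conv₂ _ _ 1 diagR_antipode_mul, ← γ.U_eq_diagR,
    γ.U_ract_Ubar]

theorem TwoCocycle.antipodeTwist_isAntipode : IsAntipode γ.antipodeTwist := by
  constructor
  · intro h
    obtain ⟨h, rfl⟩ := γ.toAlg.surjective h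
    have h1 := congrArg γ.toAlg (γ.diagL_antipodeTwist h)
    rw [map_smul, γ.toAlg_one, ← Algebra.algebraMap_eq_smul_one] at h1
    refine Eq.trans ?_ (h1.trans (congrArg _ (γ.counit_toAlg h).symm))
    refine (congrArg _ (congrArg _ (γ.comul_toAlg h))).trans ?_
    simp only [diagL, LinearMap.comp_apply]
    generalize comul (R := ℂ) h = x
    induction x with
    | zero => simp only [map_zero]
    | add x y hx hy => simp only [map_add, hx, hy]
    | tmul a b =>
      simp only [TensorProduct.map_tmul, LinearMap.rTensor_tmul, LinearEquiv.coe_coe,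
        γ.antipodeTwist_toAlg, LinearMap.mul'_apply, TensorProduct.lift.tmul,
        LinearMap.comp_apply, γ.toAlg_mulA]
  · intro h
    obtain ⟨h, rfl⟩ := γ.toAlg.surjective h
    have h1 := congrArg γ.toAlg (γ.diagR_antipodeTwist h)
    rw [map_smul, γ.toAlg_one, ← Algebra.algebraMap_eq_smul_one] at h1
    refine Eq.trans ?_ (h1.trans (congrArg _ (γ.counit_toAlg h).symm))
    refine (congrArg _ (congrArg _ (γ.comul_toAlg h))).trans ?_
    simp only [diagR, LinearMap.comp_apply]
    generalize comul (R := ℂ) h = x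
    induction x with
    | zero => simp only [map_zero]
    | add x y hx hy => simp only [map_add, hx, hy]
    | tmul a b =>
      simp only [TensorProduct.map_tmul, LinearMap.lTensor_tmul, LinearEquiv.coe_coe,
        γ.antipodeTwist_toAlg, LinearMap.mul'_apply, TensorProduct.lift.tmul,
        LinearMap.comp_apply, γ.toAlg_mulA, LinearMap.compl₂_apply]

end
end antipode

/-! ### The behaviour of `V` on products -/

section productFormula
open Coalgebra

section
variable {A : Type*} [Ring A] [Bialgebra ℂ A]

/-- A bialgebra is a comodule algebra over itself. -/
noncomputable abbrev regularComoduleAlgebra (A : Type*) [Ring A] [Bialgebra ℂ A] :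
    ComoduleAlgebra A A where
  coact := Bialgebra.comulAlgHom ℂ A
  isCoaction := comul_isCoaction

/-- `a ⊗ b ↦ ε(b) a` -/
noncomputable def projFst (A : Type*) [Ring A] [Bialgebra ℂ A] : A ⊗[ℂ] A →ₗc[ℂ] A :=
  (Coalgebra.TensorProduct.rid ℂ ℂ A).toCoalgHom.comp
    (Coalgebra.TensorProduct.map (CoalgHom.id ℂ A) (counitCoalgHom ℂ A))

/-- `a ⊗ b ↦ ε(a) b` -/
noncomputable def projSnd (A : Type*) [Ring A] [Bialgebra ℂ A] : A ⊗[ℂ] A →ₗc[ℂ] A :=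
  (Coalgebra.TensorProduct.lid ℂ A).toCoalgHom.comp
    (Coalgebra.TensorProduct.map (counitCoalgHom ℂ A) (CoalgHom.id ℂ A))

theorem projFst_tmul (a b : A) : projFst A (a ⊗ₜ b) = counit (R := ℂ) b • a := rfl
theorem projSnd_tmul (a b : A) : projSnd A (a ⊗ₜ b) = counit (R := ℂ) a • b := rfl

variable {R : Type*} [Ring R] [Algebra ℂ R]

/-- Pull-back of a map `A → R` along a coalgebra map `A ⊗ A → A`; it respects convolution. -/
noncomputable def pullback (p : A ⊗[ℂ] A →ₗc[ℂ] A) (f : WithConv (A →ₗ[ℂ] R)) :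
    WithConv (A ⊗[ℂ] A →ₗ[ℂ] R) := WithConv.toConv (f.ofConv ∘ₗ p.toLinearMap)

theorem pullback_mul_eq_one (p : A ⊗[ℂ] A →ₗc[ℂ] A) {f g : WithConv (A →ₗ[ℂ] R)}
    (h : f * g = 1) : pullback p f * pullback p g = 1 := by
  have h1 := LinearMap.convMul_comp_coalgHom_distrib f g p
  rw [h] at h1
  apply WithConv.ofConv_injective
  refine h1.symm.trans ?_
  ext x
  simp

/-- A bilinear functional as an element of the convolution algebra of maps `A ⊗ A → R`. -/
noncomputable def scalarConv (R : Type*) [Ring R] [Algebra ℂ R] (f : A →ₗ[ℂ] A →ₗ[ℂ] ℂ) :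
    WithConv (A ⊗[ℂ] A →ₗ[ℂ] R) :=
  WithConv.toConv (Algebra.linearMap ℂ R ∘ₗ TensorProduct.lift f)

theorem conv_tmul (f g : WithConv (A ⊗[ℂ] A →ₗ[ℂ] R)) (a b : A) : (f * g).ofConv (a ⊗ₜ b)
    = LinearMap.mul' ℂ R (TensorProduct.map f.ofConv g.ofConv
      (TensorProduct.tensorTensorTensorComm ℂ _ _ _ _ (comul a ⊗ₜ comul b))) := rfl

theorem scalarConv_mul (f : A →ₗ[ℂ] A →ₗ[ℂ] ℂ) (g : WithConv (A ⊗[ℂ] A →ₗ[ℂ] R)) (a b : A) :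
    (scalarConv R f * g).ofConv (a ⊗ₜ b)
      = contractL f ((TensorProduct.mk ℂ A A).compr₂ g.ofConv) (comul a) (comul b) := by
  rw [conv_tmul]
  generalize comul (R := ℂ) a = x
  generalize comul (R := ℂ) b = y
  induction x with
  | zero => simp
  | add x x' hx hx' => simp only [map_add, LinearMap.add_apply, add_tmul, hx, hx']
  | tmul a a' =>
  induction y with
  | zero => simp
  | add x x' hx hx' => simp only [map_add, tmul_add, hx, hx']
  | tmul b b' => simp [scalarConv, Algebra.smul_def]

theorem mul_scalarConv (f : A →ₗ[ℂ] A →ₗ[ℂ] ℂ) (g : WithConv (A ⊗[ℂ] A →ₗ[ℂ] R)) (a b : A) :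
    (g * scalarConv R f).ofConv (a ⊗ₜ b)
      = contractR ((TensorProduct.mk ℂ A A).compr₂ g.ofConv) f (comul a) (comul b) := by
  rw [conv_tmul]
  generalize comul (R := ℂ) a = x
  generalize comul (R := ℂ) b = y
  induction x with
  | zero => simp
  | add x x' hx hx' => simp only [map_add, LinearMap.add_apply, add_tmul, hx, hx']
  | tmul a a' =>
  induction y with
  | zero => simp
  | add x x' hx hx' => simp only [map_add, tmul_add, hx, hx']
  | tmul b b' => simp [scalarConv, Algebra.smul_def, Algebra.commutes]

theorem scalarConv_mul_scalarConv {f g : A →ₗ[ℂ] A →ₗ[ℂ] ℂ} (h : conv₂ f g = counit₂ A) :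
    scalarConv R f * scalarConv R g = 1 := by
  apply WithConv.ofConv_injective
  refine TensorProduct.ext' fun a b => ?_
  rw [scalarConv_mul]
  have h1 := contractL_compr₂ f g (Algebra.linearMap ℂ R) (comul (R := ℂ) a) (comul (R := ℂ) b)
  refine h1.symm.trans ((congrArg _ (LinearMap.congr_fun₂ h a b)).trans ?_)
  simp [counit₂, mul_comm]

theorem pullback_fst_mul_snd (f g : WithConv (A →ₗ[ℂ] R)) (a b : A) :
    (pullback (projFst A) f * pullback (projSnd A) g).ofConv (a ⊗ₜ b)
      = f.ofConv a * g.ofConv b := by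
  rw [conv_tmul]
  conv_rhs => rw [← rid_counit_comul a, ← lid_counit_comul b]
  generalize comul (R := ℂ) a = x
  generalize comul (R := ℂ) b = y
  induction x with
  | zero => simp
  | add x x' hx hx' => simp only [map_add, add_mul, add_tmul, hx, hx']
  | tmul a a' =>
  induction y with
  | zero => simp
  | add x x' hx hx' => simp only [map_add, mul_add, tmul_add, hx, hx']
  | tmul b b' => simp [pullback, projFst_tmul, projSnd_tmul, smul_smul, mul_comm]

theorem pullback_snd_mul_fst (f g : WithConv (A →ₗ[ℂ] R)) (a b : A) :
    (pullback (projSnd A) f * pullback (projFst A) g).ofConv (a ⊗ₜ b)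
      = f.ofConv b * g.ofConv a := by
  rw [conv_tmul]
  conv_rhs => rw [← lid_counit_comul a, ← rid_counit_comul b]
  generalize comul (R := ℂ) a = x
  generalize comul (R := ℂ) b = y
  induction x with
  | zero => simp
  | add x x' hx hx' => simp only [map_add, mul_add, add_tmul, hx, hx']
  | tmul a a' =>
  induction y with
  | zero => simp
  | add x x' hx hx' => simp only [map_add, add_mul, tmul_add, hx, hx']
  | tmul b b' => simp [pullback, projFst_tmul, projSnd_tmul, smul_smul, mul_comm]

/-- If `j : A → R` is multiplicative up to the functional `f`, then its convolution inverse `ρ` is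
antimultiplicative up to the convolution inverse `g` of `f`: the two sides are a left and a right
convolution inverse of `(a, b) ↦ j(a) j(b)`. -/
theorem convInverse_antimul (j ρ : WithConv (A →ₗ[ℂ] R)) (h1 : ρ * j = 1) (h2 : j * ρ = 1)
    {f g : A →ₗ[ℂ] A →ₗ[ℂ] ℂ} (hfg : conv₂ f g = counit₂ A)
    (hj : ∀ a b, j.ofConv a * j.ofConv b
      = contractL f ((LinearMap.mul ℂ A).compr₂ j.ofConv) (comul a) (comul b)) (a b : A) :
    ρ.ofConv b * ρ.ofConv a
      = contractR ((LinearMap.mul ℂ A).compr₂ ρ.ofConv) g (comul a) (comul b) := by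
  let μ : A ⊗[ℂ] A →ₗc[ℂ] A := Bialgebra.mulCoalgHom ℂ A
  have e1 : pullback (projFst A) j * pullback (projSnd A) j = scalarConv R f * pullback μ j := by
    apply WithConv.ofConv_injective
    refine TensorProduct.ext' fun a b => ?_
    rw [pullback_fst_mul_snd, hj, scalarConv_mul]
    rfl
  have e2 : pullback (projSnd A) ρ * pullback (projFst A) ρ = pullback μ ρ * scalarConv R g := by
    refine left_inv_eq_right_inv (a := pullback (projFst A) j * pullback (projSnd A) j) ?_ ?_
    · rw [mul_assoc, ← mul_assoc (pullback (projFst A) ρ), pullback_mul_eq_one _ h1, one_mul,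
        pullback_mul_eq_one _ h1]
    · rw [e1, mul_assoc, ← mul_assoc (pullback μ j), pullback_mul_eq_one _ h2, one_mul,
        scalarConv_mul_scalarConv hfg]
  rw [← pullback_snd_mul_fst, e2, mul_scalarConv]
  rfl
end

section
variable {A : Type u} [Ring A] [HopfAlgebra ℂ A] [StarRing A] [StarModule ℂ A]
  [IsStarBialgebra A] (γ : TwoCocycle A)

/-- `γ(S(b₁) ⊗ S(a₁)) Ū(b₂) Ū(a₂) = Ū(a₁b₁) γ̄(a₂ ⊗ b₂)`

Let `R` be `A` with the one-sided twisted product `γ(a₁ ⊗ b₁) a₂b₂`. The identity map `j : A → R` is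
multiplicative up to `γ`, and its convolution inverse is `ρ₀(h) = S(h₁) Ū(h₂)`. The claim is the
antimultiplicativity of `ρ₀` up to `γ̄`, after applying the counit. -/
theorem TwoCocycle.toFun_antipode (a b : A) :
    γ.toFun (HopfAlgebra.antipode ℂ (ract γ.Ubar b)) (HopfAlgebra.antipode ℂ (ract γ.Ubar a))
      = contractR ((LinearMap.mul ℂ A).compr₂ γ.Ubar) γ.inv (comul a) (comul b) := by
  -- `R` is `B_γ` for the regular comodule algebra `B = A`
  let _ := regularComoduleAlgebra A
  let ρ₀ : A →ₗ[ℂ] A := HopfAlgebra.antipode ℂ ∘ₗ ract γ.Ubar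
  let j : A →ₗ[ℂ] γ.ComodAlg A := (γ.toComodAlg A).toLinearMap
  have hmul : ∀ a b : A, j a * j b = j (γ.lmul a b) := fun a b => rfl
  have hone : j 1 = 1 := rfl
  have hL : ∀ h, diagL ρ₀ γ.lmul h = counit (R := ℂ) h • 1 := by
    intro h
    have h1 : γ.lmul = conv₂ γ.toFun (LinearMap.mul ℂ A) := rfl
    have h2 : ρ₀ = HopfAlgebra.antipode ℂ ∘ₗ ract γ.Ubar := rfl
    rw [h2, γ.Ubar_eq_diagL, ← antipode_isAntiCoalgMap.diagL_conv₂, h1, ← conv₂_assoc,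
      γ.inv_conv₂, counit₂_conv₂, diagL_antipode_mul]
  have hR : ∀ h, diagR ρ₀ γ.lmul h = counit (R := ℂ) h • 1 := by
    intro h
    have h1 : γ.lmul = conv₂ γ.toFun (LinearMap.mul ℂ A) := rfl
    have h2 : diagR ρ₀ γ.lmul h = diagR (HopfAlgebra.antipode ℂ) γ.lmul (ract γ.Ubar h) := by
      simp only [diagR, LinearMap.comp_apply, comul_ract]
      generalize comul (R := ℂ) h = x
      induction x with
      | zero => simp
      | add x y hx hy => simp only [map_add, hx, hy]
      | tmul a b => simp [ρ₀]
    rw [h2, h1, antipode_isAntiCoalgMap.diagR_conv₂ _ _ 1 diagR_antipode_mul, ← γ.U_eq_diagR,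
      γ.U_ract_Ubar]
  -- the remaining goals: `ρ₀ * j = 1`, `j * ρ₀ = 1`, and multiplicativity of `j` up to `γ`
  have key := convInverse_antimul (WithConv.toConv j) (WithConv.toConv (j ∘ₗ ρ₀)) ?_ ?_
    γ.conv₂_inv ?_ a b
  · have h3 := congrArg (fun x => counit (R := ℂ) ((γ.toComodAlg A).symm x)) key
    have h4 : contractR ((LinearMap.mul ℂ A).compr₂ (j ∘ₗ ρ₀)) γ.inv (comul a) (comul b)
        = j (ρ₀ (contractR (LinearMap.mul ℂ A) γ.inv (comul a) (comul b))) :=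
      (contractR_compr₂ _ _ (j ∘ₗ ρ₀) _ _).symm
    refine (γ.counit_lmul _ _).symm.trans (h3.trans ?_)
    refine (congrArg (fun x => counit (R := ℂ) ((γ.toComodAlg A).symm x)) h4).trans ?_
    refine (HopfAlgebra.counit_antipode _).trans ?_
    rw [counit_ract, contractR_compr₂]
  · apply WithConv.ofConv_injective
    refine LinearMap.ext fun h => ?_
    refine Eq.trans ?_ ((congrArg j (hL h)).trans ?_)
    · change LinearMap.mul' ℂ _ (TensorProduct.map (j ∘ₗ ρ₀) j (comul h)) = _
      simp only [diagL, LinearMap.comp_apply]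
      generalize comul (R := ℂ) h = x
      induction x with
      | zero => simp
      | add x y hx hy => simp only [map_add, hx, hy]
      | tmul a b => simp [hmul]
    · rw [map_smul, hone, ← Algebra.algebraMap_eq_smul_one]
      rfl
  · apply WithConv.ofConv_injective
    refine LinearMap.ext fun h => ?_
    refine Eq.trans ?_ ((congrArg j (hR h)).trans ?_)
    · change LinearMap.mul' ℂ _ (TensorProduct.map j (j ∘ₗ ρ₀) (comul h)) = _
      simp only [diagR, LinearMap.comp_apply]
      generalize comul (R := ℂ) h = x
      induction x with
      | zero => simp
      | add x y hx hy => simp only [map_add, hx, hy]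
      | tmul a b => simp [hmul]
    · rw [map_smul, hone, ← Algebra.algebraMap_eq_smul_one]
      rfl
  · intro a b
    exact contractL_compr₂ γ.toFun (LinearMap.mul ℂ A) j _ _

/-- `(a, b) ↦ γ̄(S⁻¹(b) ⊗ S⁻¹(a))`; if `γ` is unitary, this is the complex conjugate of
`γ(b^* ⊗ a^*)`. -/
noncomputable def TwoCocycle.dual : A →ₗ[ℂ] A →ₗ[ℂ] ℂ :=
  (γ.inv.compl₁₂ (antipodeInv A) (antipodeInv A)).flip

/-- `(a, b) ↦ γ(S⁻¹(b) ⊗ S⁻¹(a))`, the convolution inverse of `dual`. -/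
noncomputable def TwoCocycle.dualInv : A →ₗ[ℂ] A →ₗ[ℂ] ℂ :=
  (γ.toFun.compl₁₂ (antipodeInv A) (antipodeInv A)).flip

/-- Composing with an anti-coalgebra map and swapping the arguments reverses convolution. -/
theorem conv₂_flip_comp {S : A →ₗ[ℂ] A} (hS : IsAntiCoalgMap S) (f g : A →ₗ[ℂ] A →ₗ[ℂ] ℂ) :
    conv₂ (f.compl₁₂ S S).flip (g.compl₁₂ S S).flip = ((conv₂ g f).compl₁₂ S S).flip := by
  refine LinearMap.ext₂ fun a b => ?_
  rw [conv₂_flip]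
  simp only [conv₂, LinearMap.flip_apply, LinearMap.compl₁₂_apply, hS a, hS b]
  rw [contractL_map, contractL_comm, contractL_eq_contractR]

theorem counit₂_flip_comp : ((counit₂ A).compl₁₂ (antipodeInv A) (antipodeInv A)).flip
    = counit₂ A := by
  refine LinearMap.ext₂ fun a b => ?_
  simp [counit₂, counit_antipodeInv, mul_comm]

theorem TwoCocycle.dualInv_conv₂_dual : conv₂ γ.dualInv γ.dual = counit₂ A := by
  rw [dual, dualInv, conv₂_flip_comp antipodeInv_isAntiCoalgMap, γ.inv_conv₂, counit₂_flip_comp]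

/-- `V̄(a₁) V̄(b₁) γ(a₂ ⊗ b₂) = γ̄(S⁻¹(b₁) ⊗ S⁻¹(a₁)) V̄(a₂b₂)` -/
theorem TwoCocycle.toFun_lact_Vbar : γ.toFun.compl₁₂ (lact γ.Vbar) (lact γ.Vbar)
    = conv₂ γ.dual ((LinearMap.mul ℂ A).compr₂ γ.Vbar) := by
  refine LinearMap.ext₂ fun a b => ?_
  have h := γ.toFun_antipode (antipodeInv A b) (antipodeInv A a)
  rw [antipodeInv_isAntiCoalgMap.ract_comp, antipodeInv_isAntiCoalgMap.ract_comp,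
    antipode_antipodeInv, antipode_antipodeInv, ← γ.Vbar_eq_Ubar_comp] at h
  refine h.trans ?_
  rw [antipodeInv_isAntiCoalgMap, antipodeInv_isAntiCoalgMap, contractR_map, γ.Vbar_eq_Ubar_comp]
  simp only [conv₂, LinearMap.compl₁₂_apply]
  generalize comul (R := ℂ) a = x
  generalize comul (R := ℂ) b = y
  induction x with
  | zero => simp
  | add x x' hx hx' => simp only [map_add, LinearMap.add_apply, hx, hx']
  | tmul a m =>
  induction y with
  | zero => simp
  | add x x' hx hx' => simp only [map_add, LinearMap.add_apply, hx, hx']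
  | tmul b n => simp [dual, antipodeInv_mul]

theorem TwoCocycle.lact_Vbar_V (a : A) : lact γ.Vbar (lact γ.V a) = a :=
  γ.coactBy_Vbar_V comul_isCoaction a

theorem conv₂_compl₁₂_lact {P : Type*} [AddCommGroup P] [Module ℂ P] (f : A →ₗ[ℂ] A →ₗ[ℂ] ℂ)
    (p : A →ₗ[ℂ] A →ₗ[ℂ] P) (u : A →ₗ[ℂ] ℂ) : (conv₂ f p).compl₁₂ (lact u) (lact u)
      = conv₂ (f.compl₁₂ (lact u) (lact u)) p :=
  LinearMap.ext₂ fun a b => contractL_lact comul_isCoaction comul_isCoaction u f p a b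

/-- Convolution of the functionals `u ∘ mul` and `v ∘ mul` is that of `u` and `v`, as `Δ` is
multiplicative. -/
theorem conv₂_compr₂_mul (u v : A →ₗ[ℂ] ℂ) :
    conv₂ ((LinearMap.mul ℂ A).compr₂ u) ((LinearMap.mul ℂ A).compr₂ v)
      = (LinearMap.mul ℂ A).compr₂ (v ∘ₗ lact u) := by
  refine LinearMap.ext₂ fun a b => ?_
  simp only [conv₂, LinearMap.compl₁₂_apply, LinearMap.compr₂_apply, coactBy, LinearMap.comp_apply,
    comul_mul']
  generalize comul (R := ℂ) a = x
  generalize comul (R := ℂ) b = y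
  induction x with
  | zero => simp
  | add x x' hx hx' => simp only [map_add, LinearMap.add_apply, hx, hx']
  | tmul a m =>
  induction y with
  | zero => simp
  | add x x' hx hx' => simp only [map_add, LinearMap.add_apply, hx, hx']
  | tmul b n => simp

theorem compr₂_mul_counit : (LinearMap.mul ℂ A).compr₂ (counit (R := ℂ)) = counit₂ A := by
  refine LinearMap.ext₂ fun a b => ?_
  simp [counit₂]

/-- `γ(a ⊗ b) = V(a₁) V(b₁) γ̄(S⁻¹(b₂) ⊗ S⁻¹(a₂)) V̄(a₃b₃)` -/
theorem TwoCocycle.toFun_eq_conv₂ : γ.toFun = conv₂ (γ.dual.compl₁₂ (lact γ.V) (lact γ.V))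
    ((LinearMap.mul ℂ A).compr₂ γ.Vbar) := by
  rw [← conv₂_compl₁₂_lact, ← γ.toFun_lact_Vbar]
  refine LinearMap.ext₂ fun a b => ?_
  simp only [LinearMap.compl₁₂_apply, γ.lact_Vbar_V]

/-- `γ(a₁ ⊗ b₁) V(a₂b₂) = V(a₁) V(b₁) γ̄(S⁻¹(b₂) ⊗ S⁻¹(a₂))` -/
theorem TwoCocycle.conv₂_mul_V : conv₂ γ.toFun ((LinearMap.mul ℂ A).compr₂ γ.V)
    = γ.dual.compl₁₂ (lact γ.V) (lact γ.V) := by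
  conv_lhs => rw [γ.toFun_eq_conv₂]
  rw [conv₂_assoc, conv₂_compr₂_mul, γ.V_comp_lact_Vbar, compr₂_mul_counit, conv₂_counit₂]

/-- `m₍₋₃₎ V̄(m₍₋₂₎) ⊗ V(m₍₋₁₎) m₍₀₎ = m₍₋₁₎ ⊗ m₍₀₎` -/
theorem TwoCocycle.map_ract_coactBy {M : Type*} [AddCommGroup M] [Module ℂ M]
    {δ : M →ₗ[ℂ] A ⊗[ℂ] M} (hδ : IsCoaction δ) (m : M) :
    TensorProduct.map (ract γ.Vbar) (coactBy δ γ.V) (δ m) = δ m := by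
  have h3 : ∀ x : A ⊗[ℂ] M, TensorProduct.map (ract γ.Vbar) (coactBy δ γ.V) x
      = (ract γ.Vbar).rTensor M ((coactBy δ γ.V).lTensor A x) := fun x => by
    rw [← LinearMap.comp_apply, LinearMap.rTensor_comp_lTensor]
  have h5 : γ.Vbar ∘ₗ ract γ.V = counit := LinearMap.ext γ.Vbar_ract_V
  have h4 : ract γ.Vbar ∘ₗ ract γ.V = LinearMap.id := LinearMap.ext fun a => by
    rw [LinearMap.comp_apply, ract_ract, h5, ract_counit, LinearMap.id_apply]
  rw [h3, hδ.lTensor_coactBy, ← LinearMap.comp_apply, ← LinearMap.rTensor_comp, h4,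
    LinearMap.rTensor_id, LinearMap.id_apply]

/-- `V̄(a₁b₁) γ̄(a₂ ⊗ b₂) = γ(S⁻¹(b₁) ⊗ S⁻¹(a₁)) V̄(a₂) V̄(b₂)` -/
theorem TwoCocycle.conv₂_mul_Vbar_inv : conv₂ ((LinearMap.mul ℂ A).compr₂ γ.Vbar) γ.inv
    = γ.dualInv.compl₁₂ (ract γ.Vbar) (ract γ.Vbar) := by
  -- both sides are convolution inverse to `V(a₁) V(b₁) γ̄(S⁻¹(b₂) ⊗ S⁻¹(a₂))`
  set X := conv₂ ((LinearMap.mul ℂ A).compr₂ γ.Vbar) γ.inv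
  have h1 : conv₂ (γ.dual.compl₁₂ (lact γ.V) (lact γ.V)) X = counit₂ A := by
    rw [← conv₂_assoc, ← γ.toFun_eq_conv₂, γ.conv₂_inv]
  have h2 : conv₂ (γ.dualInv.compl₁₂ (ract γ.Vbar) (ract γ.Vbar))
      (γ.dual.compl₁₂ (lact γ.V) (lact γ.V)) = counit₂ A := by
    refine LinearMap.ext₂ fun a b => ?_
    refine (contractL_map _ _ _ _ _ _ _ _).symm.trans ?_
    rw [γ.map_ract_coactBy comul_isCoaction, γ.map_ract_coactBy comul_isCoaction]
    exact LinearMap.congr_fun₂ γ.dualInv_conv₂_dual a b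
  rw [← counit₂_conv₂ X, ← h2, conv₂_assoc, h1, conv₂_counit₂]

/-- The operator of `V` turns the twist of a comodule pairing `p` by `γ` into its twist by the
conjugate cocycle. -/
theorem TwoCocycle.coactBy_V_contractL {M N P : Type*} [AddCommGroup M] [Module ℂ M]
    [AddCommGroup N] [Module ℂ N] [AddCommGroup P] [Module ℂ P]
    {δM : M →ₗ[ℂ] A ⊗[ℂ] M} {δN : N →ₗ[ℂ] A ⊗[ℂ] N} {δP : P →ₗ[ℂ] A ⊗[ℂ] P}
    (hM : IsCoaction δM) (hN : IsCoaction δN) (p : M →ₗ[ℂ] N →ₗ[ℂ] P)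
    (hp : ∀ m n, δP (p m n) = map₂ (LinearMap.mul ℂ A) p (δM m) (δN n)) (m : M) (n : N) :
    coactBy δP γ.V (contractL γ.toFun p (δM m) (δN n))
      = contractL γ.dual p (δM (coactBy δM γ.V m)) (δN (coactBy δN γ.V n)) := by
  rw [coactBy_contractL hM hN (LinearMap.mul ℂ A) γ.V γ.toFun p hp, γ.conv₂_mul_V,
    contractL_lact hM hN]

end
end productFormula

/-! ### The twisted involutions -/

section starStructures
open Coalgebra

section
variable {A : Type*} [AddCommGroup A] [Module ℂ A] [StarAddMonoid A] [StarModule ℂ A]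
variable {M M' N N' P P' : Type*} [AddCommGroup M] [Module ℂ M] [AddCommGroup N] [Module ℂ N]
  [AddCommGroup P] [Module ℂ P] [AddCommGroup M'] [Module ℂ M'] [AddCommGroup N'] [Module ℂ N']
  [AddCommGroup P'] [Module ℂ P']

/-- `a ⊗ m ↦ a^* ⊗ K(m)` for a conjugate-linear map `K`. -/
noncomputable def starMap (A : Type*) [AddCommGroup A] [Module ℂ A] [StarAddMonoid A]
    [StarModule ℂ A] (K : M →ₛₗ[starRingEnd ℂ] M') :
    A ⊗[ℂ] M →ₛₗ[starRingEnd ℂ] A ⊗[ℂ] M' :=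
  TensorProduct.map (starLinearEquiv ℂ (A := A)).toLinearMap K

@[simp] theorem starMap_tmul (K : M →ₛₗ[starRingEnd ℂ] M') (a : A) (m : M) :
    starMap A K (a ⊗ₜ m) = star a ⊗ₜ K m := rfl

/-- An antimultiplicative conjugation turns the twist by `f` into the twist by the complex conjugate
`f'` of `f`. -/
theorem conj_contractL {f f' : A →ₗ[ℂ] A →ₗ[ℂ] ℂ} (hf : ∀ a b, star (f a b) = f' (star b) (star a))
    {p : M →ₗ[ℂ] N →ₗ[ℂ] P} {p' : N' →ₗ[ℂ] M' →ₗ[ℂ] P'} (K : M →ₛₗ[starRingEnd ℂ] M')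
    (L : N →ₛₗ[starRingEnd ℂ] N') (J : P →ₛₗ[starRingEnd ℂ] P')
    (h : ∀ m n, J (p m n) = p' (L n) (K m)) (x : A ⊗[ℂ] M) (y : A ⊗[ℂ] N) :
    J (contractL f p x y) = contractL f' p' (starMap A L y) (starMap A K x) := by
  induction x with
  | zero => simp
  | add x x' hx hx' => simp only [map_add, LinearMap.add_apply, hx, hx']
  | tmul a m =>
  induction y with
  | zero => simp
  | add x x' hx hx' => simp only [map_add, LinearMap.add_apply, hx, hx']
  | tmul b n => simp [h, ← hf]

/-- The analogue of `conj_contractL` for the involution of `A` and twists on the right. -/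
theorem star_contractR {A : Type*} [Ring A] [Algebra ℂ A] [StarRing A] [StarModule ℂ A]
    {f f' : A →ₗ[ℂ] A →ₗ[ℂ] ℂ} (hf : ∀ a b, star (f a b) = f' (star b) (star a))
    {p p' : A →ₗ[ℂ] A →ₗ[ℂ] A} (hp : ∀ a b, star (p a b) = p' (star b) (star a))
    (x y : A ⊗[ℂ] A) : star (contractR p f x y) = contractR p' f' (star y) (star x) := by
  induction x with
  | zero => simp
  | add x x' hx hx' => simp only [map_add, star_add, LinearMap.add_apply, hx, hx']
  | tmul a m =>
  induction y with
  | zero => simp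
  | add x x' hx hx' => simp only [map_add, star_add, LinearMap.add_apply, hx, hx']
  | tmul b n => simp [hp, ← hf]

/-- A conjugate-linear comodule map turns the operator of `u` into that of the complex conjugate
`u'` of `u`. -/
theorem conj_coactBy [Coalgebra ℂ A] {δ : M →ₗ[ℂ] A ⊗[ℂ] M} {δ' : M' →ₗ[ℂ] A ⊗[ℂ] M'}
    (K : M →ₛₗ[starRingEnd ℂ] M') (hK : ∀ m, δ' (K m) = starMap A K (δ m)) {u u' : A →ₗ[ℂ] ℂ}
    (hu : ∀ a, star (u a) = u' (star a)) (m : M) :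
    K (coactBy δ u m) = coactBy δ' u' (K m) := by
  simp only [coactBy, LinearMap.comp_apply, hK]
  generalize δ m = x
  induction x with
  | zero => simp
  | add x x' hx hx' => simp only [map_add, hx, hx']
  | tmul a m => simp [← hu]
end

theorem starMap_star {A B : Type*} [Ring A] [Algebra ℂ A] [StarRing A] [StarModule ℂ A]
    [Ring B] [Algebra ℂ B] [StarRing B] [StarModule ℂ B] (x : A ⊗[ℂ] B) :
    starMap A (starLinearEquiv ℂ (A := B)).toLinearMap x = star x := rfl

section
variable {A : Type u} [Ring A] [HopfAlgebra ℂ A] [StarRing A] [StarModule ℂ A]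
  [IsStarBialgebra A]

theorem star_lact {u u' : A →ₗ[ℂ] ℂ} (hu : ∀ a, star (u a) = u' (star a)) (a : A) :
    star (lact u a) = lact u' (star a) :=
  conj_coactBy (starLinearEquiv ℂ (A := A)).toLinearMap
    (fun a => IsStarBialgebra.comul_star a) hu a

theorem star_ract {u u' : A →ₗ[ℂ] ℂ} (hu : ∀ a, star (u a) = u' (star a)) (a : A) :
    star (ract u a) = ract u' (star a) := by
  simp only [ract, LinearMap.comp_apply, IsStarBialgebra.comul_star]
  generalize comul (R := ℂ) a = x
  induction x with
  | zero => simp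
  | add x x' hx hx' => simp only [map_add, star_add, hx, hx']
  | tmul a m => simp [← hu]

theorem comul₃_star (a : A) : comul₃ A (star a) = star (comul₃ A a) := by
  simp only [comul₃, LinearMap.comp_apply, IsStarBialgebra.comul_star]
  generalize comul (R := ℂ) a = x
  induction x with
  | zero => simp
  | add x x' hx hx' => simp only [map_add, star_add, hx, hx']
  | tmul a m => simp [IsStarBialgebra.comul_star]

variable (γ : TwoCocycle A)

theorem TwoCocycle.ract_Vbar_lmul (a b : A) :
    ract γ.Vbar (γ.lmul a b)
      = contractR γ.lmul ((LinearMap.mul ℂ A).compr₂ γ.Vbar) (comul a) (comul b) := by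
  simp only [ract, LinearMap.comp_apply, γ.comul_lmul]
  generalize comul (R := ℂ) a = x
  generalize comul (R := ℂ) b = y
  induction x with
  | zero => simp
  | add x x' hx hx' => simp only [map_add, LinearMap.add_apply, hx, hx']
  | tmul a m =>
  induction y with
  | zero => simp
  | add x x' hx hx' => simp only [map_add, LinearMap.add_apply, hx, hx']
  | tmul b n => simp

/-- The operator of `V̄` on the right turns the twist of the product on the right by `γ̄` into the
twist by `dualInv`. -/
theorem TwoCocycle.ract_Vbar_mulA (a b : A) :
    ract γ.Vbar (γ.mulA a b)
      = contractR γ.lmul γ.dualInv (comul (ract γ.Vbar a)) (comul (ract γ.Vbar b)) := by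
  have h1 : γ.lmul.compr₂ (ract γ.Vbar)
      = (contractR γ.lmul ((LinearMap.mul ℂ A).compr₂ γ.Vbar)).compl₁₂ comul comul :=
    LinearMap.ext₂ γ.ract_Vbar_lmul
  have h2 : (contractL ((LinearMap.mul ℂ A).compr₂ γ.Vbar) γ.inv).compl₁₂ comul comul
      = γ.dualInv.compl₁₂ (ract γ.Vbar) (ract γ.Vbar) := γ.conv₂_mul_Vbar_inv
  have h3 := contractR_map γ.dualInv γ.lmul (ract γ.Vbar) (ract γ.Vbar) LinearMap.id LinearMap.id
    (comul (R := ℂ) a) (comul (R := ℂ) b)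
  refine (contractR_compr₂ _ _ (ract γ.Vbar) _ _).trans ?_
  rw [h1, contractR_contractR (comul (R := ℂ) (A := A)) comul_coassoc, comul_ract, comul_ract, h2]
  exact h3.symm

/-- The operator of `V` on the left turns the remaining twist on the left by `γ` into the twist
by `dual`. -/
theorem TwoCocycle.lact_V_contractR_lmul (a b : A) :
    lact γ.V (contractR γ.lmul γ.dualInv (comul a) (comul b))
      = contractR (conv₂ γ.dual (LinearMap.mul ℂ A)) γ.dualInv (comul (lact γ.V a))
        (comul (lact γ.V b)) := by
  have h1 : γ.lmul.compr₂ (lact γ.V)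
      = (conv₂ γ.dual (LinearMap.mul ℂ A)).compl₁₂ (lact γ.V) (lact γ.V) :=
    LinearMap.ext₂ fun a b => γ.coactBy_V_contractL comul_isCoaction comul_isCoaction
      (LinearMap.mul ℂ A) comul_mul' a b
  have h2 := contractR_map γ.dualInv (conv₂ γ.dual (LinearMap.mul ℂ A)) LinearMap.id LinearMap.id
    (lact γ.V) (lact γ.V) (comul (R := ℂ) a) (comul (R := ℂ) b)
  refine (contractR_compr₂ _ _ (lact γ.V) _ _).trans ?_
  rw [h1, comul_lact, comul_lact]
  exact h2.symm

variable {γ}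

namespace TwoCocycle.IsUnitary

/-- The cocycle `dual` is the complex conjugate of `γ`. -/
theorem star_toFun (hγ : γ.IsUnitary) (a b : A) :
    star (γ.toFun a b) = γ.dual (star b) (star a) := by
  rw [hγ, star_antipode, star_antipode]
  rfl

/-- The complex conjugate of `γ̄` is `dualInv`: unitarity at `S⁻¹(a^*)` and `S⁻¹(b^*)`. -/
theorem star_inv (hγ : γ.IsUnitary) (a b : A) :
    star (γ.inv a b) = γ.dualInv (star b) (star a) := by
  have h := hγ (antipodeInv A (star a)) (antipodeInv A (star b))
  rw [antipode_antipodeInv, antipode_antipodeInv, star_star, star_star] at h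
  rw [← h, star_star]
  rfl

theorem star_dual (hγ : γ.IsUnitary) (a b : A) :
    star (γ.dual a b) = γ.toFun (star b) (star a) := by
  rw [star_eq_iff_star_eq, star_toFun hγ, star_star, star_star]

theorem star_dualInv (hγ : γ.IsUnitary) (a b : A) :
    star (γ.dualInv a b) = γ.inv (star b) (star a) := by
  rw [star_eq_iff_star_eq, star_inv hγ, star_star, star_star]

/-- Complex conjugation exchanges `V` and `V̄`. -/
theorem star_V (hγ : γ.IsUnitary) (a : A) : star (γ.V a) = γ.Vbar (star a) := by
  simp only [V, Vbar, LinearMap.comp_apply, IsStarBialgebra.comul_star]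
  generalize comul (R := ℂ) a = x
  induction x with
  | zero => simp
  | add x x' hx hx' => simp only [map_add, star_add, hx, hx']
  | tmul a b =>
    have h := hγ (antipodeInv A b) a
    rw [antipode_antipodeInv, star_antipode] at h
    simpa using h

theorem star_Vbar (hγ : γ.IsUnitary) (a : A) : star (γ.Vbar a) = γ.V (star a) := by
  rw [star_eq_iff_star_eq, star_V hγ, star_star]

/-- `h^{*_γ}` is the ordinary involution of `V(h₁) h₂ V̄(h₃)`. -/
theorem starA_eq (hγ : γ.IsUnitary) (h : A) : γ.starA h = star (ract γ.Vbar (lact γ.V h)) := by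
  rw [starA, ← comul₃_star, sandwich_comul₃, star_ract (star_Vbar hγ), star_lact (star_V hγ),
    LinearMap.id_apply]

theorem starA_starA (hγ : γ.IsUnitary) (h : A) : γ.starA (γ.starA h) = h := by
  rw [starA_eq hγ, starA_eq hγ, star_ract (star_Vbar hγ), star_lact (star_V hγ), star_star,
    ract_lact, ract_ract]
  have h1 : γ.V ∘ₗ ract γ.Vbar = counit := LinearMap.ext γ.V_ract_Vbar
  rw [h1, ract_counit, LinearMap.id_apply, lact_Vbar_V]

theorem star_conv₂_dual_mul (hγ : γ.IsUnitary) (a b : A) :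
    star (conv₂ γ.dual (LinearMap.mul ℂ A) a b) = γ.lmul (star b) (star a) := by
  have h := conj_contractL (star_dual hγ) (p := LinearMap.mul ℂ A) (p' := LinearMap.mul ℂ A)
    (starLinearEquiv ℂ (A := A)).toLinearMap (starLinearEquiv ℂ (A := A)).toLinearMap
    (starLinearEquiv ℂ (A := A)).toLinearMap (fun a b => star_mul a b) (comul (R := ℂ) a)
    (comul (R := ℂ) b)
  refine h.trans ?_
  rw [starMap_star, starMap_star, ← IsStarBialgebra.comul_star, ← IsStarBialgebra.comul_star]
  rfl

/-- The operators of `V` and `V̄` replace `γ` and `γ̄` by their complex conjugates, which the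
ordinary involution turns back into `γ` and `γ̄`. -/
theorem starA_mulA (hγ : γ.IsUnitary) (a b : A) :
    γ.starA (γ.mulA a b) = γ.mulA (γ.starA b) (γ.starA a) := by
  rw [starA_eq hγ, starA_eq hγ, starA_eq hγ, ract_lact, γ.ract_Vbar_mulA,
    γ.lact_V_contractR_lmul, star_contractR (star_dualInv hγ) (star_conv₂_dual_mul hγ), ract_lact,
    ract_lact, ← IsStarBialgebra.comul_star, ← IsStarBialgebra.comul_star]
  rfl

/-- `A_γ` with the twisted involution. -/
noncomputable abbrev starRingAlg (hγ : γ.IsUnitary) : StarRing γ.Alg where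
  star a := γ.toAlg (γ.starA (γ.toAlg.symm a))
  star_involutive a := starA_starA hγ a
  star_mul a b := starA_mulA hγ a b
  star_add a b := by simp [starA_eq hγ]

theorem starModuleAlg (hγ : γ.IsUnitary) : letI := starRingAlg hγ; StarModule ℂ γ.Alg := by
  let _ := starRingAlg hγ
  refine ⟨fun c a => ?_⟩
  change γ.toAlg (γ.starA (γ.toAlg.symm (c • a))) = star c • γ.toAlg (γ.starA (γ.toAlg.symm a))
  simp [starA_eq hγ]

/-- The involution of `A_γ` multiplies both legs of `Δ(h)` by `V` and `V̄`; the inner factors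
`V̄(h₂) V(h₃)` cancel. -/
theorem isStarBialgebraAlg (hγ : γ.IsUnitary) : letI := starRingAlg hγ
    haveI := starModuleAlg hγ; IsStarBialgebra γ.Alg := by
  let _ := starRingAlg hγ
  have := starModuleAlg hγ
  refine ⟨fun a => ?_⟩
  obtain ⟨a, rfl⟩ := γ.toAlg.surjective a
  have h1 : ∀ x : A ⊗[ℂ] A, star (TensorProduct.map γ.toAlg.toLinearMap γ.toAlg.toLinearMap x)
      = TensorProduct.map γ.toAlg.toLinearMap γ.toAlg.toLinearMap
        (star (TensorProduct.map (lact γ.V) (ract γ.Vbar)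
          (TensorProduct.map (ract γ.Vbar) (lact γ.V) x))) := fun x => by
    induction x with
    | zero => simp
    | add x x' hx hx' => simp only [map_add, star_add, hx, hx']
    | tmul a b =>
      have h2 : ∀ a, star (γ.toAlg a) = γ.toAlg (star (ract γ.Vbar (lact γ.V a))) := fun a =>
        congrArg γ.toAlg (starA_eq hγ a)
      simp [h2, ract_lact]
  have h3 : comul (R := ℂ) (ract γ.Vbar (lact γ.V a))
      = TensorProduct.map (lact γ.V) (ract γ.Vbar) (comul (R := ℂ) a) := by
    rw [comul_ract, comul_lact, ← LinearMap.comp_apply, LinearMap.lTensor_comp_rTensor]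
  refine (γ.comul_toAlg (γ.starA a)).trans ?_
  rw [starA_eq hγ, IsStarBialgebra.comul_star, h3]
  refine Eq.trans ?_ (congrArg star (γ.comul_toAlg a)).symm
  rw [h1, γ.map_ract_coactBy comul_isCoaction]

section
variable {B : Type v} [Ring B] [Algebra ℂ B] [ComoduleAlgebra A B] [StarRing B] [StarModule ℂ B]
  [IsStarComoduleAlgebra A B]

theorem coactB_star (b : B) : coactB A B (star b)
    = starMap A (starLinearEquiv ℂ (A := B)).toLinearMap (coactB A B b) :=
  IsStarComoduleAlgebra.coact_star b

/-- `b^{*_γ}` is the ordinary involution of `V(b₍₋₁₎) b₍₀₎`. -/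
theorem starB_eq (hγ : γ.IsUnitary) (b : B) :
    γ.starB b = star (coactBy (coactB A B) γ.V b) := by
  have h := conj_coactBy (starLinearEquiv ℂ (A := B)).toLinearMap coactB_star (star_V hγ) b
  refine Eq.trans ?_ h.symm
  rw [starB, ← IsStarComoduleAlgebra.coact_star]
  rfl

theorem starB_starB (hγ : γ.IsUnitary) (b : B) : γ.starB (γ.starB b) = b := by
  have h := conj_coactBy (starLinearEquiv ℂ (A := B)).toLinearMap coactB_star (star_Vbar hγ)
    (coactBy (coactB A B) γ.V b)
  rw [starB_eq hγ, starB_eq hγ]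
  refine (congrArg star h.symm).trans ((star_star _).trans ?_)
  exact γ.coactBy_Vbar_V ComoduleAlgebra.isCoaction b

theorem starB_mulB (hγ : γ.IsUnitary) (a b : B) :
    γ.starB (γ.mulB B a b) = γ.mulB B (γ.starB b) (γ.starB a) := by
  have h1 : coactBy (coactB A B) γ.V (γ.mulB B a b) = _ :=
    γ.coactBy_V_contractL ComoduleAlgebra.isCoaction ComoduleAlgebra.isCoaction
      (LinearMap.mul ℂ B) coact_mul a b
  rw [starB_eq hγ, h1]
  refine (conj_contractL (star_dual hγ) (starLinearEquiv ℂ (A := B)).toLinearMap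
    (starLinearEquiv ℂ (A := B)).toLinearMap (starLinearEquiv ℂ (A := B)).toLinearMap
    (p' := LinearMap.mul ℂ B) (fun a b => star_mul a b) _ _).trans ?_
  rw [← coactB_star, ← coactB_star, starB_eq hγ, starB_eq hγ]
  rfl

/-- `B_γ` with the twisted involution. -/
noncomputable abbrev starRingComodAlg (hγ : γ.IsUnitary) (B : Type v) [Ring B] [Algebra ℂ B]
    [ComoduleAlgebra A B] [StarRing B] [StarModule ℂ B] [IsStarComoduleAlgebra A B] :
    StarRing (γ.ComodAlg B) where
  star b := γ.toComodAlg B (γ.starB ((γ.toComodAlg B).symm b))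
  star_involutive b := starB_starB hγ (B := B) b
  star_mul a b := starB_mulB hγ (B := B) a b
  star_add a b := by simp [starB_eq hγ]

theorem starModuleComodAlg (hγ : γ.IsUnitary) :
    letI := starRingComodAlg hγ B; StarModule ℂ (γ.ComodAlg B) := by
  let _ := starRingComodAlg hγ B
  refine ⟨fun c b => ?_⟩
  change γ.toComodAlg B (γ.starB ((γ.toComodAlg B).symm (c • b)))
    = star c • γ.toComodAlg B (γ.starB ((γ.toComodAlg B).symm b))
  simp [starB_eq hγ]

theorem isStarComoduleAlgebraComodAlg (hγ : γ.IsUnitary) :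
    letI := starRingAlg hγ; haveI := starModuleAlg hγ
    letI := starRingComodAlg hγ B; haveI := starModuleComodAlg (B := B) hγ
    IsStarComoduleAlgebra γ.Alg (γ.ComodAlg B) := by
  let _ := starRingAlg hγ
  have := starModuleAlg hγ
  let _ := starRingComodAlg hγ B
  have := starModuleComodAlg (B := B) hγ
  refine ⟨fun b => ?_⟩
  obtain ⟨b, rfl⟩ := (γ.toComodAlg B).surjective b
  have h1 : ∀ x : A ⊗[ℂ] B,
      star (TensorProduct.map γ.toAlg.toLinearMap (γ.toComodAlg B).toLinearMap x)
      = TensorProduct.map γ.toAlg.toLinearMap (γ.toComodAlg B).toLinearMap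
        (star ((lact γ.V).rTensor B
          (TensorProduct.map (ract γ.Vbar) (coactBy (coactB A B) γ.V) x))) := fun x => by
    induction x with
    | zero => simp
    | add x x' hx hx' => simp only [map_add, star_add, hx, hx']
    | tmul a b =>
      have h2 : ∀ a, star (γ.toAlg a) = γ.toAlg (star (ract γ.Vbar (lact γ.V a))) := fun a =>
        congrArg γ.toAlg (starA_eq hγ a)
      have h3 : ∀ b, star (γ.toComodAlg B b)
          = γ.toComodAlg B (star (coactBy (coactB A B) γ.V b)) := fun b =>
        congrArg (γ.toComodAlg B) (starB_eq hγ b)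
      simp only [TensorProduct.map_tmul, LinearMap.rTensor_tmul, star_tmul, LinearEquiv.coe_coe,
        h2, h3, ract_lact]
  refine (γ.coact_toComodAlg B (γ.starB b)).trans ?_
  refine Eq.trans ?_ (congrArg star (γ.coact_toComodAlg B b)).symm
  rw [h1, γ.map_ract_coactBy ComoduleAlgebra.isCoaction, starB_eq hγ,
    ← ComoduleAlgebra.isCoaction.coact_coactBy]
  exact congrArg _ (IsStarComoduleAlgebra.coact_star (A := A) _)
end

end TwoCocycle.IsUnitary
end
end starStructures

/-! ### Twisting by a cocycle is an equivalence -/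

section equivalence
open Coalgebra

variable {A : Type u} [Ring A] [Bialgebra ℂ A] (γ : TwoCocycle A)

/-- The unit acts trivially after a twist by a functional that is unital on the left. -/
theorem contractL_one_left {f : A →ₗ[ℂ] A →ₗ[ℂ] ℂ} (hf : ∀ a, f 1 a = counit (R := ℂ) a)
    {M P : Type*} [AddCommGroup M] [Module ℂ M] [AddCommGroup P] [Module ℂ P]
    (p : P →ₗ[ℂ] M →ₗ[ℂ] M) (e : P) (he : ∀ m, p e m = m) (x : A ⊗[ℂ] M) :
    contractL f p ((1 : A) ⊗ₜ e) x
      = TensorProduct.lid ℂ M ((counit (R := ℂ) (A := A)).rTensor M x) := by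
  induction x with
  | zero => simp
  | add x x' hx hx' => simp only [map_add, hx, hx']
  | tmul b m => simp [hf, he]

/-- The unit acts trivially after a twist by a functional that is unital on the right. -/
theorem contractL_one_right {f : A →ₗ[ℂ] A →ₗ[ℂ] ℂ} (hf : ∀ a, f a 1 = counit (R := ℂ) a)
    {M P : Type*} [AddCommGroup M] [Module ℂ M] [AddCommGroup P] [Module ℂ P]
    (p : M →ₗ[ℂ] P →ₗ[ℂ] M) (e : P) (he : ∀ m, p m e = m) (x : A ⊗[ℂ] M) :
    contractL f p x ((1 : A) ⊗ₜ e)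
      = TensorProduct.lid ℂ M ((counit (R := ℂ) (A := A)).rTensor M x) := by
  induction x with
  | zero => simp
  | add x x' hx hx' => simp only [map_add, LinearMap.add_apply, hx, hx']
  | tmul b m => simp [hf, he]

theorem TwoCocycle.contractR_mul_inv (a b : A) :
    contractR (LinearMap.mul ℂ A) γ.inv (comul a) (comul b)
      = contractL γ.inv γ.mulA (comul a) (comul b) :=
  (LinearMap.congr_fun₂ γ.conv₂_inv_mulA a b).symm

/-- `γ̄` is a cocycle for the product of `A_γ`. -/
theorem TwoCocycle.inv_cocycle_mulA (g h k : A) :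
    contractL γ.inv (γ.mulA.compr₂ (γ.inv.flip k)) (comul g) (comul h)
      = contractL γ.inv (γ.mulA.compr₂ (γ.inv g)) (comul h) (comul k) := by
  have e : ∀ (u : A →ₗ[ℂ] ℂ) (a b : A), contractL γ.inv (γ.mulA.compr₂ u) (comul a) (comul b)
      = contractR ((LinearMap.mul ℂ A).compr₂ u) γ.inv (comul a) (comul b) := fun u a b => by
    rw [← contractL_compr₂, ← γ.contractR_mul_inv, contractR_compr₂]
  rw [e, e, γ.inv_cocycle]

variable {B : Type v} [Ring B] [Algebra ℂ B] [ComoduleAlgebra A B]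

theorem TwoCocycle.contractL_inv_lsmulM (M : RelHopf A B) (b : B) (m : M.carrier) :
    contractL γ.inv (γ.lsmulM M) (coactB A B b) (M.coact m) = M.lsmul b m :=
  contractL_contractL_of_inverse ComoduleAlgebra.isCoaction M.isCoaction γ.inv_conv₂ M.lsmul b m

theorem TwoCocycle.contractL_inv_rsmulM (M : RelHopf A B) (m : M.carrier) (b : B) :
    contractL γ.inv (γ.rsmulM M) (M.coact m) (coactB A B b) = M.rsmul m b :=
  contractL_contractL_of_inverse M.isCoaction ComoduleAlgebra.isCoaction γ.inv_conv₂ M.rsmul m b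

theorem map_toAlg_id_injective (X : Type*) [AddCommGroup X] [Module ℂ X] : Function.Injective
    (TensorProduct.map γ.toAlg.toLinearMap (LinearMap.id (R := ℂ) (M := X))) :=
  (TensorProduct.congr γ.toAlg (LinearEquiv.refl ℂ X)).injective

instance functor_faithful : (γ.functor B).Faithful where
  map_injective {_ _ f g} h := by
    have h' : γ.functorMap f = γ.functorMap g := h
    have h'' : RelHopf.lin (γ.functorMap f) = RelHopf.lin (γ.functorMap g) :=
      congrArg (fun k => RelHopf.lin k) h'
    exact RelHopf.Hom.ext h''

/-- A morphism `Γ(M) ⟶ Γ(N)` is a morphism `M ⟶ N`: the original actions are the twists of those of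
`Γ(M)` and `Γ(N)` by `γ̄`. -/
noncomputable def TwoCocycle.preimage {M N : RelHopf A B}
    (g : γ.functorObj M ⟶ γ.functorObj N) : M ⟶ N := by
  let g' : M.carrier →ₗ[ℂ] N.carrier :=
    RelHopf.lin (M := γ.functorObj M) (N := γ.functorObj N) g
  have hc : ∀ m, N.coact (g' m) = g'.lTensor A (M.coact m) := fun m => by
    have h : TensorProduct.map γ.toAlg.toLinearMap LinearMap.id (N.coact (g' m))
        = g'.lTensor γ.Alg (TensorProduct.map γ.toAlg.toLinearMap LinearMap.id (M.coact m)) :=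
      RelHopf.Hom.map_coact (M := γ.functorObj M) (N := γ.functorObj N) g m
    rw [← lTensor_map_id] at h
    exact map_toAlg_id_injective γ N.carrier h
  exact RelHopf.Hom.mk g'
    (fun b m => by
      rw [← γ.contractL_inv_lsmulM M, ← γ.contractL_inv_lsmulM N, hc]
      refine (map_twist γ.inv (γ.lsmulM M) (γ.lsmulM N) LinearMap.id g' g'
        (fun b m => RelHopf.Hom.map_lsmul (M := γ.functorObj M) (N := γ.functorObj N) g
          (γ.toComodAlg B b) m) _ _).trans ?_
      rw [LinearMap.lTensor_id_apply])
    (fun m b => by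
      rw [← γ.contractL_inv_rsmulM M, ← γ.contractL_inv_rsmulM N, hc]
      refine (map_twist γ.inv (γ.rsmulM M) (γ.rsmulM N) g' LinearMap.id g'
        (fun m b => RelHopf.Hom.map_rsmul (M := γ.functorObj M) (N := γ.functorObj N) g
          m (γ.toComodAlg B b)) _ _).trans ?_
      rw [LinearMap.lTensor_id_apply])
    hc

instance functor_full : (γ.functor B).Full where
  map_surjective g := ⟨γ.preimage (B := B) g, rfl⟩

section untwist
variable (N : RelHopf γ.Alg (γ.ComodAlg B))

/-- The left action of `B_γ`, regarded as a bilinear map on `B`. -/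
noncomputable def TwoCocycle.lact₀ : B →ₗ[ℂ] N.carrier →ₗ[ℂ] N.carrier :=
  N.lsmul ∘ₗ (γ.toComodAlg B).toLinearMap

/-- The right action of `B_γ`, regarded as a bilinear map on `B`. -/
noncomputable def TwoCocycle.ract₀ : N.carrier →ₗ[ℂ] B →ₗ[ℂ] N.carrier :=
  N.rsmul.compl₂ (γ.toComodAlg B).toLinearMap

/-- The coaction of `A_γ`, regarded as a coaction of `A`. -/
noncomputable def TwoCocycle.coact₀ : N.carrier →ₗ[ℂ] A ⊗[ℂ] N.carrier :=
  TensorProduct.map γ.toAlg.symm.toLinearMap LinearMap.id ∘ₗ N.coact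

theorem TwoCocycle.comul_toAlg_symm (a : γ.Alg) : comul (R := ℂ) (γ.toAlg.symm.toLinearMap a)
    = TensorProduct.map γ.toAlg.symm.toLinearMap γ.toAlg.symm.toLinearMap (comul (R := ℂ) a) := by
  obtain ⟨a, rfl⟩ := γ.toAlg.surjective a
  refine Eq.trans ?_ (congrArg _ (γ.comul_toAlg a)).symm
  refine Eq.trans ?_ ((TensorProduct.congr γ.toAlg γ.toAlg).symm_apply_apply _).symm
  rfl

theorem TwoCocycle.coact₀_isCoaction : IsCoaction (γ.coact₀ N) :=
  N.isCoaction.transfer γ.toAlg.symm.toLinearMap γ.comul_toAlg_symm (fun _ => rfl) LinearMap.id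
    Function.surjective_id (fun _ => rfl)

theorem TwoCocycle.map_symm_coact_toComodAlg (b : B) :
    TensorProduct.map γ.toAlg.symm.toLinearMap (γ.toComodAlg B).symm.toLinearMap
      (ComoduleAlgebra.coact (A := γ.Alg) (γ.toComodAlg B b)) = coactB A B b := by
  rw [γ.coact_toComodAlg]
  exact (TensorProduct.congr γ.toAlg (γ.toComodAlg B)).symm_apply_apply _

theorem TwoCocycle.coact₀_lact₀ (b : B) (n : N.carrier) : γ.coact₀ N (γ.lact₀ N b n)
    = map₂ γ.mulA (γ.lact₀ N) (coactB A B b) (γ.coact₀ N n) := by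
  refine (congrArg _ (N.coact_lsmul (γ.toComodAlg B b) n)).trans ?_
  refine (map_map₂ (LinearMap.mul ℂ γ.Alg) γ.mulA γ.toAlg.symm.toLinearMap (fun _ _ => rfl) N.lsmul
    (γ.lact₀ N) (γ.toComodAlg B).symm.toLinearMap LinearMap.id LinearMap.id (fun _ _ => rfl)
    _ _).trans ?_
  rw [γ.map_symm_coact_toComodAlg]
  rfl

theorem TwoCocycle.coact₀_ract₀ (n : N.carrier) (b : B) : γ.coact₀ N (γ.ract₀ N n b)
    = map₂ γ.mulA (γ.ract₀ N) (γ.coact₀ N n) (coactB A B b) := by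
  refine (congrArg _ (N.coact_rsmul n (γ.toComodAlg B b))).trans ?_
  refine (map_map₂ (LinearMap.mul ℂ γ.Alg) γ.mulA γ.toAlg.symm.toLinearMap (fun _ _ => rfl) N.rsmul
    (γ.ract₀ N) LinearMap.id (γ.toComodAlg B).symm.toLinearMap LinearMap.id (fun _ _ => rfl)
    _ _).trans ?_
  rw [γ.map_symm_coact_toComodAlg]
  rfl

theorem TwoCocycle.contractL_inv_mulB (a b : B) :
    contractL γ.inv (γ.mulB B) (coactB A B a) (coactB A B b) = a * b :=
  contractL_contractL_of_inverse ComoduleAlgebra.isCoaction ComoduleAlgebra.isCoaction γ.inv_conv₂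
    (LinearMap.mul ℂ B) a b

/-- The inverse of `Γ` on objects: the comodule `N` with the actions twisted by `γ̄`. -/
noncomputable def TwoCocycle.untwist : RelHopf A B where
  carrier := N.carrier
  lsmul := (contractL γ.inv (γ.lact₀ N)).compl₁₂ (coactB A B) (γ.coact₀ N)
  rsmul := (contractL γ.inv (γ.ract₀ N)).compl₁₂ (γ.coact₀ N) (coactB A B)
  one_lsmul m := by
    rw [LinearMap.compl₁₂_apply, coactB_one,
      contractL_one_left γ.inv_one_left (γ.lact₀ N) 1 N.one_lsmul, (γ.coact₀_isCoaction N).counit]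
  rsmul_one m := by
    rw [LinearMap.compl₁₂_apply, coactB_one,
      contractL_one_right γ.inv_one_right (γ.ract₀ N) 1 N.rsmul_one, (γ.coact₀_isCoaction N).counit]
  mul_lsmul a b m := by
    have h := twist_assoc comul γ.mulA γ.inv γ.inv_cocycle_mulA (coactB A B) (coactB A B)
      (coactB A B) (γ.coact₀ N) (γ.coact₀ N) (coactB_coassoc B) (coactB_coassoc B)
      (γ.coact₀_isCoaction N).coassoc (γ.mulB B) (γ.coactB_mulB B) (γ.lact₀ N) (γ.coact₀_lact₀ N)
      (γ.lact₀ N) (γ.lact₀ N) (fun a b m => N.mul_lsmul (γ.toComodAlg B a) (γ.toComodAlg B b) m)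
      a b m
    rwa [γ.contractL_inv_mulB] at h
  rsmul_mul m a b := by
    have h := twist_assoc comul γ.mulA γ.inv γ.inv_cocycle_mulA (γ.coact₀ N) (coactB A B)
      (γ.coact₀ N) (coactB A B) (coactB A B) (γ.coact₀_isCoaction N).coassoc (coactB_coassoc B)
      (coactB_coassoc B) (γ.ract₀ N) (γ.coact₀_ract₀ N) (γ.mulB B) (γ.coactB_mulB B)
      (γ.ract₀ N) (γ.ract₀ N)
      (fun m a b => (N.rsmul_mul m (γ.toComodAlg B a) (γ.toComodAlg B b)).symm) m a b
    rw [γ.contractL_inv_mulB] at h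
    exact h.symm
  lsmul_rsmul a m b :=
    twist_assoc comul γ.mulA γ.inv γ.inv_cocycle_mulA (coactB A B) (γ.coact₀ N)
      (γ.coact₀ N) (coactB A B) (γ.coact₀ N) (coactB_coassoc B) (γ.coact₀_isCoaction N).coassoc
      (coactB_coassoc B) (γ.lact₀ N) (γ.coact₀_lact₀ N) (γ.ract₀ N) (γ.coact₀_ract₀ N)
      (γ.ract₀ N) (γ.lact₀ N)
      (fun a m b => N.lsmul_rsmul (γ.toComodAlg B a) m (γ.toComodAlg B b)) a m b
  coact := γ.coact₀ N
  isCoaction := γ.coact₀_isCoaction N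
  coact_lsmul := coact_twist comul γ.mulA (LinearMap.mul ℂ A) γ.inv γ.contractR_mul_inv
    (coactB A B) (γ.coact₀ N) (γ.coact₀ N) (coactB_coassoc B) (γ.coact₀_isCoaction N).coassoc
    (γ.lact₀ N) (γ.coact₀_lact₀ N)
  coact_rsmul := coact_twist comul γ.mulA (LinearMap.mul ℂ A) γ.inv γ.contractR_mul_inv
    (γ.coact₀ N) (coactB A B) (γ.coact₀ N) (γ.coact₀_isCoaction N).coassoc (coactB_coassoc B)
    (γ.ract₀ N) (γ.coact₀_ract₀ N)

/-- `Γ` of the untwisted object is the given one. -/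
noncomputable def TwoCocycle.functorObjUntwist : γ.functorObj (γ.untwist N) ≅ N :=
  RelHopf.isoOfInv (RelHopf.Hom.mk (M := γ.functorObj (γ.untwist N)) (N := N) LinearMap.id
      (fun b m => contractL_contractL_of_inverse (ComoduleAlgebra.isCoaction (A := A) (B := B))
        (γ.coact₀_isCoaction N) γ.conv₂_inv (γ.lact₀ N) ((γ.toComodAlg B).symm b) m)
      (fun m b => contractL_contractL_of_inverse (γ.coact₀_isCoaction N)
        (ComoduleAlgebra.isCoaction (A := A) (B := B)) γ.conv₂_inv (γ.ract₀ N) m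
        ((γ.toComodAlg B).symm b))
      (fun m => by
        refine Eq.trans ?_ (LinearMap.lTensor_id_apply γ.Alg N.carrier _).symm
        exact ((TensorProduct.congr γ.toAlg (LinearEquiv.refl ℂ N.carrier)).apply_symm_apply
          (N.coact m)).symm))
    LinearMap.id (fun _ => rfl) (fun _ => rfl)
end untwist

instance functor_essSurj : (γ.functor B).EssSurj where
  mem_essImage N := ⟨γ.untwist N, ⟨γ.functorObjUntwist N⟩⟩

theorem functor_isEquivalence : (γ.functor B).IsEquivalence where

end equivalence

/-! ### Twisting by a cocycle is monoidal -/

section monoidalTwist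
open Coalgebra RelHopf

variable {A : Type u} [Ring A] [Bialgebra ℂ A] (γ : TwoCocycle A)
  {B : Type v} [Ring B] [Algebra ℂ B] [ComoduleAlgebra A B]

variable (B) in
/-- The identity `B_γ → Γ(B)`. -/
noncomputable def TwoCocycle.unitIso :
    RelHopf.unit γ.Alg (γ.ComodAlg B) ≅ γ.functorObj (RelHopf.unit A B) :=
  isoOfInv (Hom.mk (M := RelHopf.unit γ.Alg (γ.ComodAlg B)) (N := γ.functorObj (RelHopf.unit A B))
      (γ.toComodAlg B).symm.toLinearMap (fun _ _ => rfl) (fun _ _ => rfl)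
      (fun b => by
        obtain ⟨b, rfl⟩ := (γ.toComodAlg B).surjective b
        refine Eq.trans ?_ (congrArg _ (γ.coact_toComodAlg B b)).symm
        have h : ∀ x : A ⊗[ℂ] B, TensorProduct.map γ.toAlg.toLinearMap LinearMap.id x
            = (γ.toComodAlg B).symm.toLinearMap.lTensor γ.Alg
              (TensorProduct.map γ.toAlg.toLinearMap (γ.toComodAlg B).toLinearMap x) := fun x => by
          induction x with
          | zero => simp
          | add x x' hx hx' => simp only [map_add, hx, hx']
          | tmul a b => simp
        exact h (coactB A B b)))
    (γ.toComodAlg B).toLinearMap (fun _ => rfl) (fun _ => rfl)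

section
variable (M N : RelHopf A B)

/-- `(m, n) ↦ γ(m₍₋₁₎ ⊗ n₍₋₁₎) m₍₀₎ ⊗ n₍₀₎` -/
noncomputable def TwoCocycle.muAux : M.carrier →ₗ[ℂ] N.carrier →ₗ[ℂ] BT M N :=
  (contractL γ.toFun bt).compl₁₂ M.coact N.coact

theorem TwoCocycle.coact_muAux (m : M.carrier) (n : N.carrier) :
    btCoact M N (γ.muAux M N m n) = map₂ γ.mulA (γ.muAux M N) (M.coact m) (N.coact n) :=
  coact_twist comul (LinearMap.mul ℂ A) γ.mulA γ.toFun γ.contractR_mulA M.coact N.coact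
    (btCoact M N) M.isCoaction.coassoc N.isCoaction.coassoc bt (btCoact_bt M N) m n

/-- The structure map `φ` of `Γ`. -/
noncomputable def TwoCocycle.muHom :
    tensor (γ.functorObj M) (γ.functorObj N) ⟶ γ.functorObj (tensor M N) :=
  tensorHomMk (M := γ.functorObj M) (N := γ.functorObj N) (P := γ.functorObj (tensor M N))
    (γ.muAux M N)
    (fun m b n => twist_assoc comul (LinearMap.mul ℂ A) γ.toFun γ.cocycle M.coact (coactB A B)
      M.coact N.coact N.coact M.isCoaction.coassoc (coactB_coassoc B) N.isCoaction.coassoc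
      M.rsmul M.coact_rsmul N.lsmul N.coact_lsmul bt bt bt_balanced m ((γ.toComodAlg B).symm b) n)
    (fun b m n => twist_assoc comul (LinearMap.mul ℂ A) γ.toFun γ.cocycle (coactB A B) M.coact
      M.coact N.coact (btCoact M N) (coactB_coassoc B) M.isCoaction.coassoc N.isCoaction.coassoc
      M.lsmul M.coact_lsmul bt (btCoact_bt M N) bt (btLsmul M N) (fun _ _ _ => rfl)
      ((γ.toComodAlg B).symm b) m n)
    (fun m n b => (twist_assoc comul (LinearMap.mul ℂ A) γ.toFun γ.cocycle M.coact N.coact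
      (btCoact M N) (coactB A B) N.coact M.isCoaction.coassoc N.isCoaction.coassoc
      (coactB_coassoc B) bt (btCoact_bt M N) N.rsmul N.coact_rsmul (btRsmul M N) bt
      (fun _ _ _ => rfl) m n ((γ.toComodAlg B).symm b)).symm)
    (fun m n => (congrArg (TensorProduct.map γ.toAlg.toLinearMap LinearMap.id)
      (γ.coact_muAux M N m n)).trans
      (map_map₂ γ.mulA (LinearMap.mul ℂ γ.Alg) γ.toAlg.toLinearMap γ.toAlg_mulA (γ.muAux M N)
        (γ.muAux M N) LinearMap.id LinearMap.id LinearMap.id (fun _ _ => rfl) _ _))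

theorem TwoCocycle.coact_lsmulM (b : B) (m : M.carrier) : M.coact (γ.lsmulM M b m)
    = map₂ γ.mulA (γ.lsmulM M) (coactB A B b) (M.coact m) :=
  coact_twist comul (LinearMap.mul ℂ A) γ.mulA γ.toFun γ.contractR_mulA (coactB A B) M.coact
    M.coact (coactB_coassoc B) M.isCoaction.coassoc M.lsmul M.coact_lsmul b m

theorem TwoCocycle.coact_rsmulM (m : M.carrier) (b : B) : M.coact (γ.rsmulM M m b)
    = map₂ γ.mulA (γ.rsmulM M) (M.coact m) (coactB A B b) :=
  coact_twist comul (LinearMap.mul ℂ A) γ.mulA γ.toFun γ.contractR_mulA M.coact (coactB A B)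
    M.coact M.isCoaction.coassoc (coactB_coassoc B) M.rsmul M.coact_rsmul m b

/-- The pure tensor in `Γ(M) ⊗ Γ(N)`. -/
noncomputable def TwoCocycle.btTwist :
    M.carrier →ₗ[ℂ] N.carrier →ₗ[ℂ] BT (γ.functorObj M) (γ.functorObj N) :=
  bt (M := γ.functorObj M) (N := γ.functorObj N)

theorem TwoCocycle.btTwist_balanced (m : M.carrier) (b : B) (n : N.carrier) :
    γ.btTwist M N (γ.rsmulM M m b) n = γ.btTwist M N m (γ.lsmulM N b n) :=
  bt_balanced (M := γ.functorObj M) (N := γ.functorObj N) m (γ.toComodAlg B b) n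

/-- `m ⊗ n ↦ γ̄(m₍₋₁₎ ⊗ n₍₋₁₎) m₍₀₎ ⊗ n₍₀₎`, the inverse of `φ`. -/
noncomputable def TwoCocycle.muInv : BT M N →ₗ[ℂ] BT (γ.functorObj M) (γ.functorObj N) :=
  btLift ((contractL γ.inv (γ.btTwist M N)).compl₁₂ M.coact N.coact) (fun m b n => by
    have h := twist_assoc comul γ.mulA γ.inv γ.inv_cocycle_mulA M.coact (coactB A B) M.coact
      N.coact N.coact M.isCoaction.coassoc (coactB_coassoc B) N.isCoaction.coassoc (γ.rsmulM M)
      (γ.coact_rsmulM M) (γ.lsmulM N) (γ.coact_lsmulM N) (γ.btTwist M N) (γ.btTwist M N)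
      (γ.btTwist_balanced M N) m b n
    rwa [γ.contractL_inv_rsmulM, γ.contractL_inv_lsmulM] at h)

/-- The linear map underlying `φ`. -/
noncomputable def TwoCocycle.muLin : BT (γ.functorObj M) (γ.functorObj N) →ₗ[ℂ] BT M N :=
  lin (γ.muHom M N)

theorem TwoCocycle.muInv_comp_muLin : γ.muInv M N ∘ₗ γ.muLin M N = LinearMap.id :=
  bt_ext (M := γ.functorObj M) (N := γ.functorObj N) fun m n =>
    (contractL_compr₂ γ.toFun bt (γ.muInv M N) (M.coact m) (N.coact n)).trans
      (contractL_contractL_of_inverse M.isCoaction N.isCoaction γ.conv₂_inv (γ.btTwist M N) m n)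

theorem TwoCocycle.muLin_comp_muInv : γ.muLin M N ∘ₗ γ.muInv M N = LinearMap.id :=
  bt_ext fun m n =>
    (contractL_compr₂ γ.inv (γ.btTwist M N) (γ.muLin M N) (M.coact m) (N.coact n)).trans
      (contractL_contractL_of_inverse M.isCoaction N.isCoaction γ.inv_conv₂ bt m n)

/-- The structure isomorphism `φ` of `Γ`. -/
noncomputable def TwoCocycle.muIso :
    tensor (γ.functorObj M) (γ.functorObj N) ≅ γ.functorObj (tensor M N) :=
  isoOfInv (M := tensor (γ.functorObj M) (γ.functorObj N)) (N := γ.functorObj (tensor M N))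
    (γ.muHom M N) (γ.muInv M N) (fun x => DFunLike.congr_fun (γ.muInv_comp_muLin M N) x)
    (fun x => DFunLike.congr_fun (γ.muLin_comp_muInv M N) x)
end

theorem TwoCocycle.muHom_natural {M N M' N' : RelHopf A B} (f : M ⟶ M') (g : N ⟶ N') :
    tensorMap (γ.functorMap f) (γ.functorMap g) ≫ γ.muHom M' N'
      = γ.muHom M N ≫ γ.functorMap (tensorMap f g) :=
  tensor_hom_ext (M := γ.functorObj M) (N := γ.functorObj N) fun m n => by
    refine Eq.trans ?_ (map_twist γ.toFun bt bt f.hom g.hom (lin (tensorMap f g))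
      (fun _ _ => rfl) (M.coact m) (N.coact n)).symm
    exact congrArg₂ (fun x y => contractL γ.toFun bt x y) (f.map_coact m) (g.map_coact n)

theorem TwoCocycle.muHom_assoc (M N P : RelHopf A B) :
    tensorMap (γ.muHom M N) (𝟙 (γ.functorObj P)) ≫ γ.muHom (tensor M N) P
        ≫ γ.functorMap (RelHopf.associator M N P).hom
      = (RelHopf.associator (γ.functorObj M) (γ.functorObj N) (γ.functorObj P)).hom ≫
        tensorMap (𝟙 (γ.functorObj M)) (γ.muHom N P) ≫ γ.muHom M (tensor N P) :=
  tensor_hom_ext₃ (M := γ.functorObj M) (N := γ.functorObj N) (P := γ.functorObj P)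
    fun m n p => by
      have h := twist_assoc comul (LinearMap.mul ℂ A) γ.toFun γ.cocycle M.coact N.coact
        (btCoact M N) P.coact (btCoact N P) M.isCoaction.coassoc N.isCoaction.coassoc
        P.isCoaction.coassoc bt (btCoact_bt M N) bt (btCoact_bt N P) (assocAux M N P)
        (bt (M := M) (N := tensor N P)) (fun _ _ _ => rfl) m n p
      refine Eq.trans ?_ h
      exact contractL_compr₂ γ.toFun (bt (M := tensor M N) (N := P))
        (lin (RelHopf.associator M N P).hom) (btCoact M N (γ.muAux M N m n)) (P.coact p)

theorem TwoCocycle.muHom_leftUnitor (M : RelHopf A B) :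
    (RelHopf.leftUnitor (γ.functorObj M)).hom = tensorMap (γ.unitIso B).hom (𝟙 (γ.functorObj M)) ≫
      γ.muHom (RelHopf.unit A B) M ≫ γ.functorMap (RelHopf.leftUnitor M).hom :=
  tensor_hom_ext (M := RelHopf.unit γ.Alg (γ.ComodAlg B)) (N := γ.functorObj M) fun b m =>
    (contractL_compr₂ γ.toFun (bt (M := RelHopf.unit A B) (N := M)) (lin (RelHopf.leftUnitor M).hom)
      (coactB A B ((γ.toComodAlg B).symm b)) (M.coact m)).symm

theorem TwoCocycle.muHom_rightUnitor (M : RelHopf A B) :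
    (RelHopf.rightUnitor (γ.functorObj M)).hom = tensorMap (𝟙 (γ.functorObj M)) (γ.unitIso B).hom ≫
      γ.muHom M (RelHopf.unit A B) ≫ γ.functorMap (RelHopf.rightUnitor M).hom :=
  tensor_hom_ext (M := γ.functorObj M) (N := RelHopf.unit γ.Alg (γ.ComodAlg B)) fun m b =>
    (contractL_compr₂ γ.toFun (bt (M := M) (N := RelHopf.unit A B))
      (lin (RelHopf.rightUnitor M).hom) (M.coact m) (coactB A B ((γ.toComodAlg B).symm b))).symm

/-- `Γ` is monoidal. -/
noncomputable def TwoCocycle.coreMonoidal : (γ.functor B).CoreMonoidal where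
  εIso := γ.unitIso B
  μIso := γ.muIso
  μIso_hom_natural_left f N := γ.muHom_natural f (𝟙 N)
  μIso_hom_natural_right M f := γ.muHom_natural (𝟙 M) f
  associativity := γ.muHom_assoc
  left_unitality := γ.muHom_leftUnitor
  right_unitality := γ.muHom_rightUnitor

noncomputable instance : (γ.functor B).Monoidal := γ.coreMonoidal.toMonoidal

end monoidalTwist

/-! ### Twisting by a unitary cocycle is a bar functor -/

section barTwist
open Coalgebra RelHopf

theorem coactBy_natural {A M N : Type*} [AddCommGroup A] [Module ℂ A] [Coalgebra ℂ A]
    [AddCommGroup M] [Module ℂ M] [AddCommGroup N] [Module ℂ N]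
    {δM : M →ₗ[ℂ] A ⊗[ℂ] M} {δN : N →ₗ[ℂ] A ⊗[ℂ] N} (f : M →ₗ[ℂ] N)
    (hf : ∀ m, δN (f m) = f.lTensor A (δM m)) (u : A →ₗ[ℂ] ℂ) (m : M) :
    coactBy δN u (f m) = f (coactBy δM u m) := by
  simp only [coactBy, LinearMap.comp_apply, hf]
  generalize δM m = x
  induction x with
  | zero => simp
  | add x x' hx hx' => simp only [map_add, hx, hx']
  | tmul a m => simp

variable {A : Type u} [Ring A] [HopfAlgebra ℂ A] [StarRing A] [StarModule ℂ A]
  [IsStarBialgebra A] {B : Type v} [Ring B] [Algebra ℂ B] [ComoduleAlgebra A B] [StarRing B]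
  [StarModule ℂ B] [IsStarComoduleAlgebra A B] {γ : TwoCocycle A}

theorem coact_toConj (M : RelHopf A B) (m : M.carrier) :
    (barObj M).coact (toConj (M := M.carrier) m) = starMap A toConj (M.coact m) := rfl

/-- `m̄ ↦ \overline{u(m₍₋₁₎) m₍₀₎}` -/
noncomputable def conjCoactBy (M : RelHopf A B) (u : A →ₗ[ℂ] ℂ) :
    Conj M.carrier →ₗ[ℂ] Conj M.carrier := conjMap (coactBy M.coact u)

namespace TwoCocycle.IsUnitary

theorem coactBy_V_starB (hγ : γ.IsUnitary) (b : B) :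
    coactBy (coactB A B) γ.V (γ.starB b) = star b := by
  have h := conj_coactBy (starLinearEquiv ℂ (A := B)).toLinearMap coactB_star (star_Vbar hγ)
    (coactBy (coactB A B) γ.V b)
  rw [starB_eq hγ]
  refine h.symm.trans (congrArg star ?_)
  exact γ.coactBy_Vbar_V ComoduleAlgebra.isCoaction b

/-- `𝔑` is the conjugate of the operator of `V`. -/
theorem frakN_toConj (hγ : γ.IsUnitary) (M : RelHopf A B) (m : M.carrier) :
    γ.frakN M (toConj (M := M.carrier) m) = toConj (M := M.carrier) (coactBy M.coact γ.V m) :=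
  (conj_coactBy (M := M.carrier) toConj (coact_toConj M) (star_V hγ) m).symm

theorem coactBy_V_toConj (hγ : γ.IsUnitary) (M : RelHopf A B) (m : M.carrier) :
    coactBy (barObj M).coact γ.V (toConj (M := M.carrier) m)
      = toConj (M := M.carrier) (coactBy M.coact γ.Vbar m) :=
  (conj_coactBy (M := M.carrier) toConj (coact_toConj M) (star_Vbar hγ) m).symm

/-- The operator of `V` turns the right action of `Γ(M)` into the left action of `Γ(M̄)`. -/
theorem toConj_coactBy_V_rsmulM (hγ : γ.IsUnitary) (M : RelHopf A B) (m : M.carrier) (b : B) :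
    toConj (M := M.carrier) (coactBy M.coact γ.V (γ.rsmulM M m (γ.starB b)))
      = γ.lsmulM (barObj M) b (toConj (M := M.carrier) (coactBy M.coact γ.V m)) := by
  have h1 : coactBy M.coact γ.V (γ.rsmulM M m (γ.starB b)) = _ :=
    γ.coactBy_V_contractL M.isCoaction ComoduleAlgebra.isCoaction M.rsmul M.coact_rsmul m _
  rw [h1]
  refine (congrArg (fun b => toConj (M := M.carrier) (contractL γ.dual M.rsmul
    (M.coact (coactBy M.coact γ.V m)) (coactB A B b))) (coactBy_V_starB hγ b)).trans ?_
  refine (conj_contractL (star_dual hγ) (M := M.carrier) (P := M.carrier) (p' := barLsmul M)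
    toConj (starLinearEquiv ℂ (A := B)).toLinearMap toConj (fun m b => by simp) _ _).trans ?_
  rw [← coactB_star]
  exact congrArg (fun b => γ.lsmulM (barObj M) b _) (star_star b)

/-- The operator of `V` turns the left action of `Γ(M)` into the right action of `Γ(M̄)`. -/
theorem toConj_coactBy_V_lsmulM (hγ : γ.IsUnitary) (M : RelHopf A B) (b : B) (m : M.carrier) :
    toConj (M := M.carrier) (coactBy M.coact γ.V (γ.lsmulM M (γ.starB b) m))
      = γ.rsmulM (barObj M) (toConj (M := M.carrier) (coactBy M.coact γ.V m)) b := by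
  have h1 : coactBy M.coact γ.V (γ.lsmulM M (γ.starB b) m) = _ :=
    γ.coactBy_V_contractL ComoduleAlgebra.isCoaction M.isCoaction M.lsmul M.coact_lsmul _ m
  rw [h1]
  refine (congrArg (fun b => toConj (M := M.carrier) (contractL γ.dual M.lsmul (coactB A B b)
    (M.coact (coactBy M.coact γ.V m)))) (coactBy_V_starB hγ b)).trans ?_
  refine (conj_contractL (star_dual hγ) (N := M.carrier) (P := M.carrier) (p' := barRsmul M)
    (starLinearEquiv ℂ (A := B)).toLinearMap toConj toConj (fun b m => by simp) _ _).trans ?_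
  rw [← coactB_star]
  exact congrArg (fun b => γ.rsmulM (barObj M) _ b) (star_star b)

variable [StarRing γ.Alg] [StarModule ℂ γ.Alg] [IsStarBialgebra γ.Alg]
  [StarRing (γ.ComodAlg B)] [StarModule ℂ (γ.ComodAlg B)]
  [IsStarComoduleAlgebra γ.Alg (γ.ComodAlg B)]

/-- The operator of `V` intertwines the coactions of the conjugate of `Γ(M)`, which involves the
involution of `A_γ`, and of `Γ` of the conjugate of `M`. -/
theorem map_toAlg_coact_V (hγ : γ.IsUnitary)
    (hA : ∀ a : A, star (γ.toAlg a) = γ.toAlg (γ.starA a)) (M : RelHopf A B) (m : M.carrier) :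
    TensorProduct.map γ.toAlg.toLinearMap LinearMap.id
        (starMap A toConj (M.coact (coactBy M.coact γ.V m)))
      = (conjMap (coactBy M.coact γ.V)).lTensor γ.Alg (starMap γ.Alg toConj
        (TensorProduct.map γ.toAlg.toLinearMap LinearMap.id (M.coact m))) := by
  have h : ∀ x : A ⊗[ℂ] M.carrier, TensorProduct.map γ.toAlg.toLinearMap LinearMap.id
        (starMap A toConj ((lact γ.V).rTensor M.carrier
          (TensorProduct.map (ract γ.Vbar) (coactBy M.coact γ.V) x)))
      = (conjMap (coactBy M.coact γ.V)).lTensor γ.Alg (starMap γ.Alg toConj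
        (TensorProduct.map γ.toAlg.toLinearMap LinearMap.id x)) := fun x => by
    induction x with
    | zero => simp
    | add x x' hx hx' => simp only [map_add, hx, hx']
    | tmul a m =>
      simp only [TensorProduct.map_tmul, LinearMap.rTensor_tmul, LinearMap.lTensor_tmul,
        starMap_tmul, LinearEquiv.coe_coe, hA, starA_eq hγ, ract_lact, LinearMap.id_apply,
        conjMap_apply, ofConj_toConj]
  rw [← h, γ.map_ract_coactBy M.isCoaction, M.isCoaction.coact_coactBy]

/-- The isomorphism `𝔑_M`. -/
noncomputable def fbIso (hγ : γ.IsUnitary)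
    (hA : ∀ a : A, star (γ.toAlg a) = γ.toAlg (γ.starA a))
    (hB : ∀ b : B, star (γ.toComodAlg B b) = γ.toComodAlg B (γ.starB b)) (M : RelHopf A B) :
    barObj (γ.functorObj M) ≅ γ.functorObj (barObj M) :=
  isoOfInv (Hom.mk (M := barObj (γ.functorObj M)) (N := γ.functorObj (barObj M))
      (conjCoactBy M γ.V)
      (fun b m => by
        obtain ⟨b, rfl⟩ := (γ.toComodAlg B).surjective b
        refine Eq.trans ?_ (toConj_coactBy_V_rsmulM hγ M (ofConj m) b)
        exact congrArg (fun b => toConj (M := M.carrier) (coactBy M.coact γ.V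
          ((γ.functorObj M).rsmul (ofConj m) b))) (hB b))
      (fun m b => by
        obtain ⟨b, rfl⟩ := (γ.toComodAlg B).surjective b
        refine Eq.trans ?_ (toConj_coactBy_V_lsmulM hγ M b (ofConj m))
        exact congrArg (fun b => toConj (M := M.carrier) (coactBy M.coact γ.V
          ((γ.functorObj M).lsmul b (ofConj m)))) (hB b))
      (fun m => map_toAlg_coact_V hγ hA M (ofConj m)))
    (conjCoactBy M γ.Vbar)
    (fun m => congrArg (toConj (M := M.carrier)) (γ.coactBy_Vbar_V M.isCoaction (ofConj m)))
    (fun m => congrArg (toConj (M := M.carrier)) (γ.coactBy_V_Vbar M.isCoaction (ofConj m)))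

/-- The operator of `V` turns the twist of `m ⊗ n` into the twist of `n̄ ⊗ m̄`. -/
theorem upsilonAux_coactBy_V_muAux (hγ : γ.IsUnitary) (M N : RelHopf A B) (m : M.carrier)
    (n : N.carrier) : ofConj (M := BT (barObj N) (barObj M)) (upsilonAux M N
        (coactBy (btCoact M N) γ.V (γ.muAux M N m n)))
      = γ.muAux (barObj N) (barObj M) (toConj (M := N.carrier) (coactBy N.coact γ.V n))
        (toConj (M := M.carrier) (coactBy M.coact γ.V m)) := by
  have h1 : coactBy (btCoact M N) γ.V (γ.muAux M N m n) = _ :=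
    γ.coactBy_V_contractL M.isCoaction N.isCoaction bt (btCoact_bt M N) m n
  have h2 := conj_contractL (star_dual hγ) (M := M.carrier) (N := N.carrier)
    (p := bt (M := M) (N := N)) (p' := bt (M := barObj N) (N := barObj M))
    toConj toConj ((ofConj (M := BT (barObj N) (barObj M))).comp (upsilonAux M N))
    (fun _ _ => rfl) (M.coact (coactBy M.coact γ.V m)) (N.coact (coactBy N.coact γ.V n))
  exact (congrArg ((ofConj (M := BT (barObj N) (barObj M))).comp (upsilonAux M N)) h1).trans h2

/-- The compatibility of `𝔑` with `Υ` and `φ`, with the inverses of `φ` moved to the other side. -/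
theorem fbIso_upsilon (hγ : γ.IsUnitary)
    (hA : ∀ a : A, star (γ.toAlg a) = γ.toAlg (γ.starA a))
    (hB : ∀ b : B, star (γ.toComodAlg B b) = γ.toComodAlg B (γ.starB b)) (M N : RelHopf A B) :
    barMap (γ.muHom M N) ≫ (fbIso hγ hA hB (tensor M N)).hom ≫ γ.functorMap (upsilon M N).hom
      = (upsilon (γ.functorObj M) (γ.functorObj N)).hom ≫
        tensorMap (fbIso hγ hA hB N).hom (fbIso hγ hA hB M).hom ≫
        γ.muHom (barObj N) (barObj M) :=
  bar_tensor_ext (M := γ.functorObj M) (N := γ.functorObj N) fun m n => by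
    have hL : lin (barMap (γ.muHom M N) ≫ (fbIso hγ hA hB (tensor M N)).hom ≫
        γ.functorMap (upsilon M N).hom) (toConj (M := BT (γ.functorObj M) (γ.functorObj N))
          (bt (M := γ.functorObj M) (N := γ.functorObj N) m n))
        = ofConj (M := BT (barObj N) (barObj M)) (upsilonAux M N
          (coactBy (btCoact M N) γ.V (γ.muAux M N m n))) := rfl
    have hR : lin ((upsilon (γ.functorObj M) (γ.functorObj N)).hom ≫
        tensorMap (fbIso hγ hA hB N).hom (fbIso hγ hA hB M).hom ≫
        γ.muHom (barObj N) (barObj M)) (toConj (M := BT (γ.functorObj M) (γ.functorObj N))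
          (bt (M := γ.functorObj M) (N := γ.functorObj N) m n))
        = γ.muAux (barObj N) (barObj M) (toConj (M := N.carrier) (coactBy N.coact γ.V n))
        (toConj (M := M.carrier) (coactBy M.coact γ.V m)) := rfl
    exact hL.trans ((upsilonAux_coactBy_V_muAux hγ M N m n).trans hR.symm)

/-- The natural isomorphism `𝔑`. -/
noncomputable def fbNatIso (hγ : γ.IsUnitary)
    (hA : ∀ a : A, star (γ.toAlg a) = γ.toAlg (γ.starA a))
    (hB : ∀ b : B, star (γ.toComodAlg B b) = γ.toComodAlg B (γ.starB b)) :
    γ.functor B ⋙ BarCategory.bar ≅ BarCategory.bar ⋙ γ.functor B :=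
  NatIso.ofComponents (fbIso hγ hA hB) (fun {_ N} f => hom_ext fun m =>
    congrArg (toConj (M := N.carrier)) (coactBy_natural f.hom f.map_coact γ.V (ofConj m)))

/-- `Γ` is a bar functor with `fb = 𝔑`. -/
noncomputable def barFunctor (hγ : γ.IsUnitary)
    (hA : ∀ a : A, star (γ.toAlg a) = γ.toAlg (γ.starA a))
    (hB : ∀ b : B, star (γ.toComodAlg B b) = γ.toComodAlg B (γ.starB b)) :
    BarFunctor (γ.functor B) where
  fb := fbNatIso hγ hA hB
  fb_unit := hom_ext fun b => by
    obtain ⟨b, rfl⟩ := (γ.toComodAlg B).surjective b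
    refine Eq.trans ?_ (congrArg (toConj (M := B)) (coactBy_V_starB hγ b))
    exact congrArg (fun b => toConj (M := B) (coactBy (coactB A B) γ.V
      ((γ.toComodAlg B).symm b))) (hB b)
  map_bb M := hom_ext fun m => by
    refine (congrArg (bbLin M.carrier) (γ.coactBy_Vbar_V M.isCoaction m)).symm.trans ?_
    exact (congrArg (toConj (M := Conj M.carrier))
      (coactBy_V_toConj hγ M (coactBy M.coact γ.V m))).symm
  map_upsilon M N := by
    -- the inverse `δ` of `μ` is cancelled on both sides, which leaves `fbIso_upsilon`
    have h : BarCategory.bar.map (Functor.LaxMonoidal.μ (γ.functor B) M N) ≫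
          (fbNatIso hγ hA hB).hom.app (M ⊗ N) ≫ (γ.functor B).map (BarCategory.upsilon M N).hom
        = (BarCategory.upsilon ((γ.functor B).obj M) ((γ.functor B).obj N)).hom ≫
          ((fbNatIso hγ hA hB).hom.app N ⊗ₘ (fbNatIso hγ hA hB).hom.app M) ≫
          Functor.LaxMonoidal.μ (γ.functor B) (BarCategory.bar.obj N) (BarCategory.bar.obj M) :=
      fbIso_upsilon hγ hA hB M N
    refine (cancel_mono (Functor.LaxMonoidal.μ (γ.functor B) (BarCategory.bar.obj N)
      (BarCategory.bar.obj M))).1 ?_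
    simp only [Category.assoc, Functor.Monoidal.δ_μ, Category.comp_id]
    refine (congrArg (fun k => BarCategory.bar.map (Functor.OplaxMonoidal.δ (γ.functor B) M N) ≫ k)
      h.symm).trans ?_
    refine (Functor.map_comp_assoc _ _ _ _).symm.trans ?_
    rw [Functor.Monoidal.δ_μ, CategoryTheory.Functor.map_id]
    exact Category.id_comp _

end TwoCocycle.IsUnitary
end barTwist

end RelativeHopf

theorem mainTheorem9 (A : Type u) [Ring A] [HopfAlgebra ℂ A] [StarRing A] [StarModule ℂ A]
    [IsStarBialgebra A]
    (B : Type v) [Ring B] [Algebra ℂ B] [ComoduleAlgebra A B] [StarRing B] [StarModule ℂ B]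
    [IsStarComoduleAlgebra A B]
    (γ : TwoCocycle A) (hγ : γ.IsUnitary) :
    IsAntipode γ.antipodeTwist ∧
    ∃ (_ : StarRing γ.Alg) (_ : StarModule ℂ γ.Alg) (_ : IsStarBialgebra γ.Alg)
      (_ : StarRing (γ.ComodAlg B)) (_ : StarModule ℂ (γ.ComodAlg B))
      (_ : IsStarComoduleAlgebra γ.Alg (γ.ComodAlg B)),
      (∀ a : A, star (γ.toAlg a) = γ.toAlg (γ.starA a)) ∧
      (∀ b : B, star (γ.toComodAlg B b) = γ.toComodAlg B (γ.starB b)) ∧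
      (γ.functor B).IsEquivalence ∧
      ∃ (_ : (γ.functor B).Monoidal) (F : BarFunctor (γ.functor B)),
        (∀ b : B, RelHopf.lin (Functor.LaxMonoidal.ε (γ.functor B)) (γ.toComodAlg B b) = b) ∧
        (∀ (M N : RelHopf A B) (m : M.carrier) (n : N.carrier),
          RelHopf.lin (Functor.LaxMonoidal.μ (γ.functor B) M N)
              (RelHopf.bt (M := γ.functorObj M) (N := γ.functorObj N) m n)
            = contractL γ.toFun (RelHopf.bt (M := M) (N := N)) (M.coact m) (N.coact n)) ∧
        (∀ (M : RelHopf A B) (e : M.carrier),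
          RelHopf.lin (F.fb.hom.app M) (toConj (M := M.carrier) e)
            = γ.frakN M (toConj (M := M.carrier) e)) := by
  let sA := hγ.starRingAlg
  have mA := hγ.starModuleAlg
  have hA := hγ.isStarBialgebraAlg
  let sB := hγ.starRingComodAlg B
  have mB := hγ.starModuleComodAlg (B := B)
  have hB := hγ.isStarComoduleAlgebraComodAlg (B := B)
  exact ⟨γ.antipodeTwist_isAntipode, sA, mA, hA, sB, mB, hB, fun _ => rfl, fun _ => rfl,
    functor_isEquivalence γ, inferInstance, hγ.barFunctor (fun _ => rfl) (fun _ => rfl),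
    fun _ => rfl, fun _ _ _ _ => rfl, fun M e => (hγ.frakN_toConj M e).symm⟩
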